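/- **Setting.** Let $\Omega\subset\mathbb R^n$ be bounded and open with $C^{3,a}$ boundary for some $a\in(0,1)$, and let $\mu$ be a measure on $\Omega$ with a continuous Lebesgue density bounded away from $0$ and $\infty$. Write $L^2=L^2(\Omega,\mu)$ and let $\mathcal H^2$ be the space of $u\in L^2$ with weak partial derivatives up to order $2$ in $L^2$, with norm $\|u\|_{\mathcal H^2}^2=\|u\|_{L^2}^2+\sum_i\|\partial_iu\|_{L^2}^2+\sum_{i,j}\|\partial^2_{ij}u\|_{L^2}^2$. Let $\mathcal L$ map $\mathcal H^2$ to measurable functions on $\Omega$, with $\mathcal L0\in L^2$ and, for some constant $C$, for all $u,v\in\mathcal H^2$ and a.e. $x\in\Omega$, $$|\mathcal Lu(x)-\mathcal Lv(x)|\le C\Big[|u-v|(x)+\sum_i|\partial_iu-\partial_iv|(x)+\tfrac12\sum_{i,j}|\partial^2_{ij}u-\partial^2_{ij}v|(x)\Big].$$ Let $f\in\mathcal H^2$ have boundary trace $g\in L^2(\partial\Omega)$. Let $\eta\in C^3_b(\mathbb R^n)$ with $0<\eta<1$ in $\Omega$, $\eta=0$ and $\nabla\eta\neq0$ on $\partial\Omega$.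 Let $\sigma\in C^4_b(\mathbb R)$ be non-constant, $\tfrac12<\beta<1$, $0<\delta<\tfrac{1-\beta}2$, $\alpha>0$ and $T\ge 0$. For $N\ge1$ let $\psi^N\in C^2_b(\mathbb R)$ be increasing with $|\psi^N|\le 2N^\delta$, $\psi^N(s)=s$ for $|s|\le N^\delta$, $|(\psi^N)'|\le1$, and $F^N:=\psi^N(\psi^N)'$ Lipschitz. For $\theta=(c^i,w^i,b^i)_{i\le N}$ with $c^i,b^i\in\mathbb R$, $w^i\in\mathbb R^n$, put $$S^N(x;\theta)=N^{-\beta}\sum_{i=1}^Nc^i\sigma(w^i\cdot x+b^i),\qquad Q^N(x;\theta)=S^N(x;\theta)\eta(x)+(1-\eta(x))f(x).$$ **Training.** The initial parameters $(c_0^i,w_0^i,b_0^i)$, $i\le N$, are i.i.d. with a law (not depending on $N$) of a triple $(c,w,b)$ such that $c$ is independent of $(w,b)$, $|c|<K_0$ a.s. for some constant $K_0$, $\mathbb E[c]=0$, the law of $(w,b)$ gives positive mass to every non-empty open subset of $\mathbb R^{n+1}$, $\mathbb E|b|<\infty$, and $\mathbb E|w_k|^3<\infty$ and $\mathbb E|w_k|^{2/\beta}<\infty$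 for every $k\le n$ (the last condition follows from the previous one if $\beta\ge\frac23$). Almost surely, the parameters $\theta_t=\theta^N_t$ follow on $[0,T]$ the biased gradient flow $$\frac{d\theta_t}{dt}=-\alpha N^{2\beta-1}G^N(\theta_t),\qquad G^N(\theta)=\int_\Omega F^N\big(\mathcal LQ^N(\cdot;\theta)(x)\big)\,\nabla_\theta\big(-Q^N(x;\theta)\big)\,d\mu(x),$$ and $Q^N_t:=Q^N(\cdot;\theta_t)$. **Limit.** Let $$B(x,y)=\eta(x)\eta(y)\,\mathbb E\big[\sigma(w\cdot x+b)\sigma(w\cdot y+b)+c^2\sigma'(w\cdot x+b)\sigma'(w\cdot y+b)(x\cdot y+1)\big],\qquad(\mathcal Bv)(y)=\int_\Omega B(x,y)v(x)\,d\mu(x),$$ and let $Q:[0,T]\to\mathcal H^2$ solve $\frac{dQ_t}{dt}=\alpha\,\mathcal B\mathcal L(Q_t)$ in $\mathcal H^2$ with $Q_0=(1-\eta)f$. **Theorem.** For every fixed $t\in[0,T]$: $Q^N_t\in\mathcal H^2$ and $\mathbb E\|Q^N_t-Q_t\|_{\mathcal H^2}<\infty$ for every $N\ge1$, $$\lim_{N\to\infty}\mathbb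 E\big[\|Q^N_t-Q_t\|_{\mathcal H^2}\big]=0,$$ and $Q_t$ has the boundary trace of $f$: $Q_t|_{\partial\Omega}=g$. -/

import Mathlib

open MeasureTheory ProbabilityTheory Filter Topology Set
open scoped ContDiff

noncomputable section

namespace QPDE

/-- Euclidean space `ℝⁿ`. -/
abbrev E (n : ℕ) := EuclideanSpace ℝ (Fin n)

/-- The class `C_b^k`: the function and its derivatives up to order `k` are continuous and
bounded. -/
def IsCb {V : Type*} [NormedAddCommGroup V] [NormedSpace ℝ V] (k : ℕ) (g : V → ℝ) : Prop :=
  ContDiff ℝ k g ∧ ∀ j ≤ k, ∃ C : ℝ, ∀ x, ‖iteratedFDeriv ℝ j g x‖ ≤ C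

/-- The boundary of `Ω` is of class `C^{3,a}`: near each boundary point, and in suitable
orthonormal coordinates, `Ω` is the region strictly above the graph of a `C^{3,a}` function `γ` of
the coordinates orthogonal to a unit vector `e`. -/
def HasC3HolderBoundary {n : ℕ} (a : ℝ) (Ω : Set (E n)) : Prop :=
  ∀ x₀ ∈ frontier Ω, ∃ r > 0, ∃ e : E n, ‖e‖ = 1 ∧ ∃ γ : E n → ℝ,
    ContDiff ℝ 3 γ ∧
    (∃ C : ℝ, ∀ x y, ‖iteratedFDeriv ℝ 3 γ x - iteratedFDeriv ℝ 3 γ y‖ ≤ C * ‖x - y‖ ^ a) ∧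
    Ω ∩ Metric.ball x₀ r =
      {x | x ∈ Metric.ball x₀ r ∧ γ (x - (inner ℝ e x) • e) < inner ℝ e x}

/-- A bounded open set `Ω ⊆ ℝⁿ` with `C^{3,a}` boundary for some `a ∈ (0,1)`, together with a
density `ρ` on `Ω` which is continuous and bounded away from `0` and `∞`. -/
structure Domain (n : ℕ) where
  Ω : Set (E n)
  ρ : E n → ℝ
  isOpen : IsOpen Ω
  isBounded : Bornology.IsBounded Ω
  boundary : ∃ a : ℝ, 0 < a ∧ a < 1 ∧ HasC3HolderBoundary a Ω
  continuousOn : ContinuousOn ρ Ω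
  bounds : ∃ m M : ℝ, 0 < m ∧ ∀ x ∈ Ω, m ≤ ρ x ∧ ρ x ≤ M

namespace Domain

variable {n : ℕ} (D : Domain n)

/-- The measure `dμ = ρ dx` on `Ω`. -/
def μ : Measure (E n) :=
  (volume.restrict D.Ω).withDensity fun x => ENNReal.ofReal (D.ρ x)

/-- The surface measure on the boundary of `Ω`. -/
def surface : Measure (E n) := (Measure.hausdorffMeasure ((n : ℝ) - 1)).restrict (frontier D.Ω)

end Domain

/-- `i`-th partial derivative. -/
def partialDeriv {n : ℕ} (i : Fin n) (φ : E n → ℝ) (x : E n) : ℝ :=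
  fderiv ℝ φ x (EuclideanSpace.single i 1)

/-- Test functions: `C_c^∞(Ω)`. -/
def IsTest {n : ℕ} (Ω : Set (E n)) (φ : E n → ℝ) : Prop :=
  ContDiff ℝ ∞ φ ∧ HasCompactSupport φ ∧ tsupport φ ⊆ Ω

/-- Labels for the partial derivatives of order `0`, `1` and `2`. -/
abbrev JetIdx (n : ℕ) := Unit ⊕ Fin n ⊕ (Fin n × Fin n)

/-- Families of `L²(Ω, μ)` functions indexed by the derivatives of order at most `2`, with the norm
`(∑ ‖·‖²_{L²})^{1/2}`. -/
abbrev Jet {n : ℕ} (D : Domain n) := PiLp 2 (fun _ : JetIdx n => Lp ℝ 2 D.μ)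

/-- `U` consists of a function together with its weak partial derivatives of order one and two
(tested against `C_c^∞(Ω)` and Lebesgue measure). -/
def IsWeakJet {n : ℕ} (D : Domain n) (U : Jet D) : Prop :=
  ∀ φ : E n → ℝ, IsTest D.Ω φ →
    (∀ i, ∫ x in D.Ω, U (Sum.inl ()) x * partialDeriv i φ x =
      - ∫ x in D.Ω, U (Sum.inr (Sum.inl i)) x * φ x) ∧
    (∀ i j, ∫ x in D.Ω, U (Sum.inl ()) x * partialDeriv i (partialDeriv j φ) x =
      ∫ x in D.Ω, U (Sum.inr (Sum.inr (i, j))) x * φ x)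

section Aux

variable {n : ℕ} (D : Domain n)

lemma exists_volume_le : ∃ C : NNReal, volume.restrict D.Ω ≤ C • D.μ := by
  obtain ⟨m, M, hm, hb⟩ := D.bounds
  refine ⟨(Real.toNNReal m)⁻¹, ?_⟩
  have hne : Real.toNNReal m ≠ 0 := (Real.toNNReal_pos.2 hm).ne'
  have h1 : (Real.toNNReal m) • (volume.restrict D.Ω) ≤ D.μ := by
    have : (Real.toNNReal m) • (volume.restrict D.Ω) =
        (volume.restrict D.Ω).withDensity fun _ => ENNReal.ofReal m := by
      rw [withDensity_const]; rfl
    rw [this]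
    refine withDensity_mono ?_
    filter_upwards [ae_restrict_mem D.isOpen.measurableSet] with x hx
    exact ENNReal.ofReal_le_ofReal (hb x hx).1
  intro s
  have h2 := h1 s
  rw [Measure.smul_apply] at h2 ⊢
  rw [ENNReal.smul_def, smul_eq_mul] at h2 ⊢
  rw [ENNReal.coe_inv hne]
  rw [← ENNReal.div_eq_inv_mul, ENNReal.le_div_iff_mul_le (by simp [hne]) (by simp), mul_comm]
  exact h2

lemma absCont : volume.restrict D.Ω ≪ D.μ := by
  obtain ⟨C, hC⟩ := exists_volume_le D
  exact (Measure.absolutelyContinuous_of_le hC).trans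
    (Measure.AbsolutelyContinuous.rfl.smul_left C)

lemma memLp_volume (u : Lp ℝ 2 D.μ) : MemLp u 2 (volume.restrict D.Ω) := by
  obtain ⟨C, hC⟩ := exists_volume_le D
  exact MemLp.of_measure_le_smul (c := C) (by simp) hC (Lp.memLp u)

lemma integrable_mul (u : Lp ℝ 2 D.μ) {φ : E n → ℝ} (h : Continuous φ)
    (hc : HasCompactSupport φ) : Integrable (fun x => u x * φ x) (volume.restrict D.Ω) := by
  have h2 : MemLp φ 2 (volume.restrict D.Ω) := h.memLp_of_hasCompactSupport hc
  exact (memLp_volume D u).integrable_mul h2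

lemma integral_add_mul (u v : Lp ℝ 2 D.μ) {φ : E n → ℝ} (h : Continuous φ)
    (hc : HasCompactSupport φ) : ∫ x in D.Ω, (u + v : Lp ℝ 2 D.μ) x * φ x =
      (∫ x in D.Ω, u x * φ x) + ∫ x in D.Ω, v x * φ x := by
  rw [← integral_add (integrable_mul D u h hc) (integrable_mul D v h hc)]
  refine integral_congr_ae ?_
  filter_upwards [(absCont D).ae_le (Lp.coeFn_add u v)] with x hx
  rw [hx, Pi.add_apply, add_mul]

lemma integral_smul_mul (c : ℝ) (u : Lp ℝ 2 D.μ) (φ : E n → ℝ) :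
    ∫ x in D.Ω, (c • u : Lp ℝ 2 D.μ) x * φ x = c * ∫ x in D.Ω, u x * φ x := by
  rw [← integral_const_mul]
  refine integral_congr_ae ?_
  filter_upwards [(absCont D).ae_le (Lp.coeFn_smul c u)] with x hx
  rw [hx, Pi.smul_apply, smul_eq_mul, mul_assoc]

lemma integral_zero_mul (φ : E n → ℝ) :
    ∫ x in D.Ω, (0 : Lp ℝ 2 D.μ) x * φ x = 0 := by
  have := integral_smul_mul D 0 0 φ
  rwa [zero_smul, zero_mul] at this

lemma IsTest.partialDeriv {Ω : Set (E n)} {φ : E n → ℝ} (h : IsTest Ω φ) (i : Fin n) :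
    IsTest Ω (partialDeriv i φ) := by
  obtain ⟨h1, h2, h3⟩ := h
  refine ⟨?_, ?_, ?_⟩
  · exact (h1.fderiv_right (m := ∞) (by simp)).clm_apply contDiff_const
  · exact (h2.fderiv (𝕜 := ℝ)).comp_left
      (g := fun A : E n →L[ℝ] ℝ => A (EuclideanSpace.single i 1)) (by simp)
  · refine (closure_mono ?_).trans ((tsupport_fderiv_subset ℝ).trans h3)
    intro x hx
    simp only [Function.mem_support, ne_eq] at hx ⊢
    intro h0
    apply hx
    simp [QPDE.partialDeriv, h0]

end Aux

/-- The Sobolev space `H²(Ω, μ)`; its norm is `‖u‖² = ∑_{|α| ≤ 2} ‖D^α u‖²_{L²(μ)}`. An element is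
recorded with its weak derivatives, which are determined by it. -/
def H2 {n : ℕ} (D : Domain n) : Submodule ℝ (Jet D) where
  carrier := {U | IsWeakJet D U}
  add_mem' := by
    intro U V hU hV φ hφ
    refine ⟨fun i => ?_, fun i j => ?_⟩
    · have h1 := hφ.partialDeriv i
      simp only [PiLp.add_apply]
      rw [integral_add_mul D _ _ h1.1.continuous h1.2.1, integral_add_mul D _ _ hφ.1.continuous
        hφ.2.1, (hU φ hφ).1, (hV φ hφ).1]
      ring
    · have h1 := (hφ.partialDeriv j).partialDeriv i
      simp only [PiLp.add_apply]
      rw [integral_add_mul D _ _ h1.1.continuous h1.2.1, integral_add_mul D _ _ hφ.1.continuous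
        hφ.2.1, (hU φ hφ).2, (hV φ hφ).2]
  zero_mem' := by
    intro φ _
    simp only [PiLp.zero_apply]
    refine ⟨fun i => ?_, fun i j => ?_⟩
    · rw [integral_zero_mul, integral_zero_mul, neg_zero]
    · rw [integral_zero_mul, integral_zero_mul]
  smul_mem' := by
    intro c U hU φ hφ
    simp only [PiLp.smul_apply]
    refine ⟨fun i => ?_, fun i j => ?_⟩
    · rw [integral_smul_mul, integral_smul_mul, (hU φ hφ).1]
      ring
    · rw [integral_smul_mul, integral_smul_mul, (hU φ hφ).2]

namespace H2

variable {n : ℕ} {D : Domain n}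

/-- The underlying function. -/
def fn (u : H2 D) : E n → ℝ := u.1 (Sum.inl ())

/-- The weak derivative `∂_i u`. -/
def d1 (u : H2 D) (i : Fin n) : E n → ℝ := u.1 (Sum.inr (Sum.inl i))

/-- The weak derivative `∂²_{ij} u`. -/
def d2 (u : H2 D) (i j : Fin n) : E n → ℝ := u.1 (Sum.inr (Sum.inr (i, j)))

end H2

/-- The function `g` (up to `μ`-null sets) belongs to `H²(Ω, μ)`. -/
def MemH2 {n : ℕ} (D : Domain n) (g : E n → ℝ) : Prop := ∃ u : H2 D, H2.fn u =ᵐ[D.μ] g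

open Classical in
/-- The element of `H²(Ω, μ)` given by the function `g` (and `0` if there is none). -/
def toH2 {n : ℕ} (D : Domain n) (g : E n → ℝ) : H2 D :=
  if h : MemH2 D g then h.choose else 0

/-- `g` is the boundary trace of `u`: some functions `v k ∈ C¹(ℝⁿ)` converge to `u` in `H¹(Ω)` while
their restrictions to the boundary converge to `g` in `L²(∂Ω)`. That is, `(u, g)` is on the graph of
the continuous extension to `H¹(Ω)` of the restriction map `C¹(closure Ω) → L²(∂Ω)`. -/
def HasTrace {n : ℕ} (D : Domain n) (u : H2 D) (g : Lp ℝ 2 D.surface) : Prop :=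
  ∃ v : ℕ → E n → ℝ, (∀ k, ContDiff ℝ 1 (v k)) ∧
    Tendsto (fun k => eLpNorm (fun x => v k x - H2.fn u x) 2 D.μ) atTop (𝓝 0) ∧
    (∀ i, Tendsto (fun k => eLpNorm (fun x => partialDeriv i (v k) x - H2.d1 u i x) 2 D.μ)
      atTop (𝓝 0)) ∧
    Tendsto (fun k => eLpNorm (fun x => v k x - g x) 2 D.surface) atTop (𝓝 0)

/-- A nonlinear second order operator, Lipschitz in the 2-jet at almost every point, and square
integrable at zero. -/
structure IsLipschitzOperator {n : ℕ} (D : Domain n) (L : H2 D → (E n →ₘ[D.μ] ℝ)) : Prop where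
  lipschitz : ∃ C : ℝ, ∀ u v : H2 D, ∀ᵐ x ∂D.μ,
    |L u x - L v x| ≤ C * (|H2.fn u x - H2.fn v x| + ∑ i, |H2.d1 u i x - H2.d1 v i x| +
      (1 / 2) * ∑ i, ∑ j, |H2.d2 u i j x - H2.d2 v i j x|)
  zero : MemLp (L 0) 2 D.μ

/-- The auxiliary function. -/
structure IsAuxiliary {n : ℕ} (D : Domain n) (η : E n → ℝ) : Prop where
  cb : IsCb 3 η
  inside : ∀ x ∈ D.Ω, 0 < η x ∧ η x < 1
  boundary : ∀ x ∈ frontier D.Ω, η x = 0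
  fderiv_ne : ∀ x ∈ frontier D.Ω, fderiv ℝ η x ≠ 0

/-- The activation function. -/
structure IsActivation (σ : ℝ → ℝ) : Prop where
  cb : IsCb 4 σ
  nonconst : ¬ ∃ c, ∀ s, σ s = c

/-- `F^N = ψ^N · (ψ^N)'`. -/
def truncF (ψ : ℕ → ℝ → ℝ) (N : ℕ) (s : ℝ) : ℝ := ψ N s * deriv (ψ N) s

/-- A family of smooth truncation functions with exponent `δ`. -/
structure IsTruncation (β δ : ℝ) (ψ : ℕ → ℝ → ℝ) : Prop where
  pos : 0 < δ
  lt : δ < (1 - β) / 2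
  cb : ∀ N, 0 < N → IsCb 2 (ψ N)
  mono : ∀ N, 0 < N → Monotone (ψ N)
  bound : ∀ N : ℕ, 0 < N → ∀ s, |ψ N s| ≤ 2 * (N : ℝ) ^ δ
  eq_self : ∀ N : ℕ, 0 < N → ∀ s, |s| ≤ (N : ℝ) ^ δ → ψ N s = s
  deriv_le : ∀ N, 0 < N → ∀ s, |deriv (ψ N) s| ≤ 1
  lipschitz : ∀ N, 0 < N → ∃ K : NNReal, LipschitzWith K (truncF ψ N)

/-- Labels for the parameters `c`, `w_1, …, w_n`, `b` of one hidden unit. -/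
abbrev ParamIdx (n : ℕ) := Unit ⊕ Fin n ⊕ Unit

/-- The parameters `θ = (c^i, w^i, b^i)_i` of a network with `N` hidden units, as a Euclidean
space. -/
abbrev Param (n N : ℕ) := EuclideanSpace ℝ (Fin N × ParamIdx n)

namespace Param

variable {n N : ℕ} (θ : Param n N) (i : Fin N)

/-- The output weight `c^i`. -/
def c : ℝ := θ (i, Sum.inl ())

/-- The input weight `w^i`. -/
def w : E n := WithLp.toLp 2 fun k => θ (i, Sum.inr (Sum.inl k))

/-- The bias `b^i`. -/
def b : ℝ := θ (i, Sum.inr (Sum.inr ()))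

end Param

/-- The network `S^N(x; θ) = N^{-β} ∑ c^i σ(w^i · x + b^i)`. -/
def netS {n : ℕ} (σ : ℝ → ℝ) (β : ℝ) {N : ℕ} (θ : Param n N) (x : E n) : ℝ :=
  1 / (N : ℝ) ^ β * ∑ i, Param.c θ i * σ (inner ℝ (Param.w θ i) x + Param.b θ i)

/-- The approximator `Q^N(x; θ) = S^N(x; θ) η(x) + (1 - η(x)) f(x)`. -/
def netQ {n : ℕ} {D : Domain n} (σ : ℝ → ℝ) (β : ℝ) (η : E n → ℝ) (f : H2 D) {N : ℕ}
    (θ : Param n N) (x : E n) : ℝ :=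
  netS σ β θ x * η x + (1 - η x) * H2.fn f x

/-- The biased gradient estimator
`G^N(θ) = ∫_Ω F^N(L Q^N(x; θ)) ∇_θ(-Q^N(x; θ)) dμ(x)`. -/
def biasedGradient {n : ℕ} {D : Domain n} (L : H2 D → (E n →ₘ[D.μ] ℝ)) (σ : ℝ → ℝ) (β : ℝ)
    (η : E n → ℝ) (f : H2 D) (ψ : ℕ → ℝ → ℝ) {N : ℕ} (θ : Param n N) : Param n N :=
  ∫ x, truncF ψ N (L (toH2 D (netQ σ β η f θ)) x) •
    gradient (fun θ' : Param n N => - netQ σ β η f θ' x) θ ∂D.μ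

/-- `θ` solves, on `[0, T]`, the biased gradient flow with learning rate `α N^{2β-1}`, started from
the parameters `z i`. -/
structure IsTrainedPath {n : ℕ} {D : Domain n} (L : H2 D → (E n →ₘ[D.μ] ℝ)) (σ : ℝ → ℝ) (β : ℝ)
    (η : E n → ℝ) (f : H2 D) (ψ : ℕ → ℝ → ℝ) (α T : ℝ) {N : ℕ} (z : Fin N → ℝ × E n × ℝ)
    (θ : ℝ → Param n N) : Prop where
  init : ∀ i, (Param.c (θ 0) i, Param.w (θ 0) i, Param.b (θ 0) i) = z i
  flow : ∀ t ∈ Icc 0 T, HasDerivWithinAt θ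
    (-(α * (N : ℝ) ^ (2 * β - 1)) • biasedGradient L σ β η f ψ (θ t)) (Icc 0 T) t

/-- The law `ν` of the initial parameters `(c, w, b)` of one hidden unit. -/
structure IsInitialLaw {n : ℕ} (β : ℝ) (ν : Measure (ℝ × E n × ℝ)) : Prop where
  prob : IsProbabilityMeasure ν
  indep : IndepFun (fun z => z.1) (fun z => z.2) ν
  bounded : ∃ K₀ : ℝ, ∀ᵐ z ∂ν, |z.1| < K₀
  mean_zero : ∫ z, z.1 ∂ν = 0
  full_support : ∀ U : Set (E n × ℝ), IsOpen U → U.Nonempty → 0 < ν {z | z.2 ∈ U}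
  moment_w : ∀ k, Integrable (fun z => |z.2.1 k| ^ 3) ν
  moment_w' : ∀ k, Integrable (fun z => |z.2.1 k| ^ (2 / β)) ν
  moment_b : Integrable (fun z => |z.2.2|) ν

/-- For every `N`, the initial parameters `ξ N i`, `i < N`, are independent with law `ν`. -/
structure IsInitialization {n : ℕ} {S : Type*} [MeasurableSpace S] (P : Measure S)
    (ν : Measure (ℝ × E n × ℝ)) (ξ : (N : ℕ) → Fin N → S → ℝ × E n × ℝ) : Prop where
  measurable : ∀ N i, Measurable (ξ N i)
  law : ∀ N i, P.map (ξ N i) = ν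
  indep : ∀ N, iIndepFun (ξ N) P

/-- The limiting neural tangent kernel `B(x, y)`. -/
def kernelB {n : ℕ} (σ : ℝ → ℝ) (η : E n → ℝ) (ν : Measure (ℝ × E n × ℝ)) (x y : E n) : ℝ :=
  η x * η y * ∫ z : ℝ × E n × ℝ,
    (σ (inner ℝ z.2.1 x + z.2.2) * σ (inner ℝ z.2.1 y + z.2.2) +
      z.1 ^ 2 * deriv σ (inner ℝ z.2.1 x + z.2.2) * deriv σ (inner ℝ z.2.1 y + z.2.2) *
        (inner ℝ x y + 1)) ∂ν

/-- The integral operator `(𝓑 v)(y) = ∫_Ω B(x, y) v(x) dμ(x)`. -/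
def opB {n : ℕ} (D : Domain n) (σ : ℝ → ℝ) (η : E n → ℝ) (ν : Measure (ℝ × E n × ℝ))
    (v : E n → ℝ) (y : E n) : ℝ :=
  ∫ x, kernelB σ η ν x y * v x ∂D.μ

/-- `Q` solves on `[0, T]` the ordinary differential equation `dQ/dt = α 𝓑 L(Q)` in `H²`, with
initial value `(1 - η) f`. -/
structure IsWideLimit {n : ℕ} {D : Domain n} (L : H2 D → (E n →ₘ[D.μ] ℝ)) (σ : ℝ → ℝ)
    (η : E n → ℝ) (f : H2 D) (ν : Measure (ℝ × E n × ℝ)) (α T : ℝ) (Q : ℝ → H2 D) : Prop where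
  init : H2.fn (Q 0) =ᵐ[D.μ] fun x => (1 - η x) * H2.fn f x
  ode : ∀ t ∈ Icc 0 T, ∃ V : H2 D, H2.fn V =ᵐ[D.μ] opB D σ η ν (L (Q t)) ∧
    HasDerivWithinAt Q (α • V) (Icc 0 T) t

end QPDE

end

/-!
# Convergence of wide networks trained by a truncated biased gradient flow for a PDE

The space `H2 D` is a closed subspace of a finite product of `L²` spaces, hence a Hilbert space, and
its elements are determined by their underlying functions (`H2.ext_fn`), because weak derivatives
are. The proof views everything as an ordinary differential equation in this Hilbert space.

**The two differential equations.** A hidden unit with parameters `z = (c, w, b)` contributes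
`unitH2 z`, the class of `c η σ(w · y + b)`, and the approximator is
`(1 - η) f + N^{-β} ∑ i, unitH2 (z i)` (`netH2`). The contribution is differentiable in `z` with
values in `H²`, with partial derivatives `feature k z` (`hasDerivWithinAt_unitH2`), so that along the
flow the approximator satisfies `q' = α ∫ A(x, ·) F^N(L q)(x) dμ(x)`
(`IsTrainedPath.hasDerivWithinAt_netH2`). Here `A` is the empirical mean of the kernels
`unitKernel z (x, y) = ∑ k, feature k z x * feature k z y`. These kernels are regarded as `L²`
functions of `x` with values in the functions of `y` in `H²`: this is again a Hilbert space
(`KernelSpace`), and its pairing with `L²` is a bounded bilinear map into `H²`. The limit satisfies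
the same equation with the kernel `limitKernel`, the expectation of `unitKernel`, and without the
truncation `F^N`; that this is the operator of the statement is Fubini's theorem
(`fn_pairing_limitKernel`).

**Stability.** Since `|F^N| ≤ 2 N^δ`, each hidden unit moves by `O(N^{β - 1 + δ})`
(`exists_displacement_le`). In `unitKernel` the factor depending on `x` is measured in `L²`, where
it is bounded and Lipschitz uniformly in the weights. Only the factor depending on `y` costs two
derivatives, hence a factor `1 + |w|²`, and the kernel moves by `O(N^{β - 1 + δ})` times the mean of
`1 + |w|²` (`exists_norm_netKernel_sub_le`). The Lipschitz constant of `F^N` is not controlled, but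
`F^N(a)` differs from `b` by at most `3 |a - b|` plus four times the excess of `|b|` over `N^δ / 4`
(`IsTruncation.abs_truncF_sub_le`), and the `L²` norm of that excess along the limit tends to zero
uniformly in time by Dini's theorem (`eventually_norm_excessL2_le`). Gronwall's inequality then gives
a deterministic estimate by the sum of this excess, the initial fluctuation of the approximator,
`N^δ` times the initial fluctuation of the kernel, and `N^{2 δ + β - 1}` times the mean of `1 + |w|²`
(`exists_norm_netH2_sub_le`).

**Fluctuations.** Sums of `N` independent centred variables in a Hilbert space with a finite moment
of order `p ∈ (1, 2)` are `o(N^{1/p})` in mean (`tendsto_rpow_mul_integral_norm_sum`). The norm of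
`unitH2` grows like `|w|²`, and it is centred since `c` is centred and independent of `(w, b)`; the
moment of order `2 / β` of `w` allows `p = 1 / β`, which is what the scaling `N^{-β}` asks for. The
norm of `unitKernel` grows like `|w|²` too, and the third moment of `w` allows `p = 3 / 2`: the
fluctuation of the kernel is `o(N^{-1/3})`, which beats `N^δ` because `δ < 1 / 4`. The last term tends
to zero because `2 δ < 1 - β`. That the error is a measurable function on the probability space holds
since the flow is a locally Lipschitz function of the initial parameters
(`exists_norm_sub_le_of_isTrainedPath`, `aemeasurable_of_factor`).

**Trace.** The features are `C²` functions that vanish on the boundary, because `η` does. Hence the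
velocity of the limit lies in the closure of `smoothVanishing`, and so does `Q t - (1 - η) f`. If
`v k` are `C¹` functions which approximate `f` to first order with traces tending to `g`, and `w k`
are elements of `smoothVanishing` tending to `Q t - (1 - η) f`, then `(1 - η) v k + w k` approximates
`Q t` to first order, with the same boundary values as `v k` (`HasTrace.of_sub_mem`).
-/

noncomputable section

namespace QPDE

/-! ### Weak derivatives -/

/-- `u'` is the weak `i`-th partial derivative of `u` on `Ω`, tested against `C_c^∞(Ω)`. -/
def HasWeakDeriv {n : ℕ} (Ω : Set (E n)) (i : Fin n) (u u' : E n → ℝ) : Prop :=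
  ∀ φ : E n → ℝ, IsTest Ω φ →
    ∫ x in Ω, u x * partialDeriv i φ x = -∫ x in Ω, u' x * φ x

section WeakDeriv

variable {n : ℕ} {Ω : Set (E n)}

lemma continuous_partialDeriv {χ : E n → ℝ} (h : ContDiff ℝ 1 χ) (i : Fin n) :
    Continuous (partialDeriv i χ) :=
  (h.continuous_fderiv one_ne_zero).clm_apply continuous_const

lemma contDiff_partialDeriv {χ : E n → ℝ} {k : ℕ} (h : ContDiff ℝ (k + 1 : ℕ) χ) (i : Fin n) :
    ContDiff ℝ k (partialDeriv i χ) :=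
  (h.fderiv_right (m := k) (by norm_cast)).clm_apply contDiff_const

lemma hasCompactSupport_partialDeriv {χ : E n → ℝ} (h : HasCompactSupport χ) (i : Fin n) :
    HasCompactSupport (partialDeriv i χ) :=
  (h.fderiv (𝕜 := ℝ)).comp_left
    (g := fun A : E n →L[ℝ] ℝ => A (EuclideanSpace.single i 1)) (by simp)

lemma partialDeriv_mul {f g : E n → ℝ} {x : E n} (hf : DifferentiableAt ℝ f x)
    (hg : DifferentiableAt ℝ g x) (i : Fin n) :
    partialDeriv i (fun y => f y * g y) x = partialDeriv i f x * g x + f x * partialDeriv i g x := by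
  simp only [partialDeriv, fderiv_fun_mul hf hg]
  simp; ring

lemma partialDeriv_add {f g : E n → ℝ} {x : E n} (hf : DifferentiableAt ℝ f x)
    (hg : DifferentiableAt ℝ g x) (i : Fin n) :
    partialDeriv i (fun y => f y + g y) x = partialDeriv i f x + partialDeriv i g x := by
  simp [partialDeriv, fderiv_fun_add hf hg]

/-- Mollification: a compactly supported `C¹` function is a `C¹` limit of test functions. -/
lemma exists_test_approx (hΩ : IsOpen Ω) {χ : E n → ℝ} (h1 : ContDiff ℝ 1 χ)
    (hc : HasCompactSupport χ) (hs : tsupport χ ⊆ Ω) (i : Fin n) {ε : ℝ} (hε : 0 < ε) :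
    ∃ φ, IsTest Ω φ ∧ (∀ x, |φ x - χ x| ≤ ε) ∧
      ∀ x, |partialDeriv i φ x - partialDeriv i χ x| ≤ ε := by
  obtain ⟨r₀, hr₀, hthick⟩ := hc.isCompact.exists_thickening_subset_open hΩ hs
  have hcp := hasCompactSupport_partialDeriv hc i
  have hu1 : UniformContinuous χ := hc.uniformContinuous_of_continuous h1.continuous
  have hu2 : UniformContinuous (partialDeriv i χ) :=
    hcp.uniformContinuous_of_continuous (continuous_partialDeriv h1 i)
  obtain ⟨r₁, hr₁, H1⟩ := Metric.uniformContinuous_iff.1 hu1 ε hε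
  obtain ⟨r₂, hr₂, H2⟩ := Metric.uniformContinuous_iff.1 hu2 ε hε
  set r := min r₀ (min r₁ r₂) / 2 with hr
  have hrpos : 0 < r := by positivity
  have hlt : r < min r₀ (min r₁ r₂) := by rw [hr]; exact half_lt_self (by positivity)
  let B : ContDiffBump (0 : E n) := ⟨r / 2, r, by positivity, by linarith⟩
  have hBint : LocallyIntegrable (B.normed volume) volume :=
    (B.continuous_normed.integrable_of_hasCompactSupport B.hasCompactSupport_normed).locallyIntegrable
  set φ := convolution (B.normed volume) χ (ContinuousLinearMap.lsmul ℝ ℝ) volume with hφ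
  have hsupp : tsupport φ ⊆ Ω := by
    have h2 : Function.support φ ⊆ Metric.cthickening r (tsupport χ) := by
      refine (support_convolution_subset _).trans ?_
      rw [B.support_normed_eq]
      rintro x ⟨a, ha, b, hb, rfl⟩
      refine Metric.mem_cthickening_of_dist_le _ b _ _ (subset_tsupport _ hb) ?_
      rw [mem_ball_zero_iff] at ha
      simpa [dist_eq_norm] using ha.le
    refine (closure_minimal h2 Metric.isClosed_cthickening).trans ?_
    exact (Metric.cthickening_subset_thickening' hr₀ (hlt.trans_le (min_le_left _ _)) _).trans hthick
  refine ⟨φ, ⟨?_, ?_, hsupp⟩, ?_, ?_⟩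
  · exact B.hasCompactSupport_normed.contDiff_convolution_left (n := ⊤) _ B.contDiff_normed
      h1.continuous.locallyIntegrable
  · exact B.hasCompactSupport_normed.convolution _ hc
  · intro x
    rw [← Real.dist_eq]
    refine ContDiffBump.dist_normed_convolution_le h1.continuous.aestronglyMeasurable ?_
    intro y hy
    exact (H1 ((Metric.mem_ball.1 hy).trans (hlt.trans_le
      ((min_le_right _ _).trans (min_le_left _ _))))).le
  · intro x
    have : partialDeriv i φ x =
        convolution (B.normed volume) (partialDeriv i χ) (ContinuousLinearMap.lsmul ℝ ℝ) volume x := by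
      rw [partialDeriv, (hc.hasFDerivAt_convolution_right (ContinuousLinearMap.lsmul ℝ ℝ) hBint h1
        x).fderiv, convolution_precompR_apply _ hBint (hc.fderiv (𝕜 := ℝ))
        (h1.continuous_fderiv one_ne_zero)]
      rfl
    rw [this, ← Real.dist_eq]
    refine ContDiffBump.dist_normed_convolution_le
      (continuous_partialDeriv h1 i).aestronglyMeasurable ?_
    intro y hy
    exact (H2 ((Metric.mem_ball.1 hy).trans (hlt.trans_le
      ((min_le_right _ _).trans (min_le_right _ _))))).le

lemma abs_integral_mul_sub_le {ν : Measure (E n)} {u f g : E n → ℝ} (hu : Integrable u ν)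
    (hf : Integrable (fun x => u x * f x) ν) (hg : Integrable (fun x => u x * g x) ν) {ε : ℝ}
    (h : ∀ x, |f x - g x| ≤ ε) :
    |(∫ x, u x * f x ∂ν) - ∫ x, u x * g x ∂ν| ≤ ε * ∫ x, |u x| ∂ν := by
  rw [← integral_sub hf hg, ← integral_const_mul]
  refine (abs_integral_le_integral_abs).trans (integral_mono_of_nonneg (ae_of_all _ fun x => abs_nonneg _)
    (hu.abs.const_mul _) (ae_of_all _ fun x => ?_))
  simp only
  rw [← mul_sub, abs_mul, mul_comm]
  exact mul_le_mul_of_nonneg_right (h x) (abs_nonneg _)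

lemma integrable_mul_of_hasCompactSupport {ν : Measure (E n)} {u f : E n → ℝ} (hu : Integrable u ν)
    (hf : Continuous f) (hc : HasCompactSupport f) : Integrable (fun x => u x * f x) ν := by
  obtain ⟨C, hC⟩ := hf.bounded_above_of_compact_support hc
  exact hu.mul_bdd (c := C) hf.aestronglyMeasurable (ae_of_all _ hC)

/-- A weak derivative may be tested against compactly supported `C¹` functions. -/
lemma HasWeakDeriv.integral_eq (hΩ : IsOpen Ω) {i : Fin n} {u u' : E n → ℝ}
    (h : HasWeakDeriv Ω i u u') (hu : IntegrableOn u Ω) (hu' : IntegrableOn u' Ω) {χ : E n → ℝ}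
    (h1 : ContDiff ℝ 1 χ) (hc : HasCompactSupport χ) (hs : tsupport χ ⊆ Ω) :
    ∫ x in Ω, u x * partialDeriv i χ x = -∫ x in Ω, u' x * χ x := by
  have key : ∀ ε > 0, |(∫ x in Ω, u x * partialDeriv i χ x) + ∫ x in Ω, u' x * χ x| ≤
      ε * ((∫ x in Ω, |u x|) + ∫ x in Ω, |u' x|) := by
    intro ε hε
    obtain ⟨φ, hφ, ha, hb⟩ := exists_test_approx hΩ h1 hc hs i hε
    have e := h φ hφ
    have hp := hφ.partialDeriv i
    have A := abs_integral_mul_sub_le (ν := volume.restrict Ω) hu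
      (integrable_mul_of_hasCompactSupport hu hp.1.continuous hp.2.1)
      (integrable_mul_of_hasCompactSupport hu (continuous_partialDeriv h1 i)
        (hasCompactSupport_partialDeriv hc i)) hb
    have B := abs_integral_mul_sub_le (ν := volume.restrict Ω) hu'
      (integrable_mul_of_hasCompactSupport hu' hφ.1.continuous hφ.2.1)
      (integrable_mul_of_hasCompactSupport hu' h1.continuous hc) ha
    rw [abs_le] at *
    constructor <;> nlinarith [A.1, A.2, B.1, B.2]
  set S := (∫ x in Ω, |u x|) + ∫ x in Ω, |u' x|
  have hS : 0 ≤ S := add_nonneg (integral_nonneg fun _ => abs_nonneg _)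
    (integral_nonneg fun _ => abs_nonneg _)
  have h0 : |(∫ x in Ω, u x * partialDeriv i χ x) + ∫ x in Ω, u' x * χ x| ≤ 0 := by
    refine le_of_forall_pos_le_add fun ε hε => ?_
    have := key (ε / (S + 1)) (by positivity)
    refine this.trans ?_
    rw [div_mul_eq_mul_div, zero_add, div_le_iff₀ (by positivity)]
    nlinarith
  have := abs_nonpos_iff.1 h0
  linarith

/-- The Leibniz rule for a weak derivative and a `C¹` multiplier. -/
lemma HasWeakDeriv.mul (hΩ : IsOpen Ω) {i : Fin n} {u u' m : E n → ℝ}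
    (h : HasWeakDeriv Ω i u u') (hu : IntegrableOn u Ω) (hu' : IntegrableOn u' Ω)
    (hm : ContDiff ℝ 1 m) :
    HasWeakDeriv Ω i (fun x => m x * u x) (fun x => partialDeriv i m x * u x + m x * u' x) := by
  intro φ hφ
  have hφ1 : ContDiff ℝ 1 φ := hφ.1.of_le (by norm_cast)
  have e := h.integral_eq hΩ hu hu' (χ := fun x => m x * φ x) (hm.mul hφ1) hφ.2.1.mul_left
    ((tsupport_mul_subset_right).trans hφ.2.2)
  have hd : ∀ x, partialDeriv i (fun y => m y * φ y) x =
      partialDeriv i m x * φ x + m x * partialDeriv i φ x := fun x =>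
    partialDeriv_mul (hm.differentiable one_ne_zero x) (hφ1.differentiable one_ne_zero x) i
  have c1 : HasCompactSupport fun x => partialDeriv i m x * φ x := hφ.2.1.mul_left
  have c2 : HasCompactSupport fun x => m x * partialDeriv i φ x := (hφ.partialDeriv i).2.1.mul_left
  have c3 : HasCompactSupport fun x => m x * φ x := hφ.2.1.mul_left
  have k1 : Continuous fun x => partialDeriv i m x * φ x :=
    (continuous_partialDeriv hm i).mul hφ.1.continuous
  have k2 : Continuous fun x => m x * partialDeriv i φ x :=
    hm.continuous.mul (hφ.partialDeriv i).1.continuous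
  have k3 : Continuous fun x => m x * φ x := hm.continuous.mul hφ.1.continuous
  simp only [hd, mul_add] at e
  rw [integral_add (integrable_mul_of_hasCompactSupport (ν := volume.restrict Ω) hu k1 c1)
    (integrable_mul_of_hasCompactSupport (ν := volume.restrict Ω) hu k2 c2)] at e
  have e1 : ∫ x in Ω, (m x * u x) * partialDeriv i φ x =
      ∫ x in Ω, u x * (m x * partialDeriv i φ x) := by congr 1; ext x; ring
  have e2 : ∫ x in Ω, (partialDeriv i m x * u x + m x * u' x) * φ x =
      (∫ x in Ω, u x * (partialDeriv i m x * φ x)) + ∫ x in Ω, u' x * (m x * φ x) := by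
    rw [← integral_add (integrable_mul_of_hasCompactSupport (ν := volume.restrict Ω) hu k1 c1)
      (integrable_mul_of_hasCompactSupport (ν := volume.restrict Ω) hu' k3 c3)]
    congr 1; ext x; ring
  rw [e1, e2]; linarith

lemma setIntegral_mul_eq_integral {u φ : E n → ℝ} (hs : tsupport φ ⊆ Ω) :
    ∫ x in Ω, u x * φ x = ∫ x, u x * φ x := by
  refine setIntegral_eq_integral_of_forall_compl_eq_zero fun x hx => ?_
  rw [image_eq_zero_of_notMem_tsupport fun h => hx (hs h), mul_zero]

lemma hasWeakDeriv_of_contDiff {h : E n → ℝ} (hh : ContDiff ℝ 1 h) (i : Fin n) :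
    HasWeakDeriv Ω i h (partialDeriv i h) := by
  intro φ hφ
  rw [setIntegral_mul_eq_integral (hφ.partialDeriv i).2.2, setIntegral_mul_eq_integral hφ.2.2]
  have hφ1 : ContDiff ℝ 1 φ := hφ.1.of_le (by norm_cast)
  have hp := hφ.partialDeriv i
  exact integral_mul_fderiv_eq_neg_fderiv_mul_of_integrable (μ := volume)
    (v := EuclideanSpace.single i 1)
    (((continuous_partialDeriv hh i).mul hφ.1.continuous).integrable_of_hasCompactSupport
      hφ.2.1.mul_left)
    ((hh.continuous.mul hp.1.continuous).integrable_of_hasCompactSupport hp.2.1.mul_left)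
    ((hh.continuous.mul hφ.1.continuous).integrable_of_hasCompactSupport hφ.2.1.mul_left)
    (fun x _ => hh.differentiable one_ne_zero x) (fun x _ => hφ1.differentiable one_ne_zero x)

lemma HasWeakDeriv.congr {i : Fin n} {u u' v v' : E n → ℝ} (h : HasWeakDeriv Ω i u u')
    (e : u =ᵐ[volume.restrict Ω] v) (e' : u' =ᵐ[volume.restrict Ω] v') :
    HasWeakDeriv Ω i v v' := by
  intro φ hφ
  have h1 : ∫ x in Ω, v x * partialDeriv i φ x = ∫ x in Ω, u x * partialDeriv i φ x :=
    integral_congr_ae (by filter_upwards [e] with x hx; rw [hx])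
  have h2 : ∫ x in Ω, v' x * φ x = ∫ x in Ω, u' x * φ x :=
    integral_congr_ae (by filter_upwards [e'] with x hx; rw [hx])
  rw [h1, h2, h φ hφ]

/-- Weak derivatives are unique. -/
lemma HasWeakDeriv.ae_eq_zero (hΩ : IsOpen Ω) {i : Fin n} {u u' : E n → ℝ}
    (h : HasWeakDeriv Ω i u u') (hu : u =ᵐ[volume.restrict Ω] 0) (hu' : IntegrableOn u' Ω) :
    u' =ᵐ[volume.restrict Ω] 0 := by
  have := hΩ.ae_eq_zero_of_integral_contDiff_smul_eq_zero (f := u') (μ := volume)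
    hu'.locallyIntegrableOn (fun g h1 h2 h3 => by
      have e := h g ⟨h1, h2, h3⟩
      have e0 : ∫ x in Ω, u x * partialDeriv i g x = 0 := by
        rw [← integral_zero (E n) ℝ (μ := volume.restrict Ω)]
        exact integral_congr_ae (by filter_upwards [hu] with x hx; simp [hx])
      rw [e0, setIntegral_mul_eq_integral h3] at e
      have : ∫ x, g x • u' x = ∫ x, u' x * g x := by congr 1; ext x; simp [mul_comm]
      rw [this]; linarith)
  rw [Filter.EventuallyEq, ae_restrict_iff' hΩ.measurableSet]
  exact this

end WeakDeriv

/-! ### The space `H²` as a Hilbert space of functions -/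

section SobolevSpace

variable {n : ℕ} {D : Domain n}

lemma Domain.μ_ac (D : Domain n) : D.μ ≪ volume.restrict D.Ω :=
  withDensity_absolutelyContinuous _ _

lemma Domain.ae_mem (D : Domain n) : ∀ᵐ x ∂D.μ, x ∈ D.Ω :=
  (D.μ_ac).ae_le (ae_restrict_mem D.isOpen.measurableSet)

instance (D : Domain n) : IsFiniteMeasure (volume.restrict D.Ω) :=
  ⟨by rw [Measure.restrict_apply_univ]; exact D.isBounded.measure_lt_top⟩

instance (D : Domain n) : IsFiniteMeasure D.μ := by
  obtain ⟨m, M, -, hb⟩ := D.bounds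
  refine isFiniteMeasure_withDensity (ne_of_lt ?_)
  calc ∫⁻ x in D.Ω, ENNReal.ofReal (D.ρ x) ≤ ∫⁻ _ in D.Ω, ENNReal.ofReal M :=
        lintegral_mono_ae (by
          filter_upwards [ae_restrict_mem D.isOpen.measurableSet] with x hx
          exact ENNReal.ofReal_le_ofReal (hb x hx).2)
    _ < ⊤ := by
        rw [lintegral_const]
        exact ENNReal.mul_lt_top (by simp) (measure_lt_top _ _)

lemma integrableOn_coe (u : Lp ℝ 2 D.μ) : IntegrableOn u D.Ω :=
  (memLp_volume D u).integrable (by norm_num)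

lemma isWeakJet_iff (U : Jet D) : IsWeakJet D U ↔
    (∀ i, HasWeakDeriv D.Ω i (U (Sum.inl ())) (U (Sum.inr (Sum.inl i)))) ∧
    ∀ i j, HasWeakDeriv D.Ω j (U (Sum.inr (Sum.inl i))) (U (Sum.inr (Sum.inr (i, j)))) := by
  constructor
  · intro h
    refine ⟨fun i φ hφ => (h φ hφ).1 i, fun i j φ hφ => ?_⟩
    have h1 := (h φ hφ).2 i j
    have h2 := (h _ (hφ.partialDeriv j)).1 i
    linarith
  · rintro ⟨h1, h2⟩ φ hφ
    refine ⟨fun i => h1 i φ hφ, fun i j => ?_⟩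
    have e1 := h1 i _ (hφ.partialDeriv j)
    have e2 := h2 i j φ hφ
    linarith

/-- The inclusion of `H²` into `L²`. -/
def incl (D : Domain n) : H2 D →L[ℝ] Lp ℝ 2 D.μ :=
  (PiLp.proj 2 (fun _ : JetIdx n => Lp ℝ 2 D.μ) (Sum.inl ())).comp (H2 D).subtypeL

lemma coe_incl (u : H2 D) : (incl D u : E n → ℝ) = H2.fn u := rfl

lemma incl_injective : Function.Injective (incl D) := by
  rw [injective_iff_map_eq_zero]
  intro u hu
  have hu0 : u.1 (Sum.inl ()) = 0 := hu
  obtain ⟨h1, h2⟩ := (isWeakJet_iff u.1).1 u.2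
  have z0 : (u.1 (Sum.inl ()) : E n → ℝ) =ᵐ[volume.restrict D.Ω] 0 := by
    rw [hu0]; exact (absCont D).ae_le (Lp.coeFn_zero ..)
  have z1 : ∀ i, (u.1 (Sum.inr (Sum.inl i)) : E n → ℝ) =ᵐ[volume.restrict D.Ω] 0 := fun i =>
    (h1 i).ae_eq_zero D.isOpen z0 (integrableOn_coe _)
  have z2 : ∀ i j, (u.1 (Sum.inr (Sum.inr (i, j))) : E n → ℝ) =ᵐ[volume.restrict D.Ω] 0 :=
    fun i j => (h2 i j).ae_eq_zero D.isOpen (z1 i) (integrableOn_coe _)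
  have key : ∀ k, u.1 k = 0 := by
    rintro (⟨⟩ | i | ⟨i, j⟩)
    · exact hu0
    · exact (Lp.eq_zero_iff_ae_eq_zero).2 (D.μ_ac.ae_le (z1 i))
    · exact (Lp.eq_zero_iff_ae_eq_zero).2 (D.μ_ac.ae_le (z2 i j))
  ext1
  ext1 k
  exact key k

/-- Elements of `H²` are determined by the underlying function. -/
lemma H2.ext_fn {u v : H2 D} (h : H2.fn u =ᵐ[D.μ] H2.fn v) : u = v :=
  incl_injective (Lp.ext h)

lemma toH2_eq {g : E n → ℝ} {u : H2 D} (h : H2.fn u =ᵐ[D.μ] g) : toH2 D g = u := by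
  have hg : MemH2 D g := ⟨u, h⟩
  rw [toH2, dif_pos hg]
  exact H2.ext_fn (hg.choose_spec.trans h.symm)

lemma exists_abs_integral_mul_le {φ : E n → ℝ} (h : Continuous φ) (hc : HasCompactSupport φ) :
    ∃ c : ℝ, ∀ u : Lp ℝ 2 D.μ, |∫ x in D.Ω, u x * φ x| ≤ c * ‖u‖ := by
  obtain ⟨C, hC⟩ := exists_volume_le D
  have h2 : MemLp φ 2 (volume.restrict D.Ω) := h.memLp_of_hasCompactSupport hc
  set A : ENNReal := (C : ENNReal) ^ (1 / (2 : ENNReal).toReal) with hA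
  have ne : A ≠ ⊤ := by simp [hA]
  refine ⟨A.toReal * (eLpNorm φ 2 (volume.restrict D.Ω)).toReal, fun u => ?_⟩
  have hu := memLp_volume D u
  have e1 : eLpNorm u 2 (volume.restrict D.Ω) ≤ A * eLpNorm u 2 D.μ := by
    refine (eLpNorm_mono_measure _ hC).trans (le_of_eq ?_)
    rw [show C • D.μ = (C : ENNReal) • D.μ from rfl, eLpNorm_smul_measure_of_ne_top (by simp)]
    simp [hA]
  have e2 : |∫ x in D.Ω, u x * φ x| ≤ (eLpNorm ((u : E n → ℝ) • φ) 1 (volume.restrict D.Ω)).toReal := by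
    have hi : Integrable ((u : E n → ℝ) • φ) (volume.restrict D.Ω) := integrable_mul D u h hc
    have := integral_norm_eq_lintegral_enorm hi.1
    rw [eLpNorm_one_eq_lintegral_enorm, ← this]
    exact norm_integral_le_integral_norm ((u : E n → ℝ) • φ)
  have e3 : eLpNorm ((u : E n → ℝ) • φ) 1 (volume.restrict D.Ω) ≤
      eLpNorm u 2 (volume.restrict D.Ω) * eLpNorm φ 2 (volume.restrict D.Ω) :=
    eLpNorm_smul_le_mul_eLpNorm h2.1 hu.1
  refine e2.trans ?_
  have e4 : eLpNorm ((u : E n → ℝ) • φ) 1 (volume.restrict D.Ω) ≤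
      A * eLpNorm u 2 D.μ * eLpNorm φ 2 (volume.restrict D.Ω) := e3.trans (mul_le_mul_left e1 _)
  have ne' : A * eLpNorm u 2 D.μ * eLpNorm φ 2 (volume.restrict D.Ω) ≠ ⊤ :=
    ENNReal.mul_ne_top (ENNReal.mul_ne_top ne (Lp.memLp u).2.ne) h2.2.ne
  refine (ENNReal.toReal_mono ne' e4).trans (le_of_eq ?_)
  rw [ENNReal.toReal_mul, ENNReal.toReal_mul, Lp.norm_def]
  ring

lemma continuous_integral_mul {φ : E n → ℝ} (h : Continuous φ) (hc : HasCompactSupport φ) :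
    Continuous fun u : Lp ℝ 2 D.μ => ∫ x in D.Ω, u x * φ x := by
  obtain ⟨c, hc'⟩ := exists_abs_integral_mul_le (D := D) h hc
  exact continuous_of_linear_of_bound (𝕜 := ℝ) (fun u v => integral_add_mul D u v h hc)
    (fun a u => integral_smul_mul D a u φ) hc'

lemma isClosed_H2 (D : Domain n) : IsClosed (H2 D : Set (Jet D)) := by
  have hc : ∀ k, Continuous fun U : Jet D => U k := fun k =>
    (PiLp.proj (𝕜 := ℝ) 2 (fun _ : JetIdx n => Lp ℝ 2 D.μ) k).continuous
  have : (H2 D : Set (Jet D)) = ⋂ (φ : E n → ℝ) (hφ : IsTest D.Ω φ),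
      ({U : Jet D | ∀ i, ∫ x in D.Ω, U (Sum.inl ()) x * partialDeriv i φ x =
        - ∫ x in D.Ω, U (Sum.inr (Sum.inl i)) x * φ x} ∩
      {U : Jet D | ∀ i j, ∫ x in D.Ω, U (Sum.inl ()) x * partialDeriv i (partialDeriv j φ) x =
        ∫ x in D.Ω, U (Sum.inr (Sum.inr (i, j))) x * φ x}) := by
    ext U
    simp only [mem_iInter, mem_inter_iff, mem_ofPred_eq]
    rfl
  rw [this]
  refine isClosed_iInter fun φ => isClosed_iInter fun hφ => IsClosed.inter ?_ ?_
  · simp only [ofPred_forall]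
    refine isClosed_iInter fun i => isClosed_eq ?_ ?_
    · exact (continuous_integral_mul (hφ.partialDeriv i).1.continuous
        (hφ.partialDeriv i).2.1).comp (hc _)
    · exact ((continuous_integral_mul hφ.1.continuous hφ.2.1).comp (hc _)).neg
  · simp only [ofPred_forall]
    refine isClosed_iInter fun i => isClosed_iInter fun j => isClosed_eq ?_ ?_
    · have := (hφ.partialDeriv j).partialDeriv i
      exact (continuous_integral_mul this.1.continuous this.2.1).comp (hc _)
    · exact (continuous_integral_mul hφ.1.continuous hφ.2.1).comp (hc _)

instance (D : Domain n) : CompleteSpace (H2 D) := (isClosed_H2 D).completeSpace_coe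

/-- The element of `H²` with given components, which are functions satisfying the relations between
a function and its weak derivatives. -/
def ofJet (u : JetIdx n → Lp ℝ 2 D.μ)
    (h1 : ∀ i, HasWeakDeriv D.Ω i (u (Sum.inl ())) (u (Sum.inr (Sum.inl i))))
    (h2 : ∀ i j, HasWeakDeriv D.Ω j (u (Sum.inr (Sum.inl i))) (u (Sum.inr (Sum.inr (i, j))))) :
    H2 D :=
  ⟨WithLp.toLp 2 u, (isWeakJet_iff _).2 ⟨h1, h2⟩⟩

lemma continuous_memLp {h : E n → ℝ} (hh : Continuous h) : MemLp h 2 D.μ := by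
  have hK : IsCompact (closure D.Ω) := D.isBounded.isCompact_closure
  obtain ⟨C, hC⟩ := hK.exists_bound_of_continuousOn hh.continuousOn
  refine MemLp.of_bound hh.aestronglyMeasurable C ?_
  filter_upwards [D.ae_mem] with x hx using hC x (subset_closure hx)

/-- The class in `L²` of a continuous function. -/
def ofCont (D : Domain n) {h : E n → ℝ} (hh : Continuous h) : Lp ℝ 2 D.μ :=
  (continuous_memLp (D := D) hh).toLp h

lemma coe_ofCont {h : E n → ℝ} (hh : Continuous h) : ofCont D hh =ᵐ[D.μ] h :=
  MemLp.coeFn_toLp _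

lemma coe_ofCont' {h : E n → ℝ} (hh : Continuous h) : ofCont D hh =ᵐ[volume.restrict D.Ω] h :=
  (absCont D).ae_le (coe_ofCont hh)

/-- The element of `H²` given by a `C²` function. -/
def ofC2 (D : Domain n) {h : E n → ℝ} (hh : ContDiff ℝ 2 h) : H2 D :=
  ofJet (fun k => match k with
    | Sum.inl _ => ofCont D hh.continuous
    | Sum.inr (Sum.inl i) => ofCont D (contDiff_partialDeriv (k := 1) hh i).continuous
    | Sum.inr (Sum.inr (i, j)) =>
        ofCont D (continuous_partialDeriv (contDiff_partialDeriv (k := 1) hh i) j))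
    (fun i => (hasWeakDeriv_of_contDiff (hh.of_le (by norm_num)) i).congr (coe_ofCont' _).symm
      (coe_ofCont' _).symm)
    (fun i j => (hasWeakDeriv_of_contDiff (contDiff_partialDeriv (k := 1) hh i) j).congr
      (coe_ofCont' _).symm (coe_ofCont' _).symm)

lemma fn_ofC2 {h : E n → ℝ} (hh : ContDiff ℝ 2 h) : H2.fn (ofC2 D hh) =ᵐ[D.μ] h :=
  coe_ofCont hh.continuous

lemma d1_ofC2 {h : E n → ℝ} (hh : ContDiff ℝ 2 h) (i : Fin n) :
    H2.d1 (ofC2 D hh) i =ᵐ[D.μ] partialDeriv i h :=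
  coe_ofCont (contDiff_partialDeriv (k := 1) hh i).continuous

lemma memLp_continuous_mul {m : E n → ℝ} (hm : Continuous m) (u : Lp ℝ 2 D.μ) :
    MemLp (fun x => m x * u x) 2 D.μ := by
  have hK : IsCompact (closure D.Ω) := D.isBounded.isCompact_closure
  obtain ⟨C, hC⟩ := hK.exists_bound_of_continuousOn hm.continuousOn
  refine (Lp.memLp u).of_le_mul (c := C) (hm.aestronglyMeasurable.mul (Lp.aestronglyMeasurable u)) ?_
  filter_upwards [D.ae_mem] with x hx
  rw [norm_mul]
  exact mul_le_mul_of_nonneg_right (hC x (subset_closure hx)) (norm_nonneg _)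

lemma HasWeakDeriv.add {Ω : Set (E n)} {i : Fin n} {u u' v v' : E n → ℝ} (h : HasWeakDeriv Ω i u u')
    (h' : HasWeakDeriv Ω i v v') (hu : IntegrableOn u Ω) (hu' : IntegrableOn u' Ω)
    (hv : IntegrableOn v Ω) (hv' : IntegrableOn v' Ω) :
    HasWeakDeriv Ω i (fun x => u x + v x) (fun x => u' x + v' x) := by
  intro φ hφ
  have hp := hφ.partialDeriv i
  simp only [add_mul]
  rw [integral_add (integrable_mul_of_hasCompactSupport hu hp.1.continuous hp.2.1)
    (integrable_mul_of_hasCompactSupport hv hp.1.continuous hp.2.1), h φ hφ, h' φ hφ,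
    integral_add (integrable_mul_of_hasCompactSupport hu' hφ.1.continuous hφ.2.1)
    (integrable_mul_of_hasCompactSupport hv' hφ.1.continuous hφ.2.1)]
  ring

/-- `H²` is stable under multiplication by `C²` functions, with the Leibniz rule. -/
lemma exists_mul {m : E n → ℝ} (hm : ContDiff ℝ 2 m) (f : H2 D) :
    ∃ u : H2 D, H2.fn u =ᵐ[D.μ] (fun x => m x * H2.fn f x) ∧
      ∀ i, H2.d1 u i =ᵐ[D.μ] fun x => partialDeriv i m x * H2.fn f x + m x * H2.d1 f i x := by
  obtain ⟨h1, h2⟩ := (isWeakJet_iff f.1).1 f.2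
  have hm1 : ContDiff ℝ 1 m := hm.of_le (by norm_num)
  have hp : ∀ i, ContDiff ℝ 1 (partialDeriv i m) := fun i => contDiff_partialDeriv (k := 1) hm i
  have L0 := memLp_continuous_mul (D := D) hm1.continuous (f.1 (Sum.inl ()))
  have L1 : ∀ i, MemLp (fun x => partialDeriv i m x * f.1 (Sum.inl ()) x +
      m x * f.1 (Sum.inr (Sum.inl i)) x) 2 D.μ := fun i =>
    (memLp_continuous_mul (hp i).continuous _).add (memLp_continuous_mul hm1.continuous _)
  have L2 : ∀ i j, MemLp (fun x => (partialDeriv j (partialDeriv i m) x * f.1 (Sum.inl ()) x +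
      partialDeriv i m x * f.1 (Sum.inr (Sum.inl j)) x) +
      (partialDeriv j m x * f.1 (Sum.inr (Sum.inl i)) x +
        m x * f.1 (Sum.inr (Sum.inr (i, j))) x)) 2 D.μ := fun i j =>
    ((memLp_continuous_mul (continuous_partialDeriv (hp i) j) _).add
      (memLp_continuous_mul (hp i).continuous _)).add
    ((memLp_continuous_mul (hp j).continuous _).add
      (memLp_continuous_mul hm1.continuous _))
  have I : ∀ {m : E n → ℝ} (_ : Continuous m) (k : JetIdx n),
      IntegrableOn (fun x => m x * f.1 k x) D.Ω := fun hm k => by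
    have := integrableOn_coe ((memLp_continuous_mul hm (f.1 k)).toLp _)
    exact this.congr ((absCont D).ae_le (MemLp.coeFn_toLp _))
  have ae : ∀ {h : E n → ℝ} (hh : MemLp h 2 D.μ), h =ᵐ[volume.restrict D.Ω] hh.toLp h := fun hh =>
    (absCont D).ae_le (MemLp.coeFn_toLp hh).symm
  refine ⟨ofJet (fun k => match k with
    | Sum.inl _ => L0.toLp _
    | Sum.inr (Sum.inl i) => (L1 i).toLp _
    | Sum.inr (Sum.inr (i, j)) => (L2 i j).toLp _) ?_ ?_, MemLp.coeFn_toLp L0,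
    fun i => MemLp.coeFn_toLp (L1 i)⟩
  · intro i
    exact ((h1 i).mul D.isOpen (integrableOn_coe _) (integrableOn_coe _) hm1).congr (ae L0) (ae (L1 i))
  · intro i j
    refine HasWeakDeriv.congr ?_ (ae (L1 i)) (ae (L2 i j))
    exact ((h1 j).mul D.isOpen (integrableOn_coe _) (integrableOn_coe _) (hp i)).add
      ((h2 i j).mul D.isOpen (integrableOn_coe _) (integrableOn_coe _) hm1)
      (I (hp i).continuous _) ((I (continuous_partialDeriv (hp i) j) _).add (I (hp i).continuous _))
      (I hm1.continuous _) ((I (hp j).continuous _).add (I hm1.continuous _))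

end SobolevSpace

/-! ### Ridge functions as `L²`- and `H²`-valued functions of their parameters -/

section Ridge

variable {n : ℕ} {D : Domain n}

/-- The ridge function `y ↦ m(y) τ(w · y + b)`. -/
def ridgeFn {n : ℕ} (m : E n → ℝ) (τ : ℝ → ℝ) (p : E n × ℝ) (y : E n) : ℝ :=
  m y * τ (inner ℝ p.1 y + p.2)

lemma continuous_ridgeFn {m : E n → ℝ} {τ : ℝ → ℝ} (hm : Continuous m) (hτ : Continuous τ) :
    Continuous fun q : (E n × ℝ) × E n => ridgeFn m τ q.1 q.2 := by
  unfold ridgeFn; fun_prop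

lemma continuous_ridgeFn_right {m : E n → ℝ} {τ : ℝ → ℝ} (hm : Continuous m) (hτ : Continuous τ)
    (p : E n × ℝ) : Continuous (ridgeFn m τ p) := by
  unfold ridgeFn; fun_prop

lemma contDiff_ridgeFn {m : E n → ℝ} {τ : ℝ → ℝ} {k : WithTop ℕ∞} (hm : ContDiff ℝ k m)
    (hτ : ContDiff ℝ k τ) (p : E n × ℝ) : ContDiff ℝ k (ridgeFn m τ p) :=
  hm.mul (hτ.comp ((contDiff_const.inner ℝ contDiff_id).add contDiff_const))

/-- The class in `L²` of a ridge function. -/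
def ridge (D : Domain n) {m : E n → ℝ} {τ : ℝ → ℝ} (hm : Continuous m) (hτ : Continuous τ)
    (p : E n × ℝ) : Lp ℝ 2 D.μ :=
  ofCont D (continuous_ridgeFn_right hm hτ p)

lemma coe_ridge {m : E n → ℝ} {τ : ℝ → ℝ} (hm : Continuous m) (hτ : Continuous τ)
    (p : E n × ℝ) : ridge D hm hτ p =ᵐ[D.μ] ridgeFn m τ p :=
  coe_ofCont _

/-- The square root of the mass of `μ`. -/
def rootMass (D : Domain n) : ℝ := (measureUnivNNReal D.μ : ℝ) ^ (2 : ENNReal).toReal⁻¹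

lemma rootMass_nonneg : 0 ≤ rootMass D := by unfold rootMass; positivity

lemma norm_le_rootMass {u : Lp ℝ 2 D.μ} {C : ℝ} (hC : 0 ≤ C) (h : ∀ᵐ x ∂D.μ, |u x| ≤ C) :
    ‖u‖ ≤ rootMass D * C := Lp.norm_le_of_ae_bound hC h

lemma exists_bound_on (D : Domain n) {m : E n → ℝ} (hm : Continuous m) :
    ∃ M, 0 ≤ M ∧ ∀ y ∈ D.Ω, |m y| ≤ M := by
  obtain ⟨C, hC⟩ := D.isBounded.isCompact_closure.exists_bound_of_continuousOn hm.continuousOn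
  exact ⟨max C 0, le_max_right _ _, fun y hy => (hC y (subset_closure hy)).trans (le_max_left _ _)⟩

lemma exists_norm_bound (D : Domain n) : ∃ R, 0 ≤ R ∧ ∀ y ∈ D.Ω, ‖y‖ ≤ R := by
  obtain ⟨M, h0, h⟩ := exists_bound_on D (continuous_norm (E := E n))
  exact ⟨M, h0, fun y hy => by simpa using h y hy⟩

lemma exists_norm_ridge_le {m : E n → ℝ} {τ : ℝ → ℝ} (hm : Continuous m) (hτ : Continuous τ)
    (hb : ∃ S, ∀ s, |τ s| ≤ S) : ∃ C, 0 ≤ C ∧ ∀ p, ‖ridge D hm hτ p‖ ≤ C := by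
  obtain ⟨S, hS⟩ := hb
  obtain ⟨M, hM0, hM⟩ := exists_bound_on D hm
  have hS0 : 0 ≤ S := (abs_nonneg _).trans (hS 0)
  refine ⟨rootMass D * (M * S), mul_nonneg rootMass_nonneg (by positivity), fun p => ?_⟩
  refine norm_le_rootMass (by positivity) ?_
  filter_upwards [coe_ridge hm hτ p, D.ae_mem] with x hx hxΩ
  rw [hx, ridgeFn, abs_mul]
  exact mul_le_mul (hM x hxΩ) (hS _) (abs_nonneg _) hM0

/-- First order Taylor expansion of a `C¹` function, uniformly on bounded intervals. -/
lemma exists_taylor {τ : ℝ → ℝ} (hτ : ContDiff ℝ 1 τ) (U : ℝ) {ε : ℝ} (hε : 0 < ε) :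
    ∃ δ > 0, ∀ u ∈ Icc (-U) U, ∀ v ∈ Icc (-U) U, |v - u| < δ →
      |τ v - τ u - deriv τ u * (v - u)| ≤ ε * |v - u| := by
  have huc := isCompact_Icc (a := -U) (b := U) |>.uniformContinuousOn_of_continuous
    (hτ.continuous_deriv le_rfl).continuousOn
  obtain ⟨δ, hδ, H⟩ := Metric.uniformContinuousOn_iff.1 huc ε hε
  refine ⟨δ, hδ, fun u hu v hv huv => ?_⟩
  have hd : ∀ x, DifferentiableAt ℝ τ x := fun x => hτ.differentiable one_ne_zero x
  have hseg : uIcc u v ⊆ Icc (-U) U := uIcc_subset_Icc hu hv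
  have := Convex.norm_image_sub_le_of_norm_hasDerivWithin_le (s := uIcc u v)
    (f := fun x => τ x - deriv τ u * x) (f' := fun x => deriv τ x - deriv τ u) (C := ε)
    (x := u) (y := v)
    (fun x _ => by
      simpa using! ((hd x).hasDerivAt.sub ((hasDerivAt_id x).const_mul (deriv τ u))).hasDerivWithinAt)
    (fun x hx => by
      rw [← dist_eq_norm]
      refine (H x (hseg hx) u hu ?_).le
      rw [Real.dist_eq]
      have : |x - u| ≤ |v - u| := abs_sub_left_of_mem_uIcc hx
      exact this.trans_lt huv)
    (convex_uIcc u v) left_mem_uIcc right_mem_uIcc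
  simp only [Real.norm_eq_abs] at this
  convert this using 2
  ring

/-- The linear map `(v, s) ↦ ∑_k v_k x_k + s x'`. -/
def affineComb {V : Type*} [NormedAddCommGroup V] [NormedSpace ℝ V] (x : Fin n → V) (x' : V) :
    (E n × ℝ) →L[ℝ] V :=
  (∑ k, ((EuclideanSpace.proj k : E n →L[ℝ] ℝ).smulRight (x k)).comp
      (ContinuousLinearMap.fst ℝ (E n) ℝ)) +
    (ContinuousLinearMap.snd ℝ (E n) ℝ).smulRight x'

lemma affineComb_apply {V : Type*} [NormedAddCommGroup V] [NormedSpace ℝ V] (x : Fin n → V)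
    (x' : V) (q : E n × ℝ) : affineComb x x' q = ∑ k, q.1 k • x k + q.2 • x' := by
  simp [affineComb]

lemma norm_affineComb_le {V : Type*} [NormedAddCommGroup V] [NormedSpace ℝ V] (x : Fin n → V)
    (x' : V) : ‖affineComb x x'‖ ≤ ∑ k, ‖x k‖ + ‖x'‖ := by
  refine ContinuousLinearMap.opNorm_le_bound _ (by positivity) fun q => ?_
  rw [affineComb_apply, add_mul, Finset.sum_mul]
  refine (norm_add_le _ _).trans (add_le_add ((norm_sum_le _ _).trans
    (Finset.sum_le_sum fun k _ => ?_)) ?_)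
  · rw [norm_smul, mul_comm]
    refine mul_le_mul_of_nonneg_left ?_ (norm_nonneg _)
    exact (PiLp.norm_apply_le q.1 k).trans (norm_fst_le q)
  · rw [norm_smul, mul_comm]
    exact mul_le_mul_of_nonneg_left (norm_snd_le q) (norm_nonneg _)

lemma inner_eq_sum (v y : E n) : inner ℝ v y = ∑ k, v k * y k := by
  simp [PiLp.inner_apply, mul_comm]

lemma continuous_mul_coord {m : E n → ℝ} (hm : Continuous m) (k : Fin n) :
    Continuous fun y : E n => m y * y k := by fun_prop

lemma coeFn_finsetSum {ι α : Type*} {mα : MeasurableSpace α} {μ : Measure α} (s : Finset ι)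
    (f : ι → Lp ℝ 2 μ) : (∑ i ∈ s, f i : Lp ℝ 2 μ) =ᵐ[μ] fun x => ∑ i ∈ s, f i x := by
  classical
  induction s using Finset.induction_on with
  | empty => simpa using! Lp.coeFn_zero ℝ 2 μ
  | insert a s ha ih =>
    rw [Finset.sum_insert ha]
    filter_upwards [Lp.coeFn_add (f a) (∑ i ∈ s, f i), ih] with x e1 e2
    rw [e1, Pi.add_apply, e2, Finset.sum_insert ha]

lemma coeFn_affineComb {x : Fin n → Lp ℝ 2 D.μ} {x' : Lp ℝ 2 D.μ} (q : E n × ℝ) :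
    affineComb x x' q =ᵐ[D.μ] fun y => ∑ k, q.1 k * x k y + q.2 * x' y := by
  rw [affineComb_apply]
  have h1 : ∀ k, (q.1 k • x k : Lp ℝ 2 D.μ) =ᵐ[D.μ] fun y => q.1 k * x k y := fun k =>
    Lp.coeFn_smul _ _
  filter_upwards [Lp.coeFn_add (∑ k, q.1 k • x k) (q.2 • x'), Lp.coeFn_smul q.2 x',
    coeFn_finsetSum Finset.univ (fun k => q.1 k • x k), ae_all_iff.2 h1] with y e1 e2 e3 e4
  rw [e1, Pi.add_apply, e2, e3]
  simp [e4]

/-- `L²`-valued ridge functions are differentiable in the parameters. -/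
lemma hasFDerivAt_ridge {m : E n → ℝ} {τ : ℝ → ℝ} (hm : Continuous m) (hτ : ContDiff ℝ 1 τ)
    (p : E n × ℝ) :
    HasFDerivAt (ridge D hm hτ.continuous)
      (affineComb (fun k => ridge D (continuous_mul_coord hm k) (hτ.continuous_deriv le_rfl) p)
        (ridge D hm (hτ.continuous_deriv le_rfl) p)) p := by
  obtain ⟨M, hM0, hM⟩ := exists_bound_on D hm
  obtain ⟨R, hR0, hR⟩ := exists_norm_bound D
  rw [hasFDerivAt_iff_isLittleO, Asymptotics.isLittleO_iff]
  intro c hc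
  set A := rootMass D * (M * (R + 1)) + 1 with hA
  have hA0 : 0 < A := by
    have := rootMass_nonneg (D := D)
    positivity
  obtain ⟨δ, hδ, H⟩ := exists_taylor hτ (‖p.1‖ * R + |p.2| + (R + 1)) (ε := c / A) (by positivity)
  have hev : ∀ᶠ q in 𝓝 p, ‖q - p‖ < min 1 (δ / (R + 1)) := by
    have := Metric.ball_mem_nhds p (ε := min 1 (δ / (R + 1))) (by positivity)
    filter_upwards [this] with q hq
    rwa [Metric.mem_ball, dist_eq_norm] at hq
  filter_upwards [hev] with q hq
  have hq1 : ‖q - p‖ < 1 := hq.trans_le (min_le_left _ _)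
  have hq2 : (R + 1) * ‖q - p‖ < δ := by
    have := hq.trans_le (min_le_right _ _)
    rwa [lt_div_iff₀' (by positivity)] at this
  set r := ‖q - p‖ with hr
  have hr0 : 0 ≤ r := norm_nonneg _
  have main : ‖ridge D hm hτ.continuous q - ridge D hm hτ.continuous p - affineComb
      (fun k => ridge D (continuous_mul_coord hm k) (hτ.continuous_deriv le_rfl) p)
        (ridge D hm (hτ.continuous_deriv le_rfl) p) (q - p)‖ ≤
      rootMass D * (M * (c / A * ((R + 1) * r))) := by
    refine norm_le_rootMass (by positivity) ?_
    have h1 : ∀ k, ridge D (continuous_mul_coord hm k) (hτ.continuous_deriv le_rfl) p =ᵐ[D.μ]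
      ridgeFn (fun y => m y * y k) (deriv τ) p := fun k => coe_ridge _ _ p
    filter_upwards [Lp.coeFn_sub (ridge D hm hτ.continuous q - ridge D hm hτ.continuous p)
      (affineComb (fun k => ridge D (continuous_mul_coord hm k) (hτ.continuous_deriv le_rfl) p)
        (ridge D hm (hτ.continuous_deriv le_rfl) p) (q - p)),
      Lp.coeFn_sub (ridge D hm hτ.continuous q) (ridge D hm hτ.continuous p),
      coeFn_affineComb (D := D) (x := fun k => ridge D (continuous_mul_coord hm k)
        (hτ.continuous_deriv le_rfl) p)
        (x' := ridge D hm (hτ.continuous_deriv le_rfl) p) (q - p),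
      coe_ridge hm hτ.continuous q, coe_ridge hm hτ.continuous p, ae_all_iff.2 h1,
      coe_ridge hm (hτ.continuous_deriv le_rfl) p, D.ae_mem] with y e1 e2 e3 e4 e5 e6 e7 hy
    rw [e1, Pi.sub_apply, e2, Pi.sub_apply, e3, e4, e5, e7]
    simp only [e6]
    set u := inner ℝ p.1 y + p.2 with hu
    set v := inner ℝ q.1 y + q.2 with hv
    have hyR := hR y hy
    have huv' : v - u = inner ℝ (q - p).1 y + (q - p).2 := by
      simp only [hu, hv, Prod.fst_sub, Prod.snd_sub, inner_sub_left]; ring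
    have huv : |v - u| ≤ (R + 1) * r := by
      rw [huv']
      have a1 : |inner ℝ (q - p).1 y| ≤ r * R :=
        (abs_real_inner_le_norm _ _).trans (mul_le_mul (norm_fst_le _) hyR (norm_nonneg _) hr0)
      have a2 : |(q - p).2| ≤ r := norm_snd_le (q - p)
      calc _ ≤ |inner ℝ (q - p).1 y| + |(q - p).2| := abs_add_le _ _
        _ ≤ r * R + r := add_le_add a1 a2
        _ = _ := by ring
    have hub : |u| ≤ ‖p.1‖ * R + |p.2| := by
      refine (abs_add_le _ _).trans (add_le_add ((abs_real_inner_le_norm _ _).trans ?_) le_rfl)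
      exact mul_le_mul_of_nonneg_left hyR (norm_nonneg _)
    have hvb : |v| ≤ ‖p.1‖ * R + |p.2| + (R + 1) := by
      have : |v| ≤ |u| + |v - u| := by
        have := abs_add_le u (v - u); simpa using this
      nlinarith
    have key := H u (abs_le.1 (by linarith)) v (abs_le.1 hvb) (huv.trans_lt hq2)
    have e8 : ridgeFn m τ q y - ridgeFn m τ p y - (∑ k, (q - p).1 k *
        ridgeFn (fun y => m y * y k) (deriv τ) p y + (q - p).2 * ridgeFn m (deriv τ) p y) =
        m y * (τ v - τ u - deriv τ u * (v - u)) := by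
      simp only [ridgeFn, ← hu, ← hv]
      rw [huv', inner_eq_sum]
      have : ∑ k, (q - p).1 k * (m y * y k * deriv τ u) =
          m y * deriv τ u * ∑ k, (q - p).1 k * y k := by
        rw [Finset.mul_sum]; exact Finset.sum_congr rfl fun k _ => by ring
      rw [this]; ring
    rw [e8, abs_mul]
    refine mul_le_mul (hM y hy) (key.trans ?_) (abs_nonneg _) hM0
    exact mul_le_mul_of_nonneg_left huv (by positivity)
  refine main.trans ?_
  have : rootMass D * (M * (c / A * ((R + 1) * r))) = (c * r) * ((rootMass D * (M * (R + 1))) / A) := by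
    ring
  rw [this]
  refine mul_le_of_le_one_right (by positivity) ?_
  rw [div_le_one hA0, hA]; linarith

end Ridge

section RidgeH2

variable {n : ℕ} {D : Domain n}

/-- The element of `H²` given by a ridge function. -/
def ridgeH2 (D : Domain n) {m : E n → ℝ} {τ : ℝ → ℝ} (hm : ContDiff ℝ 2 m) (hτ : ContDiff ℝ 2 τ)
    (p : E n × ℝ) : H2 D :=
  ofC2 D (contDiff_ridgeFn hm hτ p)

lemma incl_ridgeH2 {m : E n → ℝ} {τ : ℝ → ℝ} (hm : ContDiff ℝ 2 m) (hτ : ContDiff ℝ 2 τ)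
    (p : E n × ℝ) : incl D (ridgeH2 D hm hτ p) = ridge D hm.continuous hτ.continuous p := rfl

lemma partialDeriv_ridgeFn {m : E n → ℝ} {τ : ℝ → ℝ} (hm : ContDiff ℝ 1 m) (hτ : ContDiff ℝ 1 τ)
    (p : E n × ℝ) (i : Fin n) (y : E n) :
    partialDeriv i (ridgeFn m τ p) y =
      ridgeFn (partialDeriv i m) τ p y + p.1 i * ridgeFn m (deriv τ) p y := by
  have hd : HasFDerivAt (fun y : E n => inner ℝ p.1 y + p.2) (innerSL ℝ p.1) y :=
    ((innerSL ℝ p.1).hasFDerivAt).add_const p.2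
  have h2 := (hτ.differentiable one_ne_zero (inner ℝ p.1 y + p.2)).hasDerivAt.comp_hasFDerivAt y hd
  have e : partialDeriv i (fun y => τ (inner ℝ p.1 y + p.2)) y =
      deriv τ (inner ℝ p.1 y + p.2) * p.1 i := by
    have := h2.fderiv
    simp only [partialDeriv]
    rw [show (fun y => τ (inner ℝ p.1 y + p.2)) = τ ∘ fun y => inner ℝ p.1 y + p.2 from rfl, this]
    simp [EuclideanSpace.inner_single_right]
  have := partialDeriv_mul (hm.differentiable one_ne_zero y) h2.differentiableAt i
  simp only [ridgeFn]
  refine this.trans ?_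
  rw [show (τ ∘ fun y => inner ℝ p.1 y + p.2) = (fun y => τ (inner ℝ p.1 y + p.2)) from rfl, e]
  ring

lemma ofCont_add_smul {f g h : E n → ℝ} (hf : Continuous f) (hg : Continuous g) (hh : Continuous h)
    (c : ℝ) (e : ∀ y, f y = g y + c * h y) :
    ofCont D hf = ofCont D hg + c • ofCont D hh := by
  apply Lp.ext
  filter_upwards [coe_ofCont (D := D) hf, coe_ofCont (D := D) hg, coe_ofCont (D := D) hh,
    Lp.coeFn_add (ofCont D hg) (c • ofCont D hh), Lp.coeFn_smul c (ofCont D hh)] with y e1 e2 e3 e4 e5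
  rw [e1, e4, Pi.add_apply, e5, Pi.smul_apply, e2, e3, e y, smul_eq_mul]

lemma ridgeH2_d1 {m : E n → ℝ} {τ : ℝ → ℝ} (hm : ContDiff ℝ 2 m) (hτ : ContDiff ℝ 2 τ)
    (p : E n × ℝ) (i : Fin n) :
    (ridgeH2 D hm hτ p).1 (Sum.inr (Sum.inl i)) =
      ridge D (contDiff_partialDeriv (k := 1) hm i).continuous hτ.continuous p +
      p.1 i • ridge D hm.continuous (hτ.continuous_deriv (by norm_num)) p :=
  ofCont_add_smul (contDiff_partialDeriv (k := 1) (contDiff_ridgeFn hm hτ p) i).continuous _ _ _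
    fun y => partialDeriv_ridgeFn (hm.of_le (by norm_num)) (hτ.of_le (by norm_num)) p i y

lemma contDiff_deriv {τ : ℝ → ℝ} {k : ℕ} (h : ContDiff ℝ (k + 1 : ℕ) τ) : ContDiff ℝ k (deriv τ) :=
  (contDiff_succ_iff_deriv (n := k)).1 (by exact_mod_cast h) |>.2.2

lemma ridgeH2_d2 {m : E n → ℝ} {τ : ℝ → ℝ} (hm : ContDiff ℝ 2 m) (hτ : ContDiff ℝ 2 τ)
    (p : E n × ℝ) (i j : Fin n) :
    (ridgeH2 D hm hτ p).1 (Sum.inr (Sum.inr (i, j))) =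
      (ridge D (continuous_partialDeriv (contDiff_partialDeriv (k := 1) hm i) j) hτ.continuous p +
      p.1 j • ridge D (contDiff_partialDeriv (k := 1) hm i).continuous
        (hτ.continuous_deriv (by norm_num)) p) +
      p.1 i • (ridge D (contDiff_partialDeriv (k := 1) hm j).continuous
          (hτ.continuous_deriv (by norm_num)) p +
        p.1 j • ridge D hm.continuous
          ((contDiff_deriv (k := 1) hτ).continuous_deriv le_rfl) p) := by
  have hm1 : ContDiff ℝ 1 m := hm.of_le (by norm_num)
  have hτ1 : ContDiff ℝ 1 τ := hτ.of_le (by norm_num)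
  have hmi := contDiff_partialDeriv (k := 1) hm i
  have hτ' := contDiff_deriv (k := 1) hτ
  have c1 := continuous_partialDeriv (contDiff_ridgeFn hmi hτ1 p) j
  have c2 := continuous_partialDeriv (contDiff_ridgeFn hm1 hτ' p) j
  refine (ofCont_add_smul (D := D) (hf := continuous_partialDeriv
    (contDiff_partialDeriv (k := 1) (contDiff_ridgeFn hm hτ p) i) j) c1 c2 (p.1 i) ?_).trans ?_
  · intro y
    have : partialDeriv i (ridgeFn m τ p) = fun y =>
        ridgeFn (partialDeriv i m) τ p y + p.1 i * ridgeFn m (deriv τ) p y :=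
      funext fun y => partialDeriv_ridgeFn hm1 hτ1 p i y
    have d1 := (contDiff_ridgeFn hmi hτ1 p).differentiable one_ne_zero y
    have d2 := (contDiff_ridgeFn hm1 hτ' p).differentiable one_ne_zero y
    rw [this, partialDeriv_add d1 (d2.const_mul _)]
    simp only [partialDeriv]
    rw [fderiv_const_mul d2]
    simp
  · congr 1
    · exact ofCont_add_smul _ _ _ _ fun y => partialDeriv_ridgeFn hmi hτ1 p j y
    · congr 1
      exact ofCont_add_smul _ _ _ _ fun y => partialDeriv_ridgeFn hm1 hτ' p j y

lemma differentiable_ridge {m : E n → ℝ} {τ : ℝ → ℝ} (hm : Continuous m) (hτ : ContDiff ℝ 1 τ) :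
    Differentiable ℝ (ridge D hm hτ.continuous) :=
  fun p => (hasFDerivAt_ridge hm hτ p).differentiableAt

lemma differentiable_ridgeH2 {m : E n → ℝ} {τ : ℝ → ℝ} (hm : ContDiff ℝ 2 m)
    (hτ : ContDiff ℝ 3 τ) :
    Differentiable ℝ (ridgeH2 D hm (hτ.of_le (by norm_num) : ContDiff ℝ 2 τ)) := by
  have hτ2 : ContDiff ℝ 2 τ := hτ.of_le (by norm_num)
  have hτ1 : ContDiff ℝ 1 τ := hτ.of_le (by norm_num)
  have hτ' : ContDiff ℝ 2 (deriv τ) := contDiff_deriv (k := 2) hτ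
  have hτ'1 : ContDiff ℝ 1 (deriv τ) := hτ'.of_le (by norm_num)
  have hτ'' : ContDiff ℝ 1 (deriv (deriv τ)) := contDiff_deriv (k := 1) hτ'
  have hc : ∀ i : Fin n, Differentiable ℝ fun p : E n × ℝ => p.1 i := fun i =>
    ((EuclideanSpace.proj i : E n →L[ℝ] ℝ).comp (ContinuousLinearMap.fst ℝ (E n) ℝ)).differentiable
  have hJ : Differentiable ℝ fun p => (ridgeH2 D hm hτ2 p).1 := by
    rw [differentiable_piLp]
    rintro (⟨⟩ | i | ⟨i, j⟩)
    · exact differentiable_ridge hm.continuous hτ1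
    · simp only [ridgeH2_d1]
      exact (differentiable_ridge _ hτ1).add ((hc i).smul (differentiable_ridge _ hτ'1))
    · simp only [ridgeH2_d2]
      exact ((differentiable_ridge _ hτ1).add ((hc j).smul (differentiable_ridge _ hτ'1))).add
        ((hc i).smul ((differentiable_ridge _ hτ'1).add ((hc j).smul (differentiable_ridge _ hτ''))))
  have : ridgeH2 D hm hτ2 = fun p => (H2 D).orthogonalProjectionOnto (ridgeH2 D hm hτ2 p).1 := by
    funext p
    exact (Submodule.orthogonalProjectionOnto_mem_subspace_eq_self _).symm
  rw [this]
  exact ((H2 D).orthogonalProjectionOnto.differentiable).comp hJ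

lemma contDiff_mul_coord {m : E n → ℝ} {k : WithTop ℕ∞} (hm : ContDiff ℝ k m) (i : Fin n) :
    ContDiff ℝ k fun y : E n => m y * y i :=
  hm.mul ((EuclideanSpace.proj i : E n →L[ℝ] ℝ).contDiff)

/-- The derivative of an `H²`-valued ridge function in its parameters; it is identified through its
image in `L²`. -/
lemma hasFDerivAt_ridgeH2 {m : E n → ℝ} {τ : ℝ → ℝ} (hm : ContDiff ℝ 2 m)
    (hτ : ContDiff ℝ 3 τ) (p : E n × ℝ) :
    HasFDerivAt (ridgeH2 D hm (hτ.of_le (by norm_num) : ContDiff ℝ 2 τ))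
      (affineComb (fun k => ridgeH2 D (contDiff_mul_coord hm k) (contDiff_deriv (k := 2) hτ) p)
        (ridgeH2 D hm (contDiff_deriv (k := 2) hτ) p)) p := by
  have hτ1 : ContDiff ℝ 1 τ := hτ.of_le (by norm_num)
  have h1 := (differentiable_ridgeH2 (D := D) hm hτ p).hasFDerivAt
  have h2 := (incl D).hasFDerivAt.comp p h1
  have h3 := hasFDerivAt_ridge (D := D) hm.continuous hτ1 p
  have e := h2.unique h3
  refine h1.congr_fderiv (ContinuousLinearMap.ext fun q => incl_injective ?_)
  have := congrArg (fun A => A q) e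
  simp only [ContinuousLinearMap.comp_apply] at this
  rw [this, affineComb_apply, affineComb_apply]
  simp only [map_add, map_sum, map_smul, incl_ridgeH2]

lemma Jet.norm_le_sum (U : Jet D) : ‖U‖ ≤ ∑ k, ‖U k‖ := by
  rw [PiLp.norm_eq_of_L2]
  refine Real.sqrt_le_iff.2 ⟨by positivity, ?_⟩
  exact Finset.sum_sq_le_sq_sum_of_nonneg fun i _ => norm_nonneg _

lemma exists_norm_ridgeH2_le {m : E n → ℝ} {τ : ℝ → ℝ} (hm : ContDiff ℝ 2 m) (hτ : ContDiff ℝ 2 τ)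
    (h0 : ∃ S, ∀ s, |τ s| ≤ S) (h1 : ∃ S, ∀ s, |deriv τ s| ≤ S)
    (h2 : ∃ S, ∀ s, |deriv (deriv τ) s| ≤ S) :
    ∃ C, 0 ≤ C ∧ ∀ p, ‖ridgeH2 D hm hτ p‖ ≤ C * (1 + ‖p.1‖ ^ 2) := by
  have hsq : ∀ a : ℝ, 0 ≤ a → a ≤ 1 + a ^ 2 ∧ (1 : ℝ) ≤ 1 + a ^ 2 ∧ a * a ≤ 1 + a ^ 2 := fun a ha =>
    ⟨by nlinarith [sq_nonneg (a - 1)], by nlinarith, by nlinarith⟩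
  have hw : ∀ (p : E n × ℝ) i, |p.1 i| ≤ ‖p.1‖ := fun p i => PiLp.norm_apply_le p.1 i
  have key : ∀ k, ∃ C, 0 ≤ C ∧ ∀ p, ‖(ridgeH2 D hm hτ p).1 k‖ ≤ C * (1 + ‖p.1‖ ^ 2) := by
    rintro (⟨⟩ | i | ⟨i, j⟩)
    · obtain ⟨C, hC0, hC⟩ := exists_norm_ridge_le (D := D) hm.continuous hτ.continuous h0
      refine ⟨C, hC0, fun p => (hC p).trans ?_⟩
      have := (hsq _ (norm_nonneg p.1)).2.1
      nlinarith
    · obtain ⟨C, hC0, hC⟩ := exists_norm_ridge_le (D := D)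
        (contDiff_partialDeriv (k := 1) hm i).continuous hτ.continuous h0
      obtain ⟨C', hC0', hC'⟩ := exists_norm_ridge_le (D := D)
        hm.continuous (hτ.continuous_deriv (by norm_num)) h1
      refine ⟨C + C', by positivity, fun p => ?_⟩
      rw [ridgeH2_d1]
      refine (norm_add_le _ _).trans ?_
      rw [norm_smul, Real.norm_eq_abs, add_mul]
      obtain ⟨q1, q2, q3⟩ := hsq _ (norm_nonneg p.1)
      refine add_le_add ((hC p).trans (le_mul_of_one_le_right hC0 q2)) ?_
      rw [mul_comm]
      exact mul_le_mul (hC' p) ((hw p i).trans q1) (abs_nonneg _) hC0'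
    · obtain ⟨C1, hC01, hC1⟩ := exists_norm_ridge_le (D := D)
        (continuous_partialDeriv (contDiff_partialDeriv (k := 1) hm i) j) hτ.continuous h0
      obtain ⟨C2, hC02, hC2⟩ := exists_norm_ridge_le (D := D)
        (contDiff_partialDeriv (k := 1) hm i).continuous (hτ.continuous_deriv (by norm_num)) h1
      obtain ⟨C3, hC03, hC3⟩ := exists_norm_ridge_le (D := D)
        (contDiff_partialDeriv (k := 1) hm j).continuous (hτ.continuous_deriv (by norm_num)) h1
      obtain ⟨C4, hC04, hC4⟩ := exists_norm_ridge_le (D := D)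
        hm.continuous ((contDiff_deriv (k := 1) hτ).continuous_deriv le_rfl) h2
      refine ⟨C1 + C2 + (C3 + C4), by positivity, fun p => ?_⟩
      obtain ⟨q1, q2, q3⟩ := hsq _ (norm_nonneg p.1)
      rw [ridgeH2_d2, smul_add, smul_smul]
      refine (norm_add_le _ _).trans ((add_le_add (norm_add_le _ _) (norm_add_le _ _)).trans ?_)
      rw [norm_smul, norm_smul, norm_smul, Real.norm_eq_abs, Real.norm_eq_abs, Real.norm_eq_abs,
        abs_mul, add_mul, add_mul C1, add_mul C3]
      refine add_le_add (add_le_add ((hC1 p).trans (le_mul_of_one_le_right hC01 q2)) ?_)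
        (add_le_add ?_ ?_)
      · rw [mul_comm]
        exact mul_le_mul (hC2 p) ((hw p j).trans q1) (abs_nonneg _) hC02
      · rw [mul_comm]
        exact mul_le_mul (hC3 p) ((hw p i).trans q1) (abs_nonneg _) hC03
      · rw [mul_comm]
        refine mul_le_mul (hC4 p) (le_trans ?_ q3) (by positivity) hC04
        exact mul_le_mul (hw p i) (hw p j) (abs_nonneg _) (norm_nonneg _)
  choose C hC0 hC using key
  refine ⟨∑ k, C k, Finset.sum_nonneg fun k _ => hC0 k, fun p => ?_⟩
  refine (Jet.norm_le_sum (ridgeH2 D hm hτ p).1).trans ?_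
  rw [Finset.sum_mul]
  exact Finset.sum_le_sum fun k _ => hC k p

/-- A local Lipschitz estimate for `H²`-valued ridge functions: the Lipschitz constant grows
quadratically in the weights. -/
lemma exists_norm_ridgeH2_sub_le {m : E n → ℝ} {τ : ℝ → ℝ} (hm : ContDiff ℝ 2 m)
    (hτ : ContDiff ℝ 3 τ) (h1 : ∃ S, ∀ s, |deriv τ s| ≤ S)
    (h2 : ∃ S, ∀ s, |deriv (deriv τ) s| ≤ S) (h3 : ∃ S, ∀ s, |deriv (deriv (deriv τ)) s| ≤ S) :
    ∃ C, 0 ≤ C ∧ ∀ R p q, ‖p.1‖ ≤ R → ‖q.1‖ ≤ R →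
      ‖ridgeH2 D hm (hτ.of_le (by norm_num) : ContDiff ℝ 2 τ) q -
        ridgeH2 D hm (hτ.of_le (by norm_num) : ContDiff ℝ 2 τ) p‖ ≤ C * (1 + R ^ 2) * ‖q - p‖ := by
  have hτ' : ContDiff ℝ 2 (deriv τ) := contDiff_deriv (k := 2) hτ
  have H := fun k => exists_norm_ridgeH2_le (D := D) (contDiff_mul_coord hm k) hτ' h1 h2 h3
  choose C hC0 hC using H
  obtain ⟨C', hC0', hC'⟩ := exists_norm_ridgeH2_le (D := D) hm hτ' h1 h2 h3
  refine ⟨∑ k, C k + C', add_nonneg (Finset.sum_nonneg fun k _ => hC0 k) hC0', ?_⟩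
  intro R p q hp hq
  have hconv : Convex ℝ {p : E n × ℝ | ‖p.1‖ ≤ R} := by
    have : {p : E n × ℝ | ‖p.1‖ ≤ R} = (ContinuousLinearMap.fst ℝ (E n) ℝ) ⁻¹' Metric.closedBall 0 R := by
      ext p; simp
    rw [this]
    exact (convex_closedBall 0 R).linear_preimage (ContinuousLinearMap.fst ℝ (E n) ℝ).toLinearMap
  refine Convex.norm_image_sub_le_of_norm_hasFDerivWithin_le
    (fun x _ => (hasFDerivAt_ridgeH2 hm hτ x).hasFDerivWithinAt) (fun x hx => ?_) hconv hp hq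
  refine (norm_affineComb_le _ _).trans ?_
  have hx' : 1 + ‖x.1‖ ^ 2 ≤ 1 + R ^ 2 := by
    have : ‖x.1‖ ≤ R := hx
    gcongr
  rw [add_mul, Finset.sum_mul]
  exact add_le_add (Finset.sum_le_sum fun k _ => (hC k x).trans (mul_le_mul_of_nonneg_left hx' (hC0 k)))
    ((hC' x).trans (mul_le_mul_of_nonneg_left hx' hC0'))

lemma exists_norm_ridge_sub_le {m : E n → ℝ} {τ : ℝ → ℝ} (hm : Continuous m)
    (hτ : ContDiff ℝ 1 τ) (h1 : ∃ S, ∀ s, |deriv τ s| ≤ S) :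
    ∃ C, 0 ≤ C ∧ ∀ p q, ‖ridge D hm hτ.continuous q - ridge D hm hτ.continuous p‖ ≤
      C * ‖q - p‖ := by
  have hτ' := hτ.continuous_deriv le_rfl
  have H := fun k => exists_norm_ridge_le (D := D) (continuous_mul_coord hm k) hτ' h1
  choose C hC0 hC using H
  obtain ⟨C', hC0', hC'⟩ := exists_norm_ridge_le (D := D) hm hτ' h1
  refine ⟨∑ k, C k + C', add_nonneg (Finset.sum_nonneg fun k _ => hC0 k) hC0', fun p q => ?_⟩
  refine Convex.norm_image_sub_le_of_norm_hasFDerivWithin_le (s := univ)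
    (fun x _ => (hasFDerivAt_ridge hm hτ x).hasFDerivWithinAt) (fun x hx => ?_) convex_univ
    (mem_univ _) (mem_univ _)
  exact (norm_affineComb_le _ _).trans (add_le_add (Finset.sum_le_sum fun k _ => hC k x) (hC' x))

end RidgeH2

/-! ### A Marcinkiewicz–Zygmund law of large numbers in Hilbert space -/

section LargeNumbers

variable {Z S V ι : Type*} [MeasurableSpace Z] [MeasurableSpace S] {ν : Measure Z} {P : Measure S}

lemma integrable_comp_law {G : Type*} [NormedAddCommGroup G] {ζ : S → Z} (hm : Measurable ζ)
    (hlaw : P.map ζ = ν) {f : Z → G} (hf : Integrable f ν) : Integrable (fun s => f (ζ s)) P := by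
  rw [← hlaw] at hf
  exact hf.comp_measurable hm

lemma integral_comp_law {G : Type*} [NormedAddCommGroup G] [NormedSpace ℝ G] {ζ : S → Z}
    (hm : Measurable ζ)
    (hlaw : P.map ζ = ν) {f : Z → G} (hf : AEStronglyMeasurable f ν) :
    ∫ s, f (ζ s) ∂P = ∫ z, f z ∂ν := by
  rw [← hlaw] at hf ⊢
  exact (integral_map hm.aemeasurable hf).symm

lemma integrable_of_rpow [NormedAddCommGroup V] [IsFiniteMeasure ν] {X : Z → V}
    (hX : StronglyMeasurable X) {p : ℝ} (hp : 1 ≤ p)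
    (h : Integrable (fun z => ‖X z‖ ^ p) ν) : Integrable X ν := by
  refine ((integrable_const (1 : ℝ)).add h).mono' hX.aestronglyMeasurable (ae_of_all _ fun z => ?_)
  simp only [Pi.add_apply]
  rcases le_total ‖X z‖ 1 with h1 | h1
  · have := Real.rpow_nonneg (norm_nonneg (X z)) p; linarith
  · have := Real.self_le_rpow_of_one_le h1 hp; linarith

variable [Fintype ι] [IsProbabilityMeasure ν] [IsProbabilityMeasure P]
  [NormedAddCommGroup V] [InnerProductSpace ℝ V] [CompleteSpace V]

/-- Centred functions of independent variables are orthogonal. -/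
lemma integral_inner_eq_zero {ζ ζ' : S → Z} (hm : Measurable ζ) (hm' : Measurable ζ')
    (hl : P.map ζ = ν) (hl' : P.map ζ' = ν) (hi : IndepFun ζ ζ' P) {Y : Z → V}
    (hY : StronglyMeasurable Y) {M : ℝ} (hM : ∀ z, ‖Y z‖ ≤ M) (h0 : ∫ z, Y z ∂ν = 0) :
    ∫ s, inner ℝ (Y (ζ s)) (Y (ζ' s)) ∂P = 0 := by
  have hmap : P.map (fun s => (ζ s, ζ' s)) = ν.prod ν := by
    rw [(indepFun_iff_map_prod_eq_prod_map_map hm.aemeasurable hm'.aemeasurable).1 hi, hl, hl']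
  have hM0 : 0 ≤ M := by
    obtain ⟨z⟩ : Nonempty Z := ν.nonempty_of_neZero
    exact (norm_nonneg _).trans (hM z)
  have hsm : StronglyMeasurable fun q : Z × Z => inner ℝ (Y q.1) (Y q.2) :=
    (hY.comp_measurable measurable_fst).inner (hY.comp_measurable measurable_snd)
  have hint : Integrable (fun q : Z × Z => inner ℝ (Y q.1) (Y q.2)) (ν.prod ν) := by
    refine Integrable.of_bound hsm.aestronglyMeasurable (M * M) (ae_of_all _ fun q => ?_)
    exact (norm_inner_le_norm _ _).trans (mul_le_mul (hM _) (hM _) (norm_nonneg _) hM0)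
  have h1 := integral_map (hm.prodMk hm').aemeasurable (μ := P)
    (f := fun q : Z × Z => inner ℝ (Y q.1) (Y q.2)) hsm.aestronglyMeasurable
  rw [hmap] at h1
  rw [← h1, integral_prod _ hint]
  have hYi : Integrable Y ν := Integrable.of_bound hY.aestronglyMeasurable M (ae_of_all _ hM)
  have : ∀ z, ∫ z', inner ℝ (Y z) (Y z') ∂ν = 0 := fun z => by
    rw [integral_inner hYi, h0, inner_zero_right]
  simp [this]

/-- The variance of a sum of independent bounded variables. -/
lemma integral_norm_sum_sq_le {ζ : ι → S → Z} (hm : ∀ i, Measurable (ζ i))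
    (hl : ∀ i, P.map (ζ i) = ν) (hi : iIndepFun ζ P) {Y : Z → V}
    (hY : StronglyMeasurable Y) {M : ℝ} (hM : ∀ z, ‖Y z‖ ≤ M) :
    ∫ s, ‖∑ i, (Y (ζ i s) - ∫ z, Y z ∂ν)‖ ^ 2 ∂P ≤ Fintype.card ι * ∫ z, ‖Y z‖ ^ 2 ∂ν := by
  set m := ∫ z, Y z ∂ν with hmdef
  have hYi : Integrable Y ν := Integrable.of_bound hY.aestronglyMeasurable M (ae_of_all _ hM)
  set X : Z → V := fun z => Y z - m with hX
  have hXm : StronglyMeasurable X := hY.sub stronglyMeasurable_const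
  have hXb : ∀ z, ‖X z‖ ≤ M + ‖m‖ := fun z => (norm_sub_le _ _).trans (add_le_add (hM z) le_rfl)
  have hX0 : ∫ z, X z ∂ν = 0 := by
    simp only [hX]
    rw [integral_sub hYi (integrable_const _)]
    simp [hmdef]
  have hint : ∀ i j, Integrable (fun s => inner ℝ (X (ζ i s)) (X (ζ j s))) P := fun i j => by
    refine Integrable.of_bound ((hXm.comp_measurable (hm i)).inner
      (hXm.comp_measurable (hm j))).aestronglyMeasurable ((M + ‖m‖) * (M + ‖m‖))
      (ae_of_all _ fun s => ?_)
    exact (norm_inner_le_norm _ _).trans (mul_le_mul (hXb _) (hXb _) (norm_nonneg _)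
      ((norm_nonneg _).trans (hXb (ζ i s))))
  have e : ∀ s, ‖∑ i, (Y (ζ i s) - m)‖ ^ 2 = ∑ i, ∑ j, inner ℝ (X (ζ i s)) (X (ζ j s)) := fun s => by
    rw [← real_inner_self_eq_norm_sq, sum_inner]
    simp only [inner_sum]
    rfl
  simp only [e]
  rw [integral_finsetSum _ fun i _ => integrable_finsetSum _ fun j _ => hint i j]
  have hterm : ∀ i, ∫ s, ∑ j, inner ℝ (X (ζ i s)) (X (ζ j s)) ∂P ≤ ∫ z, ‖Y z‖ ^ 2 ∂ν := by
    intro i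
    rw [integral_finsetSum _ fun j _ => hint i j, Finset.sum_eq_single i]
    · have := integral_comp_law (hm i) (hl i) (f := fun z => inner ℝ (X z) (X z))
        (hXm.inner hXm).aestronglyMeasurable
      rw [this]
      have e2 : ∀ z, inner ℝ (X z) (X z) = ‖Y z‖ ^ 2 - 2 * inner ℝ m (Y z) + ‖m‖ ^ 2 := fun z => by
        rw [real_inner_self_eq_norm_sq, hX, norm_sub_sq_real, real_inner_comm]
      simp only [e2]
      have i1 : Integrable (fun z => ‖Y z‖ ^ 2) ν :=
        Integrable.of_bound (hY.norm.pow 2).aestronglyMeasurable (M ^ 2) (ae_of_all _ fun z => by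
          rw [Real.norm_of_nonneg (by positivity)]
          exact pow_le_pow_left₀ (norm_nonneg _) (hM z) 2)
      have i2 : Integrable (fun z => 2 * inner ℝ m (Y z)) ν := (hYi.const_inner m).const_mul 2
      have i12 : Integrable (fun z => ‖Y z‖ ^ 2 - 2 * inner ℝ m (Y z)) ν := i1.sub i2
      rw [integral_add i12 (integrable_const _), integral_sub i1 i2, integral_const_mul,
        integral_inner hYi, ← hmdef, real_inner_self_eq_norm_sq]
      simp
      nlinarith [sq_nonneg ‖m‖]
    · intro j _ hj
      exact integral_inner_eq_zero (hm i) (hm j) (hl i) (hl j) (hi.indepFun hj.symm) hXm hXb hX0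
    · simp
  refine (Finset.sum_le_sum fun i _ => hterm i).trans (le_of_eq ?_)
  simp

lemma sq_integral_le {f : S → ℝ} (hf : Integrable f P) (hf2 : Integrable (fun s => f s ^ 2) P) :
    (∫ s, f s ∂P) ^ 2 ≤ ∫ s, f s ^ 2 ∂P := by
  set a := ∫ s, f s ∂P with ha
  have h : ∫ s, (2 * a * f s - a ^ 2) ∂P ≤ ∫ s, f s ^ 2 ∂P :=
    integral_mono ((hf.const_mul _).sub (integrable_const _)) hf2 fun s => by
      simp only; nlinarith [sq_nonneg (f s - a)]
  rw [integral_sub (hf.const_mul _) (integrable_const _), integral_const_mul, ← ha] at h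
  simp at h
  nlinarith

/-- The first moment of a centred sum, by truncation at an arbitrary level `M`. -/
lemma integral_norm_sum_le {ζ : ι → S → Z} (hm : ∀ i, Measurable (ζ i))
    (hl : ∀ i, P.map (ζ i) = ν) (hi : iIndepFun ζ P) {X : Z → V}
    (hX : StronglyMeasurable X) (hXi : Integrable X ν) (M : ℝ) :
    ∫ s, ‖∑ i, (X (ζ i s) - ∫ z, X z ∂ν)‖ ∂P ≤
      √(Fintype.card ι * ∫ z, {z | ‖X z‖ ≤ M}.indicator (fun z => ‖X z‖ ^ 2) z ∂ν) +
      Fintype.card ι * (2 * ∫ z, {z | M < ‖X z‖}.indicator (fun z => ‖X z‖) z ∂ν) := by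
  have hA : MeasurableSet {z | ‖X z‖ ≤ M} := hX.norm.measurable measurableSet_Iic
  have hB : MeasurableSet {z | M < ‖X z‖} := hX.norm.measurable measurableSet_Ioi
  set Y : Z → V := {z | ‖X z‖ ≤ M}.indicator X with hY
  set R : Z → V := {z | M < ‖X z‖}.indicator X with hR
  have hYm : StronglyMeasurable Y := hX.indicator hA
  have hRm : StronglyMeasurable R := hX.indicator hB
  have hYi : Integrable Y ν := hXi.indicator hA
  have hRi : Integrable R ν := hXi.indicator hB
  have hYR : ∀ z, X z = Y z + R z := fun z => by
    by_cases h : ‖X z‖ ≤ M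
    · simp [hY, hR, h]
    · simp [hY, hR, h, not_le.1 h]
  have hYb : ∀ z, ‖Y z‖ ≤ max M 0 := fun z => by
    by_cases h : ‖X z‖ ≤ M
    · simp [hY, h]
    · simp [hY, h]
  have hYn : ∀ z, ‖Y z‖ ^ 2 = {z | ‖X z‖ ≤ M}.indicator (fun z => ‖X z‖ ^ 2) z := fun z => by
    by_cases h : ‖X z‖ ≤ M
    · simp [hY, h]
    · simp [hY, h]
  have hRn : ∀ z, ‖R z‖ = {z | M < ‖X z‖}.indicator (fun z => ‖X z‖) z := fun z => by
    rw [hR, norm_indicator_eq_indicator_norm]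
  simp only [← hYn, ← hRn]
  have hsplit : ∫ z, X z ∂ν = (∫ z, Y z ∂ν) + ∫ z, R z ∂ν := by
    rw [← integral_add hYi hRi]; exact integral_congr_ae (ae_of_all _ hYR)
  have cY : ∀ i, Integrable (fun s => Y (ζ i s) - ∫ z, Y z ∂ν) P := fun i =>
    (integrable_comp_law (hm i) (hl i) hYi).sub (integrable_const _)
  have cR : ∀ i, Integrable (fun s => R (ζ i s) - ∫ z, R z ∂ν) P := fun i =>
    (integrable_comp_law (hm i) (hl i) hRi).sub (integrable_const _)
  have sY : Integrable (fun s => ‖∑ i, (Y (ζ i s) - ∫ z, Y z ∂ν)‖) P :=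
    (integrable_finsetSum _ fun i _ => cY i).norm
  have sR : Integrable (fun s => ∑ i, ‖R (ζ i s) - ∫ z, R z ∂ν‖) P :=
    (integrable_finsetSum _ fun i _ => (cR i).norm)
  have step1 : ∫ s, ‖∑ i, (X (ζ i s) - ∫ z, X z ∂ν)‖ ∂P ≤
      ∫ s, (‖∑ i, (Y (ζ i s) - ∫ z, Y z ∂ν)‖ + ∑ i, ‖R (ζ i s) - ∫ z, R z ∂ν‖) ∂P := by
    refine integral_mono_of_nonneg (ae_of_all _ fun s => norm_nonneg _) (sY.add sR)
      (ae_of_all _ fun s => ?_)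
    have : ∑ i, (X (ζ i s) - ∫ z, X z ∂ν) =
        ∑ i, (Y (ζ i s) - ∫ z, Y z ∂ν) + ∑ i, (R (ζ i s) - ∫ z, R z ∂ν) := by
      rw [← Finset.sum_add_distrib]
      refine Finset.sum_congr rfl fun i _ => ?_
      rw [hYR, hsplit]; abel
    simp only [this]
    exact (norm_add_le _ _).trans (add_le_add le_rfl (norm_sum_le _ _))
  rw [integral_add sY sR, integral_finsetSum _ fun i _ => (cR i).norm] at step1
  refine step1.trans (add_le_add ?_ ?_)
  · refine Real.le_sqrt_of_sq_le ((sq_integral_le sY ?_).trans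
      (integral_norm_sum_sq_le hm hl hi hYm hYb))
    refine Integrable.of_bound (sY.1.pow 2)
      ((∑ _i : ι, (max M 0 + ‖∫ z, Y z ∂ν‖)) ^ 2) (ae_of_all _ fun s => ?_)
    rw [Real.norm_of_nonneg (by positivity)]
    refine pow_le_pow_left₀ (norm_nonneg _) ((norm_sum_le _ _).trans
      (Finset.sum_le_sum fun i _ => ?_)) 2
    exact (norm_sub_le _ _).trans (add_le_add (hYb _) le_rfl)
  · have : ∀ i, ∫ s, ‖R (ζ i s) - ∫ z, R z ∂ν‖ ∂P ≤ 2 * ∫ z, ‖R z‖ ∂ν := fun i => by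
      have hRn := (integrable_comp_law (hm i) (hl i) hRi).norm
      have : ∫ s, ‖R (ζ i s) - ∫ z, R z ∂ν‖ ∂P ≤ ∫ s, (‖R (ζ i s)‖ + ‖∫ z, R z ∂ν‖) ∂P :=
        integral_mono (cR i).norm (hRn.add (integrable_const _)) fun s => norm_sub_le _ _
      rw [integral_add hRn (integrable_const _),
        integral_comp_law (hm i) (hl i) (f := fun z => ‖R z‖) hRm.norm.aestronglyMeasurable] at this
      have h3 := norm_integral_le_integral_norm (μ := ν) R
      simp at this
      linarith
    refine (Finset.sum_le_sum fun i _ => this i).trans (le_of_eq ?_)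
    simp

/-- The Marcinkiewicz–Zygmund law of large numbers, in `L¹`: a sum of `N` independent centred
variables with a finite `p`-th moment, `1 < p < 2`, is `o(N^{1/p})`. -/
theorem tendsto_rpow_mul_integral_norm_sum {ξ : (N : ℕ) → Fin N → S → Z}
    (hm : ∀ N i, Measurable (ξ N i)) (hl : ∀ N i, P.map (ξ N i) = ν)
    (hi : ∀ N, iIndepFun (ξ N) P) {X : Z → V} (hX : StronglyMeasurable X) {p : ℝ} (hp1 : 1 < p)
    (hp2 : p < 2) (hint : Integrable (fun z => ‖X z‖ ^ p) ν) :
    Tendsto (fun N : ℕ => (N : ℝ) ^ (-(1 / p)) * ∫ s, ‖∑ i, (X (ξ N i s) - ∫ z, X z ∂ν)‖ ∂P)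
      atTop (𝓝 0) := by
  have hp0 : 0 < p := by linarith
  have hXi := integrable_of_rpow hX hp1.le hint
  -- truncation at the level `N^{1/p}`: below it, `‖X‖²` is at most `‖X‖^p N^{(2-p)/p}`, above it,
  -- `‖X‖` is at most `‖X‖^p N^{-(p-1)/p}`; both errors thus have the integrable majorant `‖X‖^p`
  set b : ℕ → ℝ := fun N => (N : ℝ) ^ (1 / p) with hb
  have hbt : Tendsto b atTop atTop :=
    (tendsto_rpow_atTop (by positivity)).comp tendsto_natCast_atTop_atTop
  set g₁ : ℕ → Z → ℝ := fun N z =>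
    {z | ‖X z‖ ≤ b N}.indicator (fun z => (N : ℝ) ^ (1 - 2 / p) * ‖X z‖ ^ 2) z with hg₁
  set g₂ : ℕ → Z → ℝ := fun N z =>
    {z | b N < ‖X z‖}.indicator (fun z => (N : ℝ) ^ (1 - 1 / p) * ‖X z‖) z with hg₂
  have hbN : ∀ N : ℕ, 0 < N → ∀ r : ℝ, b N ^ r = (N : ℝ) ^ (r / p) := fun N hN r => by
    rw [hb, ← Real.rpow_mul (by positivity)]; congr 1; ring
  have lim₁ : Tendsto (fun N => ∫ z, g₁ N z ∂ν) atTop (𝓝 0) := by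
    have := tendsto_integral_filter_of_dominated_convergence (μ := ν) (F := g₁) (f := fun _ => 0)
      (l := atTop) (fun z => ‖X z‖ ^ p) ?_ ?_ hint ?_
    · simpa using this
    · exact Eventually.of_forall fun N => (StronglyMeasurable.indicator
        ((hX.norm.pow 2).const_mul _) (hX.norm.measurable measurableSet_Iic)).aestronglyMeasurable
    · filter_upwards [eventually_gt_atTop 0] with N hN
      refine ae_of_all _ fun z => ?_
      simp only [hg₁, indicator]
      split_ifs with h
      · have h' : ‖X z‖ ≤ b N := h
        rw [Real.norm_of_nonneg (by positivity)]
        rcases (norm_nonneg (X z)).eq_or_lt with h0 | h0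
        · rw [← h0]; simp [Real.zero_rpow hp0.ne']
        · have e1 : (N : ℝ) ^ (1 - 2 / p) = (b N ^ (2 - p))⁻¹ := by
            rw [hbN N hN, ← Real.rpow_neg (by positivity)]; congr 1; field_simp; ring
          have e2 : ‖X z‖ ^ 2 = ‖X z‖ ^ p * ‖X z‖ ^ (2 - p) := by
            rw [← Real.rpow_add h0]; norm_num
          have e3 : ‖X z‖ ^ (2 - p) ≤ b N ^ (2 - p) :=
            Real.rpow_le_rpow h0.le h' (by linarith)
          have hb0 : 0 < b N ^ (2 - p) := Real.rpow_pos_of_pos (h0.trans_le h') _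
          rw [e1, e2, inv_mul_le_iff₀ hb0, mul_comm (b N ^ (2 - p))]
          exact mul_le_mul_of_nonneg_left e3 (by positivity)
      · simp; positivity
    · refine ae_of_all _ fun z => ?_
      have h0 : Tendsto (fun N : ℕ => (N : ℝ) ^ (1 - 2 / p) * ‖X z‖ ^ 2) atTop (𝓝 0) := by
        have : 0 < 2 / p - 1 := by rw [sub_pos, lt_div_iff₀ hp0]; linarith
        have := ((tendsto_rpow_neg_atTop this).comp tendsto_natCast_atTop_atTop).mul_const
          (‖X z‖ ^ 2)
        simpa [Function.comp_def] using this
      refine squeeze_zero (fun N => ?_) (fun N => ?_) h0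
      · exact indicator_nonneg (fun z _ => by positivity) z
      · exact indicator_le_self' (fun z _ => by positivity) z
  have lim₂ : Tendsto (fun N => ∫ z, g₂ N z ∂ν) atTop (𝓝 0) := by
    have := tendsto_integral_filter_of_dominated_convergence (μ := ν) (F := g₂) (f := fun _ => 0)
      (l := atTop) (fun z => ‖X z‖ ^ p) ?_ ?_ hint ?_
    · simpa using this
    · exact Eventually.of_forall fun N => (StronglyMeasurable.indicator
        (hX.norm.const_mul _) (hX.norm.measurable measurableSet_Ioi)).aestronglyMeasurable
    · filter_upwards [eventually_gt_atTop 0] with N hN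
      refine ae_of_all _ fun z => ?_
      simp only [hg₂, indicator]
      split_ifs with h
      · have h' : b N < ‖X z‖ := h
        have hb0 : 0 < b N := by positivity
        have h0 := hb0.trans h'
        rw [Real.norm_of_nonneg (by positivity)]
        have e1 : (N : ℝ) ^ (1 - 1 / p) = b N ^ (p - 1) := by
          rw [hbN N hN]; congr 1; field_simp
        have e2 : ‖X z‖ ^ p = ‖X z‖ ^ (p - 1) * ‖X z‖ := by
          rw [← Real.rpow_add_one h0.ne']; ring_nf
        rw [e1, e2]
        exact mul_le_mul_of_nonneg_right (Real.rpow_le_rpow hb0.le h'.le (by linarith)) h0.le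
      · simp; positivity
    · refine ae_of_all _ fun z => tendsto_const_nhds.congr' ?_
      filter_upwards [hbt.eventually_ge_atTop ‖X z‖] with N hN
      simp [hg₂, indicator, not_lt.2 hN]
  have lim : Tendsto (fun N => √(∫ z, g₁ N z ∂ν) + 2 * ∫ z, g₂ N z ∂ν) atTop (𝓝 0) := by
    have := (lim₁.sqrt).add (lim₂.const_mul 2)
    simpa using this
  refine squeeze_zero' (Eventually.of_forall fun N => by positivity) ?_ lim
  filter_upwards [eventually_gt_atTop 0] with N hN
  have hN' : (0 : ℝ) < N := by exact_mod_cast hN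
  have := integral_norm_sum_le (hm N) (hl N) (hi N) hX hXi (b N)
  refine (mul_le_mul_of_nonneg_left this (by positivity)).trans (le_of_eq ?_)
  rw [mul_add]
  congr 1
  · have e : (N : ℝ) ^ (-(1 / p)) = √((N : ℝ) ^ (-(2 / p))) := by
      rw [Real.sqrt_eq_rpow, ← Real.rpow_mul hN'.le]; congr 1; ring
    rw [e, ← Real.sqrt_mul (by positivity), Fintype.card_fin, ← mul_assoc, ← integral_const_mul]
    congr 1
    refine integral_congr_ae (ae_of_all _ fun z => ?_)
    have e2 : (N : ℝ) ^ (-(2 / p)) * N = (N : ℝ) ^ (1 - 2 / p) := by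
      rw [← Real.rpow_add_one hN'.ne']; ring_nf
    simp only [hg₁, indicator, e2]
    split_ifs <;> simp
  · rw [Fintype.card_fin, mul_left_comm _ (2 : ℝ), mul_left_comm _ (2 : ℝ), ← mul_assoc ((N : ℝ) ^ _),
      ← integral_const_mul]
    congr 1
    refine integral_congr_ae (ae_of_all _ fun z => ?_)
    have e2 : (N : ℝ) ^ (-(1 / p)) * N = (N : ℝ) ^ (1 - 1 / p) := by
      rw [← Real.rpow_add_one hN'.ne']; ring_nf
    simp only [hg₂, indicator, e2]
    split_ifs <;> simp

end LargeNumbers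

/-! ### Tangent features and the neural tangent kernel -/

section Features

variable {n : ℕ} {D : Domain n} {η : E n → ℝ} {σ : ℝ → ℝ}

/-- The multiplier in the derivative of `c η(y) σ(w · y + b)` with respect to the parameter `k`. -/
def mult {n : ℕ} (η : E n → ℝ) : ParamIdx n → E n → ℝ
  | Sum.inl _ => η
  | Sum.inr (Sum.inl i) => fun y => η y * y i
  | Sum.inr (Sum.inr _) => η

/-- The activation in the derivative of `c η(y) σ(w · y + b)` with respect to the parameter `k`. -/
def act (n : ℕ) (σ : ℝ → ℝ) : ParamIdx n → ℝ → ℝ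
  | Sum.inl _ => σ
  | Sum.inr _ => deriv σ

/-- The power of `c` in the derivative of `c η(y) σ(w · y + b)` with respect to the parameter
`k`. -/
def coef {n : ℕ} : ParamIdx n → ℝ → ℝ
  | Sum.inl _ => fun _ => 1
  | Sum.inr _ => fun c => c

/-- The coordinates of the parameters `(c, w, b)` of a hidden unit. -/
def coord {n : ℕ} (z : ℝ × E n × ℝ) : ParamIdx n → ℝ
  | Sum.inl _ => z.1
  | Sum.inr (Sum.inl i) => z.2.1 i
  | Sum.inr (Sum.inr _) => z.2.2

lemma contDiff_mult (hη : IsAuxiliary D η) : ∀ k, ContDiff ℝ 2 (mult η k)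
  | Sum.inl _ => hη.cb.1.of_le (by norm_num)
  | Sum.inr (Sum.inl i) => contDiff_mul_coord (hη.cb.1.of_le (by norm_num)) i
  | Sum.inr (Sum.inr _) => hη.cb.1.of_le (by norm_num)

lemma contDiff_act (hσ : IsActivation σ) : ∀ k, ContDiff ℝ 3 (act n σ k)
  | Sum.inl _ => hσ.cb.1.of_le (by norm_num)
  | Sum.inr _ => contDiff_deriv (k := 3) hσ.cb.1

lemma contDiff_act' (hσ : IsActivation σ) (k : ParamIdx n) : ContDiff ℝ 2 (act n σ k) :=
  (contDiff_act hσ k).of_le (by norm_num)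

lemma exists_bound_iterate_deriv (hσ : IsActivation σ) {j : ℕ} (hj : j ≤ 4) :
    ∃ S, ∀ s, |deriv^[j] σ s| ≤ S := by
  obtain ⟨C, hC⟩ := hσ.cb.2 j hj
  refine ⟨C, fun s => ?_⟩
  rw [← iteratedDeriv_eq_iterate, ← Real.norm_eq_abs, ← norm_iteratedFDeriv_eq_norm_iteratedDeriv]
  exact hC s

lemma exists_bound_act (hσ : IsActivation σ) (k : ParamIdx n) {j : ℕ} (hj : j ≤ 3) :
    ∃ S, ∀ s, |deriv^[j] (act n σ k) s| ≤ S := by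
  rcases k with _ | _
  · exact exists_bound_iterate_deriv hσ (by omega)
  · exact exists_bound_iterate_deriv hσ (j := j + 1) (by omega)

/-- The ridge function in the derivative of `c η(y) σ(w · y + b)` with respect to the parameter
`k`. -/
def tangentRidge (hη : IsAuxiliary D η) (hσ : IsActivation σ) (k : ParamIdx n) (p : E n × ℝ) : H2 D :=
  ridgeH2 D (contDiff_mult hη k) (contDiff_act' hσ k) p

/-- The derivative of `z = (c, w, b) ↦ c η σ(w · y + b) ∈ H²` with respect to the parameter `k`. -/
def feature (hη : IsAuxiliary D η) (hσ : IsActivation σ) (k : ParamIdx n) (z : ℝ × E n × ℝ) : H2 D :=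
  coef k z.1 • tangentRidge hη hσ k z.2

/-- The function underlying `feature`. -/
def featureFn {n : ℕ} (η : E n → ℝ) (σ : ℝ → ℝ) (k : ParamIdx n) (z : ℝ × E n × ℝ) (y : E n) : ℝ :=
  coef k z.1 * ridgeFn (mult η k) (act n σ k) z.2 y

/-- The contribution `c η σ(w · y + b) ∈ H²` of a hidden unit to the approximator. -/
def unitH2 (hη : IsAuxiliary D η) (hσ : IsActivation σ) (z : ℝ × E n × ℝ) : H2 D :=
  z.1 • tangentRidge hη hσ (Sum.inl ()) z.2

lemma incl_feature (hη : IsAuxiliary D η) (hσ : IsActivation σ) (k : ParamIdx n)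
    (z : ℝ × E n × ℝ) : incl D (feature hη hσ k z) =ᵐ[D.μ] featureFn η σ k z := by
  rw [feature, map_smul]
  filter_upwards [Lp.coeFn_smul (coef k z.1) (incl D (tangentRidge hη hσ k z.2)),
    coe_ridge (D := D) (contDiff_mult hη k).continuous (contDiff_act' hσ k).continuous z.2]
    with y e1 e2
  rw [e1, Pi.smul_apply, tangentRidge, incl_ridgeH2, e2, featureFn, smul_eq_mul]

lemma fn_unitH2 (hη : IsAuxiliary D η) (hσ : IsActivation σ) (z : ℝ × E n × ℝ) :
    H2.fn (unitH2 hη hσ z) =ᵐ[D.μ] fun y => z.1 * ridgeFn η σ z.2 y := by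
  rw [← coe_incl, unitH2, map_smul]
  filter_upwards [Lp.coeFn_smul z.1 (incl D (tangentRidge hη hσ (Sum.inl ()) z.2)),
    coe_ridge (D := D) (contDiff_mult hη (Sum.inl ())).continuous
      (contDiff_act' hσ (Sum.inl ())).continuous z.2] with y e1 e2
  rw [e1, Pi.smul_apply, tangentRidge, incl_ridgeH2, e2, smul_eq_mul]
  rfl

/-- Size and Lipschitz bounds of the tangent ridge functions: uniform in `L²`, quadratic in the
weights in `H²`. -/
structure TangentBounds (hη : IsAuxiliary D η) (hσ : IsActivation σ) (C : ℝ) : Prop where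
  nonneg : 0 ≤ C
  norm_le : ∀ k p, ‖tangentRidge hη hσ k p‖ ≤ C * (1 + ‖p.1‖ ^ 2)
  norm_incl_le : ∀ k p, ‖incl D (tangentRidge hη hσ k p)‖ ≤ C
  norm_sub_le : ∀ k R p q, ‖p.1‖ ≤ R → ‖q.1‖ ≤ R →
    ‖tangentRidge hη hσ k q - tangentRidge hη hσ k p‖ ≤ C * (1 + R ^ 2) * ‖q - p‖
  norm_incl_sub_le : ∀ k p q,
    ‖incl D (tangentRidge hη hσ k q) - incl D (tangentRidge hη hσ k p)‖ ≤ C * ‖q - p‖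

lemma exists_tangentBounds (hη : IsAuxiliary D η) (hσ : IsActivation σ) :
    ∃ C, TangentBounds hη hσ C := by
  have B := fun (k : ParamIdx n) (j : ℕ) (hj : j ≤ 3) => exists_bound_act hσ k hj
  have H1 := fun k => exists_norm_ridgeH2_le (D := D) (contDiff_mult hη k) (contDiff_act' hσ k)
    (B k 0 (by omega)) (B k 1 (by omega)) (B k 2 (by omega))
  have H2 := fun k => exists_norm_ridge_le (D := D) (contDiff_mult hη k).continuous
    (contDiff_act' hσ k).continuous (B k 0 (by omega))
  have H3 := fun k => exists_norm_ridgeH2_sub_le (D := D) (contDiff_mult hη k) (contDiff_act hσ k)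
    (B k 1 (by omega)) (B k 2 (by omega)) (B k 3 (by omega))
  have H4 := fun k => exists_norm_ridge_sub_le (D := D) (contDiff_mult hη k).continuous
    ((contDiff_act hσ k).of_le (by norm_num)) (B k 1 (by omega))
  choose C1 h1 H1 using H1
  choose C2 h2 H2 using H2
  choose C3 h3 H3 using H3
  choose C4 h4 H4 using H4
  have hle : ∀ k, C1 k + C2 k + C3 k + C4 k ≤ ∑ k, (C1 k + C2 k + C3 k + C4 k) := fun k =>
    Finset.single_le_sum (f := fun k => C1 k + C2 k + C3 k + C4 k)
      (fun k _ => by have := h1 k; have := h2 k; have := h3 k; have := h4 k; positivity)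
      (Finset.mem_univ k)
  set C := ∑ k, (C1 k + C2 k + C3 k + C4 k)
  have a1 : ∀ k, C1 k ≤ C := fun k => by linarith [hle k, h1 k, h2 k, h3 k, h4 k]
  have a2 : ∀ k, C2 k ≤ C := fun k => by linarith [hle k, h1 k, h2 k, h3 k, h4 k]
  have a3 : ∀ k, C3 k ≤ C := fun k => by linarith [hle k, h1 k, h2 k, h3 k, h4 k]
  have a4 : ∀ k, C4 k ≤ C := fun k => by linarith [hle k, h1 k, h2 k, h3 k, h4 k]
  refine ⟨C, (h1 (Sum.inl ())).trans (a1 _), fun k p => ?_, fun k p => ?_, fun k R p q hp hq => ?_,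
    fun k p q => ?_⟩
  · exact (H1 k p).trans (mul_le_mul_of_nonneg_right (a1 k) (by positivity))
  · exact (H2 k p).trans (a2 k)
  · refine (H3 k R p q hp hq).trans ?_
    rw [mul_assoc, mul_assoc]
    exact mul_le_mul_of_nonneg_right (a3 k) (by positivity)
  · exact (H4 k p q).trans (mul_le_mul_of_nonneg_right (a4 k) (by positivity))

lemma norm_smul_sub_smul_le {V : Type*} [NormedAddCommGroup V] [NormedSpace ℝ V] (a a' : ℝ)
    (v v' : V) : ‖a' • v' - a • v‖ ≤ |a'| * ‖v' - v‖ + |a' - a| * ‖v‖ := by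
  have : a' • v' - a • v = a' • (v' - v) + (a' - a) • v := by
    rw [smul_sub, sub_smul]; abel
  rw [this]
  refine (norm_add_le _ _).trans (le_of_eq ?_)
  rw [norm_smul, norm_smul, Real.norm_eq_abs, Real.norm_eq_abs]

lemma abs_coef_le (k : ParamIdx n) {c K : ℝ} (hK : 1 ≤ K) (hc : |c| ≤ K) : |coef k c| ≤ K := by
  rcases k with _ | _
  · simpa [coef] using hK
  · exact hc

lemma abs_coef_sub_le (k : ParamIdx n) (c c' : ℝ) : |coef k c' - coef k c| ≤ |c' - c| := by
  rcases k with _ | _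
  · simp [coef]
  · exact le_rfl

lemma TangentBounds.norm_smul_sub {hη : IsAuxiliary D η} {hσ : IsActivation σ} {C : ℝ}
    (hC : TangentBounds hη hσ C) (k : ParamIdx n) {K R a a' : ℝ} (hK : 1 ≤ K) (ha' : |a'| ≤ K)
    {p q : E n × ℝ} (hp : ‖p.1‖ ≤ R) (hq : ‖q.1‖ ≤ R) {r : ℝ} (haa : |a' - a| ≤ r)
    (hpq : ‖q - p‖ ≤ r) :
    ‖a' • tangentRidge hη hσ k q - a • tangentRidge hη hσ k p‖ ≤
      2 * K * C * (1 + R ^ 2) * r := by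
  have hC0 := hC.nonneg
  have hr : 0 ≤ r := (norm_nonneg _).trans hpq
  refine (norm_smul_sub_smul_le _ _ _ _).trans ?_
  have h1 := (hC.norm_sub_le k R p q hp hq).trans (mul_le_mul_of_nonneg_left hpq (by positivity))
  have h2 : ‖tangentRidge hη hσ k p‖ ≤ C * (1 + R ^ 2) :=
    (hC.norm_le k p).trans (by gcongr)
  calc _ ≤ K * (C * (1 + R ^ 2) * r) + r * (C * (1 + R ^ 2)) :=
        add_le_add (mul_le_mul ha' h1 (norm_nonneg _) (by linarith))
          (mul_le_mul haa h2 (norm_nonneg _) hr)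
    _ = (K + 1) * (C * (1 + R ^ 2) * r) := by ring
    _ ≤ (2 * K) * (C * (1 + R ^ 2) * r) :=
        mul_le_mul_of_nonneg_right (by linarith) (by positivity)
    _ = _ := by ring

lemma fst_sub_le (z z' : ℝ × E n × ℝ) : |z'.1 - z.1| ≤ ‖z' - z‖ := norm_fst_le (z' - z)

lemma snd_sub_le (z z' : ℝ × E n × ℝ) : ‖z'.2 - z.2‖ ≤ ‖z' - z‖ := norm_snd_le (z' - z)

lemma TangentBounds.norm_feature_sub {hη : IsAuxiliary D η} {hσ : IsActivation σ} {C : ℝ}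
    (hC : TangentBounds hη hσ C) (k : ParamIdx n) {K R : ℝ} (hK : 1 ≤ K) {z z' : ℝ × E n × ℝ}
    (hz' : |z'.1| ≤ K) (hw : ‖z.2.1‖ ≤ R) (hw' : ‖z'.2.1‖ ≤ R) :
    ‖feature hη hσ k z' - feature hη hσ k z‖ ≤ 2 * K * C * (1 + R ^ 2) * ‖z' - z‖ :=
  hC.norm_smul_sub k hK (abs_coef_le k hK hz') hw hw'
    ((abs_coef_sub_le k _ _).trans (fst_sub_le z z')) (snd_sub_le z z')

lemma TangentBounds.norm_unitH2_sub {hη : IsAuxiliary D η} {hσ : IsActivation σ} {C : ℝ}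
    (hC : TangentBounds hη hσ C) {K R : ℝ} (hK : 1 ≤ K) {z z' : ℝ × E n × ℝ}
    (hz' : |z'.1| ≤ K) (hw : ‖z.2.1‖ ≤ R) (hw' : ‖z'.2.1‖ ≤ R) :
    ‖unitH2 hη hσ z' - unitH2 hη hσ z‖ ≤ 2 * K * C * (1 + R ^ 2) * ‖z' - z‖ :=
  hC.norm_smul_sub _ hK hz' hw hw' (fst_sub_le z z') (snd_sub_le z z')

lemma TangentBounds.norm_incl_feature_sub {hη : IsAuxiliary D η} {hσ : IsActivation σ} {C : ℝ}
    (hC : TangentBounds hη hσ C) (k : ParamIdx n) {K : ℝ} (hK : 1 ≤ K) {z z' : ℝ × E n × ℝ}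
    (hz' : |z'.1| ≤ K) :
    ‖incl D (feature hη hσ k z') - incl D (feature hη hσ k z)‖ ≤ 2 * K * C * ‖z' - z‖ := by
  have hC0 := hC.nonneg
  rw [feature, feature, map_smul, map_smul]
  refine (norm_smul_sub_smul_le _ _ _ _).trans ?_
  have h1 := (hC.norm_incl_sub_le k z.2 z'.2).trans
    (mul_le_mul_of_nonneg_left (snd_sub_le z z') hC0)
  calc _ ≤ K * (C * ‖z' - z‖) + ‖z' - z‖ * C :=
        add_le_add (mul_le_mul (abs_coef_le k hK hz') h1 (norm_nonneg _) (by linarith))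
          (mul_le_mul ((abs_coef_sub_le k _ _).trans (fst_sub_le z z')) (hC.norm_incl_le k z.2)
            (norm_nonneg _) (norm_nonneg _))
    _ = (K + 1) * (C * ‖z' - z‖) := by ring
    _ ≤ (2 * K) * (C * ‖z' - z‖) :=
        mul_le_mul_of_nonneg_right (by linarith) (by positivity)
    _ = _ := by ring

lemma TangentBounds.norm_feature_le {hη : IsAuxiliary D η} {hσ : IsActivation σ} {C : ℝ}
    (hC : TangentBounds hη hσ C) (k : ParamIdx n) {K : ℝ} (hK : 1 ≤ K) {z : ℝ × E n × ℝ}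
    (hz : |z.1| ≤ K) : ‖feature hη hσ k z‖ ≤ K * C * (1 + ‖z.2.1‖ ^ 2) := by
  rw [feature, norm_smul, mul_assoc]
  exact mul_le_mul (abs_coef_le k hK hz) (hC.norm_le k z.2) (norm_nonneg _) (by linarith)

lemma TangentBounds.norm_incl_feature_le {hη : IsAuxiliary D η} {hσ : IsActivation σ} {C : ℝ}
    (hC : TangentBounds hη hσ C) (k : ParamIdx n) {K : ℝ} (hK : 1 ≤ K) {z : ℝ × E n × ℝ}
    (hz : |z.1| ≤ K) : ‖incl D (feature hη hσ k z)‖ ≤ K * C := by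
  rw [feature, map_smul, norm_smul]
  exact mul_le_mul (abs_coef_le k hK hz) (hC.norm_incl_le k z.2) (norm_nonneg _) (by linarith)

lemma continuous_tangentRidge (hη : IsAuxiliary D η) (hσ : IsActivation σ) (k : ParamIdx n) :
    Continuous (tangentRidge hη hσ k) :=
  (differentiable_ridgeH2 (D := D) (contDiff_mult hη k) (contDiff_act hσ k)).continuous

lemma continuous_coef (k : ParamIdx n) : Continuous (coef k) := by
  rcases k with _ | _
  · exact continuous_const
  · exact continuous_id

lemma continuous_feature (hη : IsAuxiliary D η) (hσ : IsActivation σ) (k : ParamIdx n) :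
    Continuous (feature hη hσ k) :=
  ((continuous_coef k).comp continuous_fst).smul
    ((continuous_tangentRidge hη hσ k).comp continuous_snd)

lemma continuous_unitH2 (hη : IsAuxiliary D η) (hσ : IsActivation σ) :
    Continuous (unitH2 hη hσ : ℝ × E n × ℝ → H2 D) :=
  continuous_fst.smul ((continuous_tangentRidge hη hσ _).comp continuous_snd)

/-- The chain rule for the contribution of a hidden unit along a path of parameters. -/
lemma hasDerivWithinAt_unitH2 (hη : IsAuxiliary D η) (hσ : IsActivation σ)
    {z : ℝ → ℝ × E n × ℝ} {z' : ℝ × E n × ℝ} {s : Set ℝ} {t : ℝ} (hz : HasDerivWithinAt z z' s t) :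
    HasDerivWithinAt (fun t => unitH2 (D := D) hη hσ (z t))
      (∑ k, coord z' k • feature hη hσ k (z t)) s t := by
  have hη2 : ContDiff ℝ 2 η := hη.cb.1.of_le (by norm_num)
  have hσ3 : ContDiff ℝ 3 σ := hσ.cb.1.of_le (by norm_num)
  have h1 : HasDerivWithinAt (fun t => (z t).1) z'.1 s t :=
    (ContinuousLinearMap.fst ℝ ℝ (E n × ℝ)).hasFDerivAt.comp_hasDerivWithinAt t hz
  have h2 : HasDerivWithinAt (fun t => (z t).2) z'.2 s t :=
    (ContinuousLinearMap.snd ℝ ℝ (E n × ℝ)).hasFDerivAt.comp_hasDerivWithinAt t hz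
  have h3 := (hasFDerivAt_ridgeH2 (D := D) hη2 hσ3 (z t).2).comp_hasDerivWithinAt t h2
  have h4 := h1.smul h3
  refine h4.congr_deriv ?_
  rw [affineComb_apply]
  simp only [Fintype.sum_sum_type, feature, coord, coef, Finset.univ_unique, Finset.sum_singleton]
  simp only [smul_add, Finset.smul_sum, smul_smul, mul_comm (z t).1, mul_one]
  rw [add_comm]
  rfl

end Features

section Tensor

variable {α V : Type*} {mα : MeasurableSpace α} {μ : Measure α} [NormedAddCommGroup V]
  [NormedSpace ℝ V]

/-- The rank one kernel `(x, y) ↦ f(x) h(y)`, seen as a function of `x` with values in the space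
`V` of functions of `y`. -/
def tensor (μ : Measure α) (V : Type*) [NormedAddCommGroup V] [NormedSpace ℝ V] :
    V →L[ℝ] Lp ℝ 2 μ →L[ℝ] Lp V 2 μ :=
  ContinuousLinearMap.compLpL₂ 2 μ (ContinuousLinearMap.lsmul ℝ ℝ : ℝ →L[ℝ] V →L[ℝ] V).flip

/-- The action `v ↦ ∫ v(x) k(x, ·) dμ(x)` of a kernel. -/
def pairing (μ : Measure α) (V : Type*) [NormedAddCommGroup V] [NormedSpace ℝ V] [CompleteSpace V] :
    Lp V 2 μ →L[ℝ] Lp ℝ 2 μ →L[ℝ] V :=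
  (ContinuousLinearMap.lsmul ℝ ℝ : ℝ →L[ℝ] V →L[ℝ] V).flip.lpPairing μ 2 2

lemma pairing_tensor [CompleteSpace V] (h : V) (f v : Lp ℝ 2 μ) :
    pairing μ V (tensor μ V h f) v = (inner ℝ v f : ℝ) • h := by
  rw [pairing, ContinuousLinearMap.lpPairing_eq_integral, L2.inner_def, ← integral_smul_const]
  refine integral_congr_ae ?_
  have := ContinuousLinearMap.coeFn_compLp
    ((ContinuousLinearMap.lsmul ℝ ℝ : ℝ →L[ℝ] V →L[ℝ] V).flip h) f
  filter_upwards [this] with x hx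
  have hx' : (tensor μ V h f) x = f x • h := hx
  rw [hx']
  simp [smul_smul]

lemma exists_norm_pairing_le (μ : Measure α) (V : Type*) [NormedAddCommGroup V] [NormedSpace ℝ V]
    [CompleteSpace V] : ∃ c, 0 ≤ c ∧ ∀ A v, ‖pairing μ V A v‖ ≤ c * ‖A‖ * ‖v‖ :=
  ⟨‖pairing μ V‖, ContinuousLinearMap.opNorm_nonneg _, (pairing μ V).le_opNorm₂⟩

lemma exists_norm_tensor_le (μ : Measure α) (V : Type*) [NormedAddCommGroup V] [NormedSpace ℝ V] :
    ∃ c, 0 ≤ c ∧ ∀ (h : V) (f : Lp ℝ 2 μ) (a b : ℝ), ‖h‖ ≤ a → ‖f‖ ≤ b →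
      ‖tensor μ V h f‖ ≤ c * a * b := by
  refine ⟨‖tensor μ V‖, ContinuousLinearMap.opNorm_nonneg _, fun h f a b ha hb => ?_⟩
  have h0 : 0 ≤ ‖tensor μ V‖ := ContinuousLinearMap.opNorm_nonneg _
  have ha0 : 0 ≤ a := (norm_nonneg _).trans ha
  refine ((tensor μ V).le_opNorm₂ h f).trans ?_
  exact mul_le_mul (mul_le_mul_of_nonneg_left ha h0) hb (norm_nonneg _) (mul_nonneg h0 ha0)

lemma tensor_sub_tensor (h h' : V) (f f' : Lp ℝ 2 μ) :
    tensor μ V h' f' - tensor μ V h f = tensor μ V (h' - h) f' + tensor μ V h (f' - f) := by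
  rw [map_sub, map_sub, sub_apply]; abel

lemma continuous_tensor {β : Type*} [TopologicalSpace β] {h : β → V} {f : β → Lp ℝ 2 μ}
    (hh : Continuous h) (hf : Continuous f) : Continuous fun b => tensor μ V (h b) (f b) :=
  ((tensor μ V).continuous.comp hh).clm_apply hf

lemma pairing_sum [CompleteSpace V] {ι : Type*} (s : Finset ι) (A : ι → Lp V 2 μ) (v : Lp ℝ 2 μ) :
    pairing μ V (∑ i ∈ s, A i) v = ∑ i ∈ s, pairing μ V (A i) v := by
  rw [map_sum, sum_apply]

/-- A finite sum of rank one kernels. -/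
def tensorSum {ι : Type*} [Fintype ι] (h : ι → V) (f : ι → Lp ℝ 2 μ) : Lp V 2 μ :=
  ∑ k, tensor μ V (h k) (f k)

lemma pairing_tensorSum [CompleteSpace V] {ι : Type*} [Fintype ι] (h : ι → V) (f : ι → Lp ℝ 2 μ)
    (v : Lp ℝ 2 μ) : pairing μ V (tensorSum h f) v = ∑ k, (inner ℝ v (f k) : ℝ) • h k := by
  rw [tensorSum, pairing_sum]
  exact Finset.sum_congr rfl fun k _ => pairing_tensor _ _ _

lemma continuous_tensorSum {β ι : Type*} [TopologicalSpace β] [Fintype ι] {h : ι → β → V}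
    {f : ι → β → Lp ℝ 2 μ} (hh : ∀ k, Continuous (h k)) (hf : ∀ k, Continuous (f k)) :
    Continuous fun b => tensorSum (fun k => h k b) fun k => f k b :=
  continuous_finsetSum _ fun k _ => continuous_tensor (hh k) (hf k)

lemma exists_norm_tensorSum_le (μ : Measure α) (V : Type*) [NormedAddCommGroup V] [NormedSpace ℝ V]
    (ι : Type*) [Fintype ι] :
    ∃ c, 0 ≤ c ∧ (∀ (h : ι → V) (f : ι → Lp ℝ 2 μ) (a b : ℝ), (∀ k, ‖h k‖ ≤ a) → (∀ k, ‖f k‖ ≤ b) →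
      ‖tensorSum h f‖ ≤ c * (a * b)) ∧
    ∀ (h h' : ι → V) (f f' : ι → Lp ℝ 2 μ) (a b a' b' : ℝ), (∀ k, ‖h k‖ ≤ a) → (∀ k, ‖f' k‖ ≤ b) →
      (∀ k, ‖h' k - h k‖ ≤ a') → (∀ k, ‖f' k - f k‖ ≤ b') →
      ‖tensorSum h' f' - tensorSum h f‖ ≤ c * (a' * b + a * b') := by
  obtain ⟨c, hc0, hc⟩ := exists_norm_tensor_le μ V
  refine ⟨∑ _k : ι, c, by positivity, fun h f a b ha hb => ?_, fun h h' f f' a b a' b' ha hb ha' hb' => ?_⟩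
  · rw [tensorSum, Finset.sum_mul]
    refine norm_sum_le_of_le _ fun k _ => ?_
    rw [← mul_assoc]
    exact hc _ _ _ _ (ha k) (hb k)
  · rw [tensorSum, tensorSum, ← Finset.sum_sub_distrib, Finset.sum_mul]
    refine norm_sum_le_of_le _ fun k _ => ?_
    rw [tensor_sub_tensor, mul_add, ← mul_assoc, ← mul_assoc]
    exact norm_add_le_of_le (hc _ _ _ _ (ha' k) (hb k)) (hc _ _ _ _ (ha k) (hb' k))

end Tensor

section Kernel

variable {n : ℕ} {D : Domain n} {η : E n → ℝ} {σ : ℝ → ℝ}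

/-- Kernels on `Ω × Ω`, seen as square integrable functions of the first variable with values in
`H²` in the second one. -/
abbrev KernelSpace (D : Domain n) := Lp (H2 D) 2 D.μ

/-- The neural tangent kernel of a single hidden unit. -/
def unitKernel (hη : IsAuxiliary D η) (hσ : IsActivation σ) (z : ℝ × E n × ℝ) : KernelSpace D :=
  tensorSum (fun k => feature hη hσ k z) fun k => incl D (feature hη hσ k z)

lemma pairing_unitKernel (hη : IsAuxiliary D η) (hσ : IsActivation σ) (z : ℝ × E n × ℝ)
    (v : Lp ℝ 2 D.μ) : pairing D.μ (H2 D) (unitKernel hη hσ z) v =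
      ∑ k, (inner ℝ v (incl D (feature hη hσ k z)) : ℝ) • feature hη hσ k z :=
  pairing_tensorSum _ _ _

lemma continuous_unitKernel (hη : IsAuxiliary D η) (hσ : IsActivation σ) :
    Continuous (unitKernel hη hσ : ℝ × E n × ℝ → KernelSpace D) :=
  continuous_tensorSum (fun k => continuous_feature hη hσ k)
    fun k => (incl D).continuous.comp (continuous_feature hη hσ k)

lemma exists_norm_unitKernel_le (hη : IsAuxiliary D η) (hσ : IsActivation σ) {K : ℝ} (hK : 1 ≤ K) :
    ∃ C, 0 ≤ C ∧ ∀ z : ℝ × E n × ℝ, |z.1| ≤ K →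
      ‖unitKernel (D := D) hη hσ z‖ ≤ C * (1 + ‖z.2.1‖ ^ 2) := by
  obtain ⟨C, hC⟩ := exists_tangentBounds hη hσ
  obtain ⟨c, hc0, hc, -⟩ := exists_norm_tensorSum_le D.μ (H2 D) (ParamIdx n)
  refine ⟨c * (K * C) ^ 2, by positivity, fun z hz => ?_⟩
  refine (hc _ _ _ _ (fun k => hC.norm_feature_le k hK hz)
    (fun k => hC.norm_incl_feature_le k hK hz)).trans (le_of_eq ?_)
  ring

/-- The Lipschitz constant of the neural tangent kernel grows quadratically in the weights, thanks to
the uniform bounds in `L²` on the first factor. -/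
lemma exists_norm_unitKernel_sub_le (hη : IsAuxiliary D η) (hσ : IsActivation σ) {K : ℝ}
    (hK : 1 ≤ K) : ∃ C, 0 ≤ C ∧ ∀ (R : ℝ) (z z' : ℝ × E n × ℝ), |z.1| ≤ K → |z'.1| ≤ K →
      ‖z.2.1‖ ≤ R → ‖z'.2.1‖ ≤ R →
      ‖unitKernel (D := D) hη hσ z' - unitKernel hη hσ z‖ ≤ C * (1 + R ^ 2) * ‖z' - z‖ := by
  obtain ⟨C, hC⟩ := exists_tangentBounds hη hσ
  have hC0 := hC.nonneg
  obtain ⟨c, hc0, -, hc⟩ := exists_norm_tensorSum_le D.μ (H2 D) (ParamIdx n)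
  refine ⟨c * (4 * (K * C) ^ 2), by positivity, fun R z z' hz hz' hw hw' => ?_⟩
  have hR : 1 + ‖z.2.1‖ ^ 2 ≤ 1 + R ^ 2 := by gcongr
  refine (hc _ _ _ _ (K * C * (1 + R ^ 2)) (K * C) (2 * K * C * (1 + R ^ 2) * ‖z' - z‖)
    (2 * K * C * ‖z' - z‖) (fun k => (hC.norm_feature_le k hK hz).trans
      (mul_le_mul_of_nonneg_left hR (mul_nonneg (zero_le_one.trans hK) hC0)))
    (fun k => hC.norm_incl_feature_le k hK hz')
    (fun k => hC.norm_feature_sub k hK hz' hw hw')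
    (fun k => hC.norm_incl_feature_sub k hK hz')).trans (le_of_eq ?_)
  ring

end Kernel

/-! ### The nonlinear operator and its truncation as maps into `L²` -/

section Operator

variable {n : ℕ} {D : Domain n} {L : H2 D → (E n →ₘ[D.μ] ℝ)}

lemma memLp_operator (hL : IsLipschitzOperator D L) (u : H2 D) : MemLp (L u) 2 D.μ := by
  obtain ⟨C, hC⟩ := hL.lipschitz
  have hd : ∀ k, MemLp (fun x => |u.1 k x - (0 : H2 D).1 k x|) 2 D.μ := fun k =>
    ((Lp.memLp (u.1 k)).sub (Lp.memLp ((0 : H2 D).1 k))).abs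
  have hg : MemLp (fun x => C * (|H2.fn u x - H2.fn 0 x| + ∑ i, |H2.d1 u i x - H2.d1 0 i x| +
      (1 / 2) * ∑ i, ∑ j, |H2.d2 u i j x - H2.d2 0 i j x|)) 2 D.μ :=
    (((hd _).add (memLp_finsetSum _ fun i _ => hd _)).add
      ((memLp_finsetSum _ fun i _ => memLp_finsetSum _ fun j _ => hd _).const_mul (1 / 2))).const_mul C
  have hdiff : MemLp (fun x => L u x - L 0 x) 2 D.μ :=
    hg.mono' ((L u).aestronglyMeasurable.sub (L 0).aestronglyMeasurable) (hC u 0)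
  have := hdiff.add hL.zero
  refine this.ae_eq (ae_of_all _ fun x => ?_)
  simp

/-- The operator `L`, with values in `L²`. -/
def opL2 (hL : IsLipschitzOperator D L) (u : H2 D) : Lp ℝ 2 D.μ := (memLp_operator hL u).toLp _

lemma coe_opL2 (hL : IsLipschitzOperator D L) (u : H2 D) : opL2 hL u =ᵐ[D.μ] L u :=
  MemLp.coeFn_toLp _

lemma norm_jet_apply_le (U : Jet D) (k : JetIdx n) : ‖U k‖ ≤ ‖U‖ := PiLp.norm_apply_le U k

lemma exists_norm_opL2_sub_le (hL : IsLipschitzOperator D L) :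
    ∃ C, 0 ≤ C ∧ ∀ u v, ‖opL2 hL u - opL2 hL v‖ ≤ C * ‖u - v‖ := by
  obtain ⟨C, hC⟩ := hL.lipschitz
  refine ⟨|C| * Fintype.card (JetIdx n), by positivity, fun u v => ?_⟩
  set G : Lp ℝ 2 D.μ := ∑ k, |(u - v).1 k| with hG
  have hGn : ‖G‖ ≤ Fintype.card (JetIdx n) * ‖u - v‖ := by
    refine (norm_sum_le_of_le (f := fun k => |(u - v).1 k|) (n := fun _ => ‖u - v‖) _
      fun k _ => ?_).trans (by simp)
    rw [norm_abs_eq_norm]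
    exact norm_jet_apply_le (u - v).1 k
  have h1 : ∀ k, (|(u - v).1 k| : Lp ℝ 2 D.μ) =ᵐ[D.μ] fun x => |u.1 k x - v.1 k x| := fun k => by
    filter_upwards [Lp.coeFn_abs ((u - v).1 k), Lp.coeFn_sub (u.1 k) (v.1 k)] with x e1 e2
    rw [e1]
    exact congrArg abs e2
  have key : ∀ᵐ x ∂D.μ, ‖(opL2 hL u - opL2 hL v) x‖ ≤ |C| * ‖G x‖ := by
    filter_upwards [Lp.coeFn_sub (opL2 hL u) (opL2 hL v), coe_opL2 hL u, coe_opL2 hL v, hC u v,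
      coeFn_finsetSum Finset.univ (fun k => |(u - v).1 k|), ae_all_iff.2 h1] with x e1 e2 e3 e4 e5 e6
    rw [e1, Pi.sub_apply, e2, e3, Real.norm_eq_abs]
    refine e4.trans ?_
    have hGx : G x = |H2.fn u x - H2.fn v x| + ∑ i, |H2.d1 u i x - H2.d1 v i x| +
        ∑ i, ∑ j, |H2.d2 u i j x - H2.d2 v i j x| := by
      rw [hG, e5]
      simp only [e6, Fintype.sum_sum_type, Fintype.sum_prod_type, Finset.univ_unique,
        Finset.sum_singleton, add_assoc]
      rfl
    have p1 : 0 ≤ |H2.fn u x - H2.fn v x| := abs_nonneg _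
    have p2 : 0 ≤ ∑ i, |H2.d1 u i x - H2.d1 v i x| := Finset.sum_nonneg fun _ _ => abs_nonneg _
    have p3 : 0 ≤ ∑ i, ∑ j, |H2.d2 u i j x - H2.d2 v i j x| :=
      Finset.sum_nonneg fun _ _ => Finset.sum_nonneg fun _ _ => abs_nonneg _
    rw [hGx, Real.norm_of_nonneg (by positivity)]
    refine (mul_le_mul_of_nonneg_right (le_abs_self C) (by positivity)).trans ?_
    exact mul_le_mul_of_nonneg_left (by linarith) (abs_nonneg C)
  refine (Lp.norm_le_mul_norm_of_ae_le_mul key).trans ?_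
  rw [mul_assoc]
  exact mul_le_mul_of_nonneg_left hGn (abs_nonneg C)

lemma continuous_opL2 (hL : IsLipschitzOperator D L) : Continuous (opL2 hL) := by
  obtain ⟨C, hC0, hC⟩ := exists_norm_opL2_sub_le hL
  exact (LipschitzWith.of_dist_le_mul (K := ⟨C, hC0⟩) fun u v => by
    rw [dist_eq_norm, dist_eq_norm]; exact hC u v).continuous

end Operator

section Truncation

variable {β δ : ℝ} {ψ : ℕ → ℝ → ℝ}

/-- Soft thresholding of the modulus. -/
def excess (M : ℝ) (s : ℝ) : ℝ := max (|s| - M) 0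

lemma lipschitzWith_excess (M : ℝ) : LipschitzWith 1 (excess M) := by
  refine LipschitzWith.of_dist_le_mul fun s r => ?_
  rw [Real.dist_eq, Real.dist_eq, NNReal.coe_one, one_mul]
  refine (abs_max_sub_max_le_abs _ _ _).trans ?_
  rw [sub_sub_sub_cancel_right]
  exact abs_abs_sub_abs_le_abs_sub s r

lemma excess_zero {M : ℝ} (hM : 0 ≤ M) : excess M 0 = 0 := by simp [excess, hM]

lemma excess_nonneg (M s : ℝ) : 0 ≤ excess M s := le_max_right _ _

lemma excess_le {M : ℝ} (hM : 0 ≤ M) (s : ℝ) : excess M s ≤ |s| :=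
  max_le (by linarith) (abs_nonneg s)

lemma IsTruncation.apply_zero (hψ : IsTruncation β δ ψ) {N : ℕ} (hN : 0 < N) : ψ N 0 = 0 :=
  hψ.eq_self N hN 0 (by simp; positivity)

lemma IsTruncation.truncF_zero (hψ : IsTruncation β δ ψ) {N : ℕ} (hN : 0 < N) :
    truncF ψ N 0 = 0 := by
  rw [truncF, hψ.apply_zero hN, zero_mul]

lemma IsTruncation.abs_truncF_le (hψ : IsTruncation β δ ψ) {N : ℕ} (hN : 0 < N) (s : ℝ) :
    |truncF ψ N s| ≤ 2 * (N : ℝ) ^ δ := by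
  rw [truncF, abs_mul]
  exact (mul_le_of_le_one_right (abs_nonneg _) (hψ.deriv_le N hN s)).trans (hψ.bound N hN s)

lemma IsTruncation.abs_truncF_le_abs (hψ : IsTruncation β δ ψ) {N : ℕ} (hN : 0 < N) (s : ℝ) :
    |truncF ψ N s| ≤ |s| := by
  rw [truncF, abs_mul]
  refine (mul_le_of_le_one_right (abs_nonneg _) (hψ.deriv_le N hN s)).trans ?_
  have hd : Differentiable ℝ (ψ N) := (hψ.cb N hN).1.differentiable (by norm_num)
  have := Convex.norm_image_sub_le_of_norm_deriv_le (s := univ) (f := ψ N) (C := 1) (x := 0) (y := s)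
    (fun x _ => hd x) (fun x _ => hψ.deriv_le N hN x) convex_univ (mem_univ _) (mem_univ _)
  simpa [hψ.apply_zero hN] using this

lemma IsTruncation.truncF_eq_self (hψ : IsTruncation β δ ψ) {N : ℕ} (hN : 0 < N) {s : ℝ}
    (hs : |s| < (N : ℝ) ^ δ) : truncF ψ N s = s := by
  have : ψ N =ᶠ[𝓝 s] id := by
    filter_upwards [continuous_abs.continuousAt.eventually_lt continuousAt_const hs] with x hx
    exact hψ.eq_self N hN x hx.le
  rw [truncF, this.deriv_eq, deriv_id, mul_one, this.eq_of_nhds, id]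

/-- Although the Lipschitz constant of `F^N` is not controlled uniformly in `N`, the function `F^N`
is uniformly close to the identity up to the excess of one of the two arguments over `N^δ / 4`. -/
lemma IsTruncation.abs_truncF_sub_le (hψ : IsTruncation β δ ψ) {N : ℕ} (hN : 0 < N) (a b : ℝ) :
    |truncF ψ N a - b| ≤ 3 * |a - b| + 4 * excess ((N : ℝ) ^ δ / 4) b := by
  have h0 := excess_nonneg ((N : ℝ) ^ δ / 4) b
  have h1 : |b| - (N : ℝ) ^ δ / 4 ≤ excess ((N : ℝ) ^ δ / 4) b := le_max_left _ _
  -- if `|a| ≥ N^δ`, then either `|b| ≤ N^δ / 2 ≤ |a - b|`, or `|b|` is at most twice its excess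
  rcases lt_or_ge |a| ((N : ℝ) ^ δ) with h | h
  · rw [hψ.truncF_eq_self hN h]
    have := abs_nonneg (a - b)
    linarith
  · have h2 : |truncF ψ N a - b| ≤ |a| + |b| :=
      (abs_sub _ _).trans (add_le_add (hψ.abs_truncF_le_abs hN a) le_rfl)
    have h3 : |a| ≤ |a - b| + |b| := by
      have := abs_add_le (a - b) b; simpa using this
    rcases le_total |b| ((N : ℝ) ^ δ / 2) with h4 | h4
    · linarith
    · have := abs_nonneg (a - b)
      linarith

variable {α : Type*} {mα : MeasurableSpace α} {μ : Measure α}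

/-- The map `F^N`, acting on `L²`. -/
def truncL2 (μ : Measure α) (hψ : IsTruncation β δ ψ) {N : ℕ} (hN : 0 < N) (u : Lp ℝ 2 μ) : Lp ℝ 2 μ :=
  (hψ.lipschitz N hN).choose_spec.compLp (hψ.truncF_zero hN) u

lemma coe_truncL2 (hψ : IsTruncation β δ ψ) {N : ℕ} (hN : 0 < N) (u : Lp ℝ 2 μ) :
    truncL2 μ hψ hN u =ᵐ[μ] fun x => truncF ψ N (u x) :=
  LipschitzWith.coeFn_compLp _ _ _

lemma lipschitzWith_truncL2 (μ : Measure α) (hψ : IsTruncation β δ ψ) {N : ℕ} (hN : 0 < N) :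
    ∃ K, LipschitzWith K (truncL2 μ hψ hN) :=
  ⟨_, (hψ.lipschitz N hN).choose_spec.lipschitzWith_compLp (hψ.truncF_zero hN)⟩

/-- Soft thresholding, acting on `L²`. -/
def excessL2 {M : ℝ} (hM : 0 ≤ M) (u : Lp ℝ 2 μ) : Lp ℝ 2 μ :=
  (lipschitzWith_excess M).compLp (excess_zero hM) u

lemma coe_excessL2 {M : ℝ} (hM : 0 ≤ M) (u : Lp ℝ 2 μ) :
    excessL2 hM u =ᵐ[μ] fun x => excess M (u x) :=
  LipschitzWith.coeFn_compLp _ _ _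

lemma thr_nonneg (δ : ℝ) (N : ℕ) : 0 ≤ (N : ℝ) ^ δ / 4 := by positivity

lemma norm_truncL2_sub_le (hψ : IsTruncation β δ ψ) {N : ℕ} (hN : 0 < N) (u v : Lp ℝ 2 μ) :
    ‖truncL2 μ hψ hN u - v‖ ≤ 3 * ‖u - v‖ + 4 * ‖excessL2 (thr_nonneg δ N) v‖ := by
  have h : ‖truncL2 μ hψ hN u - v‖ ≤ ‖(3 : ℝ) • |u - v| + (4 : ℝ) • excessL2 (thr_nonneg δ N) v‖ := by
    refine Lp.norm_le_norm_of_ae_le ?_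
    filter_upwards [Lp.coeFn_sub (truncL2 μ hψ hN u) v, coe_truncL2 hψ hN u, Lp.coeFn_sub u v,
      Lp.coeFn_abs (u - v), coe_excessL2 (thr_nonneg δ N) v,
      Lp.coeFn_smul (3 : ℝ) |u - v|, Lp.coeFn_smul (4 : ℝ) (excessL2 (thr_nonneg δ N) v),
      Lp.coeFn_add ((3 : ℝ) • |u - v|) ((4 : ℝ) • excessL2 (thr_nonneg δ N) v)]
      with x e1 e2 e3 e4 e5 e6 e7 e8
    rw [e1, e8, Pi.sub_apply, Pi.add_apply, e2, e6, e7, Pi.smul_apply, Pi.smul_apply, e4, e3, e5,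
      Pi.sub_apply, smul_eq_mul, smul_eq_mul, Real.norm_eq_abs, Real.norm_eq_abs]
    exact (hψ.abs_truncF_sub_le hN _ _).trans (le_abs_self _)
  refine h.trans ((norm_add_le _ _).trans (le_of_eq ?_))
  rw [norm_smul, norm_smul, norm_abs_eq_norm]
  norm_num

lemma norm_sq_eq_integral (u : Lp ℝ 2 μ) : ‖u‖ ^ 2 = ∫ x, u x ^ 2 ∂μ := by
  rw [← real_inner_self_eq_norm_sq, L2.inner_def]
  simp [sq]

lemma integrable_sq (u : Lp ℝ 2 μ) : Integrable (fun x => u x ^ 2) μ := (Lp.memLp u).integrable_sq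

lemma tendsto_norm_excessL2 {δ : ℝ} (hδ : 0 < δ) (u : Lp ℝ 2 μ) :
    Tendsto (fun N : ℕ => ‖excessL2 (thr_nonneg δ N) u‖) atTop (𝓝 0) := by
  have hsq : Tendsto (fun N : ℕ => ‖excessL2 (thr_nonneg δ N) u‖ ^ 2) atTop (𝓝 0) := by
    simp only [norm_sq_eq_integral]
    have := tendsto_integral_of_dominated_convergence (μ := μ)
      (F := fun (N : ℕ) x => excessL2 (thr_nonneg δ N) u x ^ 2) (f := fun _ => 0)
      (fun x => u x ^ 2) (fun N => (integrable_sq _).1) (integrable_sq u) ?_ ?_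
    · simpa using this
    · intro N
      filter_upwards [coe_excessL2 (thr_nonneg δ N) u] with x hx
      rw [hx, Real.norm_of_nonneg (by positivity), ← sq_abs (u x)]
      exact pow_le_pow_left₀ (excess_nonneg _ _) (excess_le (thr_nonneg δ N) _) 2
    · filter_upwards [ae_all_iff.2 fun N : ℕ => coe_excessL2 (thr_nonneg δ N) u] with x hx
      refine tendsto_const_nhds.congr' ?_
      have ht : Tendsto (fun N : ℕ => (N : ℝ) ^ δ / 4) atTop atTop :=
        ((tendsto_rpow_atTop hδ).comp tendsto_natCast_atTop_atTop).atTop_div_const (by norm_num)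
      filter_upwards [ht.eventually_ge_atTop |u x|] with N hN
      rw [hx N, excess, max_eq_right (by linarith)]
      norm_num
  have := hsq.sqrt
  simpa [Real.sqrt_sq] using this

/-- The excess over `N^δ / 4` tends to zero in `L²`, uniformly on compact sets (Dini's theorem). -/
lemma eventually_norm_excessL2_le {δ : ℝ} (hδ : 0 < δ) {T : ℝ} {u : ℝ → Lp ℝ 2 μ}
    (hu : ContinuousOn u (Icc 0 T)) {ε : ℝ} (hε : 0 < ε) :
    ∀ᶠ N : ℕ in atTop, ∀ t ∈ Icc 0 T, ‖excessL2 (thr_nonneg δ N) (u t)‖ ≤ ε := by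
  have h := Antitone.tendstoUniformlyOn_of_forall_tendsto
    (F := fun (N : ℕ) t => ‖excessL2 (thr_nonneg δ N) (u t)‖) (f := fun _ => (0 : ℝ))
    (isCompact_Icc (a := (0 : ℝ)) (b := T)) ?_ ?_ continuousOn_const
    (fun t _ => tendsto_norm_excessL2 hδ (u t))
  · rw [Metric.tendstoUniformlyOn_iff] at h
    filter_upwards [h ε hε] with N hN t ht
    have := hN t ht
    rw [dist_comm, dist_zero_right, norm_norm] at this
    exact this.le
  · intro N
    exact ((lipschitzWith_excess _).continuous_compLp (excess_zero (thr_nonneg δ N))).norm.comp_continuousOn hu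
  · intro t _ N N' hNN
    refine Lp.norm_le_norm_of_ae_le ?_
    filter_upwards [coe_excessL2 (thr_nonneg δ N) (u t), coe_excessL2 (thr_nonneg δ N') (u t)] with x e1 e2
    rw [e1, e2, Real.norm_of_nonneg (excess_nonneg _ _), Real.norm_of_nonneg (excess_nonneg _ _)]
    have : (N : ℝ) ^ δ ≤ (N' : ℝ) ^ δ := Real.rpow_le_rpow (by positivity) (by exact_mod_cast hNN) hδ.le
    exact max_le_max (by linarith) le_rfl

end Truncation

lemma norm_truncL2_le {n : ℕ} {D : Domain n} {β δ : ℝ} {ψ : ℕ → ℝ → ℝ} (hψ : IsTruncation β δ ψ)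
    {N : ℕ} (hN : 0 < N) (u : Lp ℝ 2 D.μ) :
    ‖truncL2 D.μ hψ hN u‖ ≤ rootMass D * (2 * (N : ℝ) ^ δ) := by
  refine norm_le_rootMass (by positivity) ?_
  filter_upwards [coe_truncL2 hψ hN u] with x hx
  rw [hx]
  exact hψ.abs_truncF_le hN _

/-! ### Moments of the initial law and the limiting kernel -/

section Moments

variable {n : ℕ} {β : ℝ} {ν : Measure (ℝ × E n × ℝ)}

lemma one_add_sq_rpow_le {x q : ℝ} (hx : 0 ≤ x) (hq : 0 < q) :
    (1 + x ^ 2) ^ q ≤ 2 ^ q * (1 + x ^ (2 * q)) := by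
  have e : x ^ (2 * q) = (x ^ 2) ^ q := by
    rw [Real.rpow_mul hx]; norm_num
  have h : (1 + x ^ 2) ≤ 2 * max 1 (x ^ 2) := by
    rcases le_total 1 (x ^ 2) with h | h
    · rw [max_eq_right h]; linarith
    · rw [max_eq_left h]; linarith
  calc (1 + x ^ 2) ^ q ≤ (2 * max 1 (x ^ 2)) ^ q := Real.rpow_le_rpow (by positivity) h hq.le
    _ = 2 ^ q * (max 1 (x ^ 2)) ^ q := Real.mul_rpow (by norm_num) (by positivity)
    _ ≤ 2 ^ q * (1 + x ^ (2 * q)) := by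
        refine mul_le_mul_of_nonneg_left ?_ (by positivity)
        rw [e]
        rcases le_total 1 (x ^ 2) with h | h
        · rw [max_eq_right h]; linarith
        · rw [max_eq_left h, Real.one_rpow]
          have : 0 ≤ (x ^ 2) ^ q := by positivity
          linarith

lemma norm_rpow_le_sum (w : E n) {p : ℝ} (hp : 0 < p) :
    ‖w‖ ^ p ≤ (n : ℝ) ^ p * ∑ k, |w k| ^ p := by
  have h1 : ‖w‖ ≤ ∑ k, |w k| := by
    rw [EuclideanSpace.norm_eq]
    refine Real.sqrt_le_iff.2 ⟨by positivity, ?_⟩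
    simp only [Real.norm_eq_abs]
    exact Finset.sum_sq_le_sq_sum_of_nonneg fun i _ => abs_nonneg _
  rcases Nat.eq_zero_or_pos n with rfl | hn
  · have : w = 0 := Subsingleton.elim _ _
    simp [this, Real.zero_rpow hp.ne']
  · have : Nonempty (Fin n) := ⟨⟨0, hn⟩⟩
    obtain ⟨k, -, hk⟩ := Finset.exists_max_image Finset.univ (fun k => |w k|) Finset.univ_nonempty
    have h2 : ‖w‖ ≤ n * |w k| := by
      refine h1.trans ((Finset.sum_le_card_nsmul _ _ _ fun j _ => hk j (Finset.mem_univ j)).trans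
        (le_of_eq ?_))
      simp
    calc ‖w‖ ^ p ≤ (n * |w k|) ^ p := Real.rpow_le_rpow (norm_nonneg _) h2 hp.le
      _ = (n : ℝ) ^ p * |w k| ^ p := Real.mul_rpow (by positivity) (abs_nonneg _)
      _ ≤ _ := by
          refine mul_le_mul_of_nonneg_left ?_ (by positivity)
          exact Finset.single_le_sum (f := fun k => |w k| ^ p) (fun j _ => by positivity)
            (Finset.mem_univ k)

lemma integrable_weight_rpow [IsFiniteMeasure ν] {q : ℝ} (hq : 0 < q)
    (h : ∀ k, Integrable (fun z : ℝ × E n × ℝ => |z.2.1 k| ^ (2 * q)) ν) :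
    Integrable (fun z : ℝ × E n × ℝ => (1 + ‖z.2.1‖ ^ 2) ^ q) ν := by
  have hb : Integrable (fun z : ℝ × E n × ℝ =>
      2 ^ q * (1 + (n : ℝ) ^ (2 * q) * ∑ k, |z.2.1 k| ^ (2 * q))) ν :=
    ((integrable_const 1).add ((integrable_finsetSum _ fun k _ => h k).const_mul _)).const_mul _
  refine hb.mono' ?_ (ae_of_all _ fun z => ?_)
  · refine Measurable.aestronglyMeasurable ?_
    exact ((measurable_snd.fst.norm.pow_const 2).const_add 1).pow_const q
  · rw [Real.norm_of_nonneg (by positivity)]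
    refine (one_add_sq_rpow_le (norm_nonneg _) hq).trans ?_
    refine mul_le_mul_of_nonneg_left (add_le_add le_rfl ?_) (by positivity)
    exact norm_rpow_le_sum _ (by positivity)

lemma IsInitialLaw.integrable_weight_three_halves (hν : IsInitialLaw β ν) :
    Integrable (fun z : ℝ × E n × ℝ => (1 + ‖z.2.1‖ ^ 2) ^ (3 / 2 : ℝ)) ν := by
  have := hν.prob
  refine integrable_weight_rpow (by norm_num) fun k => ?_
  refine (hν.moment_w k).congr (ae_of_all _ fun z => ?_)
  simp only
  rw [← Real.rpow_natCast]; norm_num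

lemma IsInitialLaw.integrable_weight_inv (hν : IsInitialLaw β ν) (hβ : 0 < β) :
    Integrable (fun z : ℝ × E n × ℝ => (1 + ‖z.2.1‖ ^ 2) ^ (1 / β)) ν := by
  have := hν.prob
  refine integrable_weight_rpow (by positivity) fun k => ?_
  refine (hν.moment_w' k).congr (ae_of_all _ fun z => ?_)
  simp only
  congr 1; ring

lemma IsInitialLaw.integrable_weight (hν : IsInitialLaw β ν) :
    Integrable (fun z : ℝ × E n × ℝ => 1 + ‖z.2.1‖ ^ 2) ν := by
  refine hν.integrable_weight_three_halves.mono' ?_ (ae_of_all _ fun z => ?_)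
  · exact ((measurable_snd.fst.norm.pow_const 2).const_add 1).aestronglyMeasurable
  · rw [Real.norm_of_nonneg (by positivity)]
    exact Real.self_le_rpow_of_one_le (by nlinarith [sq_nonneg ‖z.2.1‖]) (by norm_num)

lemma IsInitialLaw.exists_bound (hν : IsInitialLaw β ν) :
    ∃ K, 1 ≤ K ∧ ∀ᵐ z ∂ν, |z.1| ≤ K := by
  obtain ⟨K, hK⟩ := hν.bounded
  exact ⟨max 1 K, le_max_left _ _, hK.mono fun z hz => hz.le.trans (le_max_right _ _)⟩

lemma stronglyMeasurable_of_continuous {V : Type*} [NormedAddCommGroup V] {X : ℝ × E n × ℝ → V}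
    (hX : Continuous X) : StronglyMeasurable X := hX.stronglyMeasurable

lemma integrable_norm_rpow_of_weight {V : Type*} [NormedAddCommGroup V] {X : ℝ × E n × ℝ → V}
    (hX : StronglyMeasurable X) {C q : ℝ} (hC : 0 ≤ C) (hq : 0 < q)
    (hb : ∀ᵐ z ∂ν, ‖X z‖ ≤ C * (1 + ‖z.2.1‖ ^ 2))
    (hi : Integrable (fun z : ℝ × E n × ℝ => (1 + ‖z.2.1‖ ^ 2) ^ q) ν) :
    Integrable (fun z => ‖X z‖ ^ q) ν := by
  refine (hi.const_mul (C ^ q)).mono' (hX.norm.measurable.pow_const q).aestronglyMeasurable ?_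
  filter_upwards [hb] with z hz
  rw [Real.norm_of_nonneg (by positivity), ← Real.mul_rpow hC (by positivity)]
  exact Real.rpow_le_rpow (norm_nonneg _) hz hq.le

end Moments

section LimitKernel

variable {n : ℕ} {D : Domain n} {η : E n → ℝ} {σ : ℝ → ℝ} {β : ℝ} {ν : Measure (ℝ × E n × ℝ)}

lemma integrable_rpow_unitKernel (hη : IsAuxiliary D η) (hσ : IsActivation σ)
    (hν : IsInitialLaw β ν) :
    Integrable (fun z => ‖unitKernel (D := D) hη hσ z‖ ^ (3 / 2 : ℝ)) ν := by
  obtain ⟨K, hK1, hK⟩ := hν.exists_bound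
  obtain ⟨C, hC0, hC⟩ := exists_norm_unitKernel_le (D := D) hη hσ hK1
  exact integrable_norm_rpow_of_weight (stronglyMeasurable_of_continuous (continuous_unitKernel hη hσ)) hC0
    (by norm_num) (hK.mono fun z hz => hC z hz) hν.integrable_weight_three_halves

lemma integrable_unitKernel (hη : IsAuxiliary D η) (hσ : IsActivation σ) (hν : IsInitialLaw β ν) :
    Integrable (fun z => unitKernel (D := D) hη hσ z) ν := by
  have := hν.prob
  exact integrable_of_rpow (stronglyMeasurable_of_continuous (continuous_unitKernel hη hσ)) (by norm_num)
    (integrable_rpow_unitKernel hη hσ hν)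

lemma integrable_rpow_unitH2 (hη : IsAuxiliary D η) (hσ : IsActivation σ)
    (hν : IsInitialLaw β ν) (hβ : 0 < β) :
    Integrable (fun z => ‖unitH2 (D := D) hη hσ z‖ ^ (1 / β)) ν := by
  obtain ⟨K, hK1, hK⟩ := hν.exists_bound
  obtain ⟨C, hC⟩ := exists_tangentBounds hη hσ
  have hC0 := hC.nonneg
  refine integrable_norm_rpow_of_weight (C := K * C) (stronglyMeasurable_of_continuous (continuous_unitH2 hη hσ))
    (by positivity) (by positivity) (hK.mono fun z hz => ?_) (hν.integrable_weight_inv hβ)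
  rw [unitH2, norm_smul, mul_assoc]
  exact mul_le_mul hz (hC.norm_le _ _) (norm_nonneg _) (by linarith)

lemma IsInitialLaw.integral_smul_eq_zero (hν : IsInitialLaw β ν) {V : Type*} [NormedAddCommGroup V]
    [NormedSpace ℝ V] {r : E n × ℝ → V} (hr : Continuous r) :
    ∫ z : ℝ × E n × ℝ, z.1 • r z.2 ∂ν = 0 := by
  have := hν.indep.integral_fun_comp_smul_comp (f := fun c : ℝ => c) (g := r)
    measurable_fst.aemeasurable measurable_snd.aemeasurable
    measurable_id.aestronglyMeasurable hr.stronglyMeasurable.aestronglyMeasurable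
  rw [this, hν.mean_zero, zero_smul]

/-- The contribution of a hidden unit is centred, as `c` is centred and independent of `(w, b)`. -/
lemma integral_unitH2 (hη : IsAuxiliary D η) (hσ : IsActivation σ) (hν : IsInitialLaw β ν) :
    ∫ z, unitH2 (D := D) hη hσ z ∂ν = 0 :=
  hν.integral_smul_eq_zero (continuous_tangentRidge hη hσ _)

/-- The limiting neural tangent kernel. -/
def limitKernel (hη : IsAuxiliary D η) (hσ : IsActivation σ) (ν : Measure (ℝ × E n × ℝ)) :
    KernelSpace D := ∫ z, unitKernel hη hσ z ∂ν

lemma pairing_integral {α Z V : Type*} {mα : MeasurableSpace α} {μ : Measure α}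
    [NormedAddCommGroup V] [NormedSpace ℝ V] [CompleteSpace V] [MeasurableSpace Z] {ν : Measure Z}
    {A : Z → Lp V 2 μ} (hA : Integrable A ν) (v : Lp ℝ 2 μ) :
    Integrable (fun z => pairing μ V (A z) v) ν ∧
      pairing μ V (∫ z, A z ∂ν) v = ∫ z, pairing μ V (A z) v ∂ν :=
  ⟨((pairing μ V).flip v).integrable_comp hA, (((pairing μ V).flip v).integral_comp_comm hA).symm⟩

lemma map_pairing_integral {α Z V W : Type*} {mα : MeasurableSpace α} {μ : Measure α}
    [NormedAddCommGroup V] [NormedSpace ℝ V] [CompleteSpace V] [NormedAddCommGroup W]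
    [NormedSpace ℝ W] [CompleteSpace W] [MeasurableSpace Z] {ν : Measure Z}
    {A : Z → Lp V 2 μ} (hA : Integrable A ν) (v : Lp ℝ 2 μ) (l : V →L[ℝ] W) :
    Integrable (fun z => l (pairing μ V (A z) v)) ν ∧
      l (pairing μ V (∫ z, A z ∂ν) v) = ∫ z, l (pairing μ V (A z) v) ∂ν := by
  obtain ⟨h1, h2⟩ := pairing_integral hA v
  exact ⟨l.integrable_comp h1, by rw [h2, l.integral_comp_comm h1]⟩

/-- A Bochner integral in `L²` may be computed pointwise. -/
lemma coeFn_integral {α Z : Type*} {mα : MeasurableSpace α} {μ : Measure α} [IsFiniteMeasure μ]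
    [MeasurableSpace Z] {ν : Measure Z} [SFinite ν] {u : Z → Lp ℝ 2 μ} (hu : Integrable u ν)
    {U : Z → α → ℝ} (hU : Integrable (Function.uncurry U) (ν.prod μ))
    (h : ∀ z, u z =ᵐ[μ] U z) : (∫ z, u z ∂ν : Lp ℝ 2 μ) =ᵐ[μ] fun y => ∫ z, U z y ∂ν := by
  have hU' : Integrable (fun y => ∫ z, U z y ∂ν) μ := hU.integral_prod_right
  refine Integrable.ae_eq_of_forall_setIntegral_eq _ _
    ((Lp.memLp _).integrable (by norm_num)) hU' fun s hs hμs => ?_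
  rw [← L2.inner_indicatorConstLp_one hs hμs.ne, ← integral_inner hu]
  have hUs : Integrable (Function.uncurry U) (ν.prod (μ.restrict s)) :=
    hU.mono_measure (Measure.prod_mono le_rfl Measure.restrict_le_self)
  rw [← integral_integral_swap hUs]
  refine integral_congr_ae (ae_of_all _ fun z => ?_)
  simp only
  rw [L2.inner_indicatorConstLp_one hs hμs.ne]
  exact integral_congr_ae (ae_restrict_of_ae (h z))

lemma continuous_featureFn (hη : IsAuxiliary D η) (hσ : IsActivation σ) (k : ParamIdx n) :
    Continuous fun q : (ℝ × E n × ℝ) × E n => featureFn η σ k q.1 q.2 := by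
  refine ((continuous_coef k).comp continuous_fst.fst).mul ?_
  exact (continuous_ridgeFn (contDiff_mult hη k).continuous (contDiff_act' hσ k).continuous).comp
    (continuous_fst.snd.prodMk continuous_snd)

lemma exists_abs_featureFn_le (hη : IsAuxiliary D η) (hσ : IsActivation σ) {K : ℝ} (hK : 1 ≤ K) :
    ∃ C, 0 ≤ C ∧ ∀ (k : ParamIdx n) (z : ℝ × E n × ℝ), |z.1| ≤ K → ∀ y ∈ D.Ω,
      |featureFn η σ k z y| ≤ C := by
  have H1 := fun k => exists_bound_on D (contDiff_mult hη k).continuous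
  have H2 := fun k => exists_bound_act (n := n) hσ k (j := 0) (by omega)
  choose M hM0 hM using H1
  choose S hS using H2
  have hS0 : ∀ k, 0 ≤ S k := fun k => (abs_nonneg _).trans (hS k 0)
  refine ⟨∑ k, K * (M k * S k), Finset.sum_nonneg fun k _ => ?_, fun k z hz y hy => ?_⟩
  · have := hM0 k; have := hS0 k; positivity
  · have h1 : |featureFn η σ k z y| ≤ K * (M k * S k) := by
      rw [featureFn, abs_mul, ridgeFn, abs_mul]
      exact mul_le_mul (abs_coef_le k hK hz) (mul_le_mul (hM k y hy) (hS k _) (abs_nonneg _) (hM0 k))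
        (by positivity) (by linarith)
    refine h1.trans (Finset.single_le_sum (f := fun k => K * (M k * S k)) (fun k _ => ?_)
      (Finset.mem_univ k))
    have := hM0 k; have := hS0 k; positivity

lemma kernelB_eq (η : E n → ℝ) (σ : ℝ → ℝ) (ν : Measure (ℝ × E n × ℝ)) (x y : E n) :
    kernelB σ η ν x y = ∫ z, ∑ k, featureFn η σ k z x * featureFn η σ k z y ∂ν := by
  rw [kernelB, ← integral_const_mul]
  refine integral_congr_ae (ae_of_all _ fun z => ?_)
  simp only [featureFn, Fintype.sum_sum_type, coef, ridgeFn, mult, act, Finset.univ_unique,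
    Finset.sum_singleton]
  have : ∑ k : Fin n, z.1 * (η x * x k * deriv σ (inner ℝ z.2.1 x + z.2.2)) *
      (z.1 * (η y * y k * deriv σ (inner ℝ z.2.1 y + z.2.2))) =
      z.1 ^ 2 * η x * η y * deriv σ (inner ℝ z.2.1 x + z.2.2) *
        deriv σ (inner ℝ z.2.1 y + z.2.2) * inner ℝ x y := by
    rw [inner_eq_sum x y, Finset.mul_sum]
    exact Finset.sum_congr rfl fun k _ => by ring
  rw [this]
  ring

lemma inner_incl_feature (hη : IsAuxiliary D η) (hσ : IsActivation σ) (k : ParamIdx n)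
    (z : ℝ × E n × ℝ) (v : Lp ℝ 2 D.μ) : (inner ℝ v (incl D (feature hη hσ k z)) : ℝ) =
      ∫ x, v x * featureFn η σ k z x ∂D.μ := by
  rw [L2.inner_def]
  refine integral_congr_ae ?_
  filter_upwards [incl_feature hη hσ k z] with x hx
  rw [hx]; simp [mul_comm]

/-- The function underlying `∑_k ⟨v, f_k⟩ f_k`, where the `f_k` are the features of a hidden unit. -/
def kernelActionFn (hη : IsAuxiliary D η) (hσ : IsActivation σ) (v : Lp ℝ 2 D.μ) (z : ℝ × E n × ℝ)
    (y : E n) : ℝ :=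
  ∑ k, (inner ℝ v (incl D (feature hη hσ k z)) : ℝ) * featureFn η σ k z y

lemma incl_pairing_unitKernel (hη : IsAuxiliary D η) (hσ : IsActivation σ) (v : Lp ℝ 2 D.μ)
    (z : ℝ × E n × ℝ) : incl D (pairing D.μ (H2 D) (unitKernel hη hσ z) v) =ᵐ[D.μ]
      kernelActionFn hη hσ v z := by
  have e : incl D (pairing D.μ (H2 D) (unitKernel hη hσ z) v) =
      ∑ k, (inner ℝ v (incl D (feature hη hσ k z)) : ℝ) • incl D (feature hη hσ k z) := by
    rw [pairing_unitKernel, map_sum]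
    exact Finset.sum_congr rfl fun k _ => (incl D).map_smul _ _
  rw [e]
  filter_upwards [coeFn_finsetSum Finset.univ fun k =>
      (inner ℝ v (incl D (feature hη hσ k z)) : ℝ) • incl D (feature hη hσ k z),
    ae_all_iff.2 fun k => incl_feature hη hσ k z,
    ae_all_iff.2 fun k => Lp.coeFn_smul (inner ℝ v (incl D (feature hη hσ k z)) : ℝ)
      (incl D (feature hη hσ k z))] with y e1 e2 e3
  rw [e1, kernelActionFn]
  refine Finset.sum_congr rfl fun k _ => ?_
  rw [e3, Pi.smul_apply, e2, smul_eq_mul]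

lemma IsInitialLaw.ae_prod {K : ℝ} [IsProbabilityMeasure ν] (hK : ∀ᵐ z ∂ν, |z.1| ≤ K) :
    ∀ᵐ q ∂(ν.prod D.μ), |q.1.1| ≤ K ∧ q.2 ∈ D.Ω :=
  (Measure.quasiMeasurePreserving_fst.ae hK).and (Measure.quasiMeasurePreserving_snd.ae D.ae_mem)

lemma integrable_kernelActionFn (hη : IsAuxiliary D η) (hσ : IsActivation σ)
    (hν : IsInitialLaw β ν) (v : Lp ℝ 2 D.μ) :
    Integrable (Function.uncurry (kernelActionFn hη hσ v)) (ν.prod D.μ) := by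
  have := hν.prob
  obtain ⟨K, hK1, hK⟩ := hν.exists_bound
  obtain ⟨C, hC0, hC⟩ := exists_abs_featureFn_le (D := D) hη hσ hK1
  have hUc : Continuous fun q : (ℝ × E n × ℝ) × E n => kernelActionFn hη hσ v q.1 q.2 := by
    unfold kernelActionFn
    refine continuous_finsetSum _ fun k _ => ?_
    refine Continuous.mul ?_ (continuous_featureFn hη hσ k)
    exact continuous_const.inner ((incl D).continuous.comp
      ((continuous_feature hη hσ k).comp continuous_fst))
  obtain ⟨C', hC'⟩ := exists_tangentBounds hη hσ
  have hC0' := hC'.nonneg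
  refine Integrable.of_bound (f := fun q : (ℝ × E n × ℝ) × E n => kernelActionFn hη hσ v q.1 q.2)
    hUc.aestronglyMeasurable (∑ _k : ParamIdx n, ‖v‖ * (K * C') * C) ?_
  filter_upwards [IsInitialLaw.ae_prod hK] with q hq
  unfold kernelActionFn
  refine norm_sum_le_of_le _ fun k _ => ?_
  rw [norm_mul]
  refine mul_le_mul ((norm_inner_le_norm _ _).trans ?_) (hC k q.1 hq.1 q.2 hq.2) (norm_nonneg _)
    (by positivity)
  exact mul_le_mul_of_nonneg_left (hC'.norm_incl_feature_le k hK1 hq.1) (norm_nonneg _)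

/-- Fubini's theorem for the kernel `B(x, y)`. -/
lemma integral_kernelActionFn (hη : IsAuxiliary D η) (hσ : IsActivation σ)
    (hν : IsInitialLaw β ν) (v : Lp ℝ 2 D.μ) {y : E n} (hy : y ∈ D.Ω) :
    ∫ z, kernelActionFn hη hσ v z y ∂ν = opB D σ η ν v y := by
  have := hν.prob
  obtain ⟨K, hK1, hK⟩ := hν.exists_bound
  obtain ⟨C, hC0, hC⟩ := exists_abs_featureFn_le (D := D) hη hσ hK1
  have hvi : Integrable v D.μ := (Lp.memLp v).integrable (by norm_num)
  have hG : Integrable (Function.uncurry fun (z : ℝ × E n × ℝ) (x : E n) =>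
      (∑ k, featureFn η σ k z x * featureFn η σ k z y) * v x) (ν.prod D.μ) := by
    have hv2 : Integrable (fun q : (ℝ × E n × ℝ) × E n => v q.2) (ν.prod D.μ) := hvi.comp_snd ν
    refine hv2.bdd_mul (c := ∑ _k : ParamIdx n, C * C) ?_ ?_
    · refine Continuous.aestronglyMeasurable (continuous_finsetSum _ fun k _ => ?_)
      exact (continuous_featureFn hη hσ k).mul
        ((continuous_featureFn hη hσ k).comp (continuous_fst.prodMk continuous_const))
    · filter_upwards [IsInitialLaw.ae_prod hK] with q hq
      refine norm_sum_le_of_le _ fun k _ => ?_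
      rw [norm_mul]
      exact mul_le_mul (hC k q.1 hq.1 q.2 hq.2) (hC k q.1 hq.1 y hy) (norm_nonneg _) hC0
  have e1 : opB D σ η ν v y =
      ∫ x, ∫ z, (∑ k, featureFn η σ k z x * featureFn η σ k z y) * v x ∂ν ∂D.μ := by
    rw [opB]
    refine integral_congr_ae (ae_of_all _ fun x => ?_)
    simp only
    rw [kernelB_eq, integral_mul_const]
  rw [e1, ← integral_integral_swap hG]
  refine integral_congr_ae (hK.mono fun z hz => ?_)
  simp only [kernelActionFn, inner_incl_feature, Finset.sum_mul]
  rw [integral_finsetSum]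
  · refine Finset.sum_congr rfl fun k _ => ?_
    rw [← integral_mul_const]
    refine integral_congr_ae (ae_of_all _ fun x => ?_)
    simp only; ring
  · intro k _
    refine hvi.bdd_mul (c := C * C) ?_ ?_
    · exact (((continuous_featureFn hη hσ k).comp
        (continuous_const.prodMk continuous_id)).mul continuous_const).aestronglyMeasurable
    · filter_upwards [D.ae_mem] with x hx
      rw [norm_mul]
      exact mul_le_mul (hC k z hz x hx) (hC k z hz y hy) (norm_nonneg _) hC0

/-- The integral operator `𝓑` is the action of the limiting kernel. -/
lemma fn_pairing_limitKernel (hη : IsAuxiliary D η) (hσ : IsActivation σ)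
    (hν : IsInitialLaw β ν) (v : Lp ℝ 2 D.μ) :
    H2.fn (pairing D.μ (H2 D) (limitKernel hη hσ ν) v) =ᵐ[D.μ] opB D σ η ν v := by
  have := hν.prob
  obtain ⟨hi, he⟩ := map_pairing_integral (integrable_unitKernel (D := D) hη hσ hν) v (incl D)
  have h := coeFn_integral hi (integrable_kernelActionFn hη hσ hν v)
    (incl_pairing_unitKernel hη hσ v)
  rw [← he] at h
  refine h.trans ?_
  filter_upwards [D.ae_mem] with y hy
  exact integral_kernelActionFn hη hσ hν v hy

end LimitKernel

/-! ### The gradient flow as a differential equation in `H²` -/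

section Network

variable {n N : ℕ} {D : Domain n} {η : E n → ℝ} {σ : ℝ → ℝ} {β δ α T : ℝ} {ψ : ℕ → ℝ → ℝ}
  {L : H2 D → (E n →ₘ[D.μ] ℝ)}

/-- The parameters `(c, w, b)` of the `i`-th hidden unit. -/
def unitParam (i : Fin N) : Param n N →L[ℝ] ℝ × E n × ℝ :=
  LinearMap.toContinuousLinearMap
    { toFun := fun θ => (Param.c θ i, Param.w θ i, Param.b θ i)
      map_add' := fun _ _ => rfl
      map_smul' := fun _ _ => rfl }

lemma unitParam_apply (i : Fin N) (θ : Param n N) :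
    unitParam i θ = (Param.c θ i, Param.w θ i, Param.b θ i) := rfl

lemma coord_unitParam (i : Fin N) (θ : Param n N) (k : ParamIdx n) :
    coord (unitParam i θ) k = θ (i, k) := by
  rcases k with _ | _ | _ <;> rfl

lemma norm_le_sum_coord (z : ℝ × E n × ℝ) : ‖z‖ ≤ ∑ k, |coord z k| := by
  have h1 : ‖z.2.1‖ ≤ ∑ k, |z.2.1 k| := by
    rw [EuclideanSpace.norm_eq]
    refine Real.sqrt_le_iff.2 ⟨by positivity, ?_⟩
    simp only [Real.norm_eq_abs]
    exact Finset.sum_sq_le_sq_sum_of_nonneg fun i _ => abs_nonneg _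
  simp only [Fintype.sum_sum_type, Finset.univ_unique, Finset.sum_singleton, coord]
  have h2 : 0 ≤ ∑ k, |z.2.1 k| := Finset.sum_nonneg fun _ _ => abs_nonneg _
  have h3 := abs_nonneg z.1
  have h4 := abs_nonneg z.2.2
  rw [Prod.norm_def, Prod.norm_def, Real.norm_eq_abs, Real.norm_eq_abs]
  exact max_le (by linarith) (max_le (by linarith) (by linarith))

lemma IsAuxiliary.contDiff_one_sub (hη : IsAuxiliary D η) : ContDiff ℝ 2 fun x => 1 - η x :=
  contDiff_const.sub (hη.cb.1.of_le (by norm_num))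

/-- The element `(1 - η) f` of `H²`. -/
def liftH2 (hη : IsAuxiliary D η) (f : H2 D) : H2 D := (exists_mul hη.contDiff_one_sub f).choose

lemma fn_liftH2 (hη : IsAuxiliary D η) (f : H2 D) :
    H2.fn (liftH2 hη f) =ᵐ[D.μ] fun x => (1 - η x) * H2.fn f x :=
  (exists_mul hη.contDiff_one_sub f).choose_spec.1

lemma d1_liftH2 (hη : IsAuxiliary D η) (f : H2 D) (i : Fin n) :
    H2.d1 (liftH2 hη f) i =ᵐ[D.μ] fun x =>
      partialDeriv i (fun x => 1 - η x) x * H2.fn f x + (1 - η x) * H2.d1 f i x :=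
  (exists_mul hη.contDiff_one_sub f).choose_spec.2 i

/-- The approximator `Q^N(·; θ)` as an element of `H²`. -/
def netH2 (hη : IsAuxiliary D η) (hσ : IsActivation σ) (β : ℝ) (f : H2 D) (θ : Param n N) : H2 D :=
  (1 / (N : ℝ) ^ β) • (∑ i, unitH2 hη hσ (unitParam i θ)) + liftH2 hη f

lemma fn_netH2 (hη : IsAuxiliary D η) (hσ : IsActivation σ) (β : ℝ) (f : H2 D) (θ : Param n N) :
    H2.fn (netH2 hη hσ β f θ) =ᵐ[D.μ] netQ σ β η f θ := by
  have e : incl D (netH2 hη hσ β f θ) =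
      (1 / (N : ℝ) ^ β) • (∑ i, incl D (unitH2 hη hσ (unitParam i θ))) + incl D (liftH2 hη f) := by
    rw [netH2, map_add, map_smul, map_sum]
  rw [← coe_incl, e]
  filter_upwards [Lp.coeFn_add ((1 / (N : ℝ) ^ β) • (∑ i, incl D (unitH2 hη hσ (unitParam i θ))))
      (incl D (liftH2 hη f)),
    Lp.coeFn_smul (1 / (N : ℝ) ^ β) (∑ i, incl D (unitH2 hη hσ (unitParam i θ))),
    coeFn_finsetSum Finset.univ fun i => incl D (unitH2 hη hσ (unitParam i θ)),
    ae_all_iff.2 fun i => fn_unitH2 (D := D) hη hσ (unitParam i θ), fn_liftH2 hη f]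
    with x e1 e2 e3 e4 e5
  rw [e1, Pi.add_apply, e2, Pi.smul_apply, e3, coe_incl, e5, netQ, netS, smul_eq_mul, mul_assoc,
    Finset.sum_mul]
  congr 2
  refine Finset.sum_congr rfl fun i _ => ?_
  rw [coe_incl, e4 i, ridgeFn, unitParam_apply]
  ring

lemma memH2_netQ (hη : IsAuxiliary D η) (hσ : IsActivation σ) (β : ℝ) (f : H2 D) (θ : Param n N) :
    MemH2 D (netQ σ β η f θ) := ⟨_, fn_netH2 hη hσ β f θ⟩

lemma toH2_netQ (hη : IsAuxiliary D η) (hσ : IsActivation σ) (β : ℝ) (f : H2 D) (θ : Param n N) :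
    toH2 D (netQ σ β η f θ) = netH2 hη hσ β f θ := toH2_eq (fn_netH2 hη hσ β f θ)

lemma continuous_netH2 (hη : IsAuxiliary D η) (hσ : IsActivation σ) (β : ℝ) (f : H2 D) :
    Continuous (netH2 hη hσ β f : Param n N → H2 D) := by
  have h : Continuous fun θ : Param n N => ∑ i, unitH2 (D := D) hη hσ (unitParam i θ) :=
    continuous_finsetSum _ fun i _ => (continuous_unitH2 hη hσ).comp (unitParam i).continuous
  exact (h.const_smul (1 / (N : ℝ) ^ β)).add continuous_const

/-- The gradient of `-Q^N(x; θ)` in the parameters. -/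
def gradNet (n N : ℕ) (σ : ℝ → ℝ) (β : ℝ) (η : E n → ℝ) (θ : Param n N) (x : E n) : Param n N :=
  WithLp.toLp 2 fun p => -(1 / (N : ℝ) ^ β * featureFn η σ p.2 (unitParam p.1 θ) x)

lemma hasFDerivAt_unit (hσ : Differentiable ℝ σ) (x : E n) (i : Fin N) (θ : Param n N) :
    HasFDerivAt (fun θ' : Param n N => Param.c θ' i * σ (inner ℝ (Param.w θ' i) x + Param.b θ' i))
      (Param.c θ i • deriv σ (inner ℝ (Param.w θ i) x + Param.b θ i) •
        (((innerSL ℝ x).comp ((ContinuousLinearMap.fst ℝ (E n) ℝ).comp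
          ((ContinuousLinearMap.snd ℝ ℝ (E n × ℝ)).comp (unitParam i)))) +
          (ContinuousLinearMap.snd ℝ (E n) ℝ).comp
          ((ContinuousLinearMap.snd ℝ ℝ (E n × ℝ)).comp (unitParam i))) +
        σ (inner ℝ (Param.w θ i) x + Param.b θ i) •
          (ContinuousLinearMap.fst ℝ ℝ (E n × ℝ)).comp (unitParam i)) θ := by
  set ℓ : Param n N →L[ℝ] ℝ := ((innerSL ℝ x).comp ((ContinuousLinearMap.fst ℝ (E n) ℝ).comp
          ((ContinuousLinearMap.snd ℝ ℝ (E n × ℝ)).comp (unitParam i)))) +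
          (ContinuousLinearMap.snd ℝ (E n) ℝ).comp
          ((ContinuousLinearMap.snd ℝ ℝ (E n × ℝ)).comp (unitParam i)) with hℓ
  have e : ∀ θ', ℓ θ' = inner ℝ (Param.w θ' i) x + Param.b θ' i := fun θ' => by
    rw [real_inner_comm]; rfl
  have h1 : HasFDerivAt (fun θ' : Param n N => Param.c θ' i)
      ((ContinuousLinearMap.fst ℝ ℝ (E n × ℝ)).comp (unitParam i)) θ :=
    ((ContinuousLinearMap.fst ℝ ℝ (E n × ℝ)).comp (unitParam i)).hasFDerivAt
  have h2 : HasFDerivAt (fun θ' => σ (ℓ θ')) (deriv σ (ℓ θ) • ℓ) θ :=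
    (hσ (ℓ θ)).hasDerivAt.comp_hasFDerivAt θ ℓ.hasFDerivAt
  simp only [e] at h2
  exact h1.mul h2

lemma hasGradientAt_neg_netQ (hσ : Differentiable ℝ σ) (β : ℝ) (η : E n → ℝ) (f : H2 D)
    (θ : Param n N) (x : E n) :
    HasGradientAt (fun θ' : Param n N => - netQ σ β η f θ' x) (gradNet n N σ β η θ x) θ := by
  have h := ((((HasFDerivAt.fun_sum fun i (_ : i ∈ Finset.univ) =>
    hasFDerivAt_unit hσ x i θ).const_mul (1 / (N : ℝ) ^ β)).mul_const (η x)).add_const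
      ((1 - η x) * H2.fn f x)).neg
  refine (hasGradientAt_iff_hasFDerivAt).2 (h.congr_fderiv ?_)
  ext v
  rw [InnerProductSpace.toDual_apply_apply, PiLp.inner_apply, Fintype.sum_prod_type]
  simp only [neg_apply, smul_apply, sum_apply, add_apply, ContinuousLinearMap.comp_apply,
    ContinuousLinearMap.coe_fst', ContinuousLinearMap.coe_snd', smul_eq_mul, innerSL_apply_apply,
    Fintype.sum_sum_type, Finset.univ_unique, Finset.sum_singleton, gradNet, featureFn, coef, mult,
    act, ridgeFn, unitParam_apply, RCLike.inner_apply, conj_trivial]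
  rw [Finset.mul_sum, Finset.mul_sum, ← Finset.sum_neg_distrib]
  refine Finset.sum_congr rfl fun i _ => ?_
  rw [inner_eq_sum x (Param.w v i)]
  have : ∑ j : Fin n, v (i, Sum.inr (Sum.inl j)) * -(1 / (N : ℝ) ^ β * (Param.c θ i *
      (η x * x j * deriv σ (inner ℝ (Param.w θ i) x + Param.b θ i)))) =
      -(1 / (N : ℝ) ^ β * (Param.c θ i * (η x * deriv σ (inner ℝ (Param.w θ i) x + Param.b θ i)))) *
        ∑ j : Fin n, x j * Param.w v i j := by
    rw [Finset.mul_sum]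
    exact Finset.sum_congr rfl fun j _ => by simp only [Param.w]; ring
  rw [this]
  simp only [Param.c, Param.b]
  ring

/-- The error signal `F^N(L Q^N)`. -/
def signal (hL : IsLipschitzOperator D L) (hη : IsAuxiliary D η) (hσ : IsActivation σ)
    (hψ : IsTruncation β δ ψ) (hN : 0 < N) (f : H2 D) (θ : Param n N) : Lp ℝ 2 D.μ :=
  truncL2 D.μ hψ hN (opL2 hL (netH2 hη hσ β f θ))

/-- The velocity of the parameters under the biased gradient flow. -/
def velocity (hL : IsLipschitzOperator D L) (hη : IsAuxiliary D η) (hσ : IsActivation σ)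
    (hψ : IsTruncation β δ ψ) (hN : 0 < N) (f : H2 D) (α : ℝ) (θ : Param n N) : Param n N :=
  WithLp.toLp 2 fun p => α * (N : ℝ) ^ (β - 1) *
    (inner ℝ (signal hL hη hσ hψ hN f θ) (incl D (feature hη hσ p.2 (unitParam p.1 θ))) : ℝ)

lemma coe_signal (hL : IsLipschitzOperator D L) (hη : IsAuxiliary D η) (hσ : IsActivation σ)
    (hψ : IsTruncation β δ ψ) (hN : 0 < N) (f : H2 D) (θ : Param n N) :
    signal hL hη hσ hψ hN f θ =ᵐ[D.μ]
      fun x => truncF ψ N (L (toH2 D (netQ σ β η f θ)) x) := by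
  filter_upwards [coe_truncL2 hψ hN (opL2 hL (netH2 hη hσ β f θ)),
    coe_opL2 hL (netH2 hη hσ β f θ)] with x e1 e2
  rw [signal, e1, e2, toH2_netQ hη hσ]

lemma continuous_gradNet (hη : IsAuxiliary D η) (hσ : IsActivation σ) (β : ℝ) (θ : Param n N) :
    Continuous (gradNet n N σ β η θ) := by
  refine (PiLp.continuous_toLp 2 _).comp (continuous_pi fun p => ?_)
  exact (continuous_const.mul ((continuous_featureFn hη hσ p.2).comp
    (continuous_const.prodMk continuous_id))).neg

lemma biasedGradient_apply (hL : IsLipschitzOperator D L) (hη : IsAuxiliary D η)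
    (hσ : IsActivation σ) (hψ : IsTruncation β δ ψ) (hN : 0 < N) (f : H2 D) (θ : Param n N)
    (p : Fin N × ParamIdx n) : biasedGradient L σ β η f ψ θ p = -(1 / (N : ℝ) ^ β *
      (inner ℝ (signal hL hη hσ hψ hN f θ) (incl D (feature hη hσ p.2 (unitParam p.1 θ))) : ℝ)) := by
  have hd : Differentiable ℝ σ := hσ.cb.1.differentiable (by norm_num)
  have e0 : biasedGradient L σ β η f ψ θ =
      ∫ x, signal hL hη hσ hψ hN f θ x • gradNet n N σ β η θ x ∂D.μ := by
    rw [biasedGradient]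
    refine integral_congr_ae ?_
    filter_upwards [coe_signal hL hη hσ hψ hN f θ] with x hx
    rw [hx, (hasGradientAt_neg_netQ hd β η f θ x).gradient]
  have hint : Integrable (fun x => signal hL hη hσ hψ hN f θ x • gradNet n N σ β η θ x) D.μ := by
    have hK : IsCompact (closure D.Ω) := D.isBounded.isCompact_closure
    obtain ⟨C, hC⟩ := hK.exists_bound_of_continuousOn (continuous_gradNet hη hσ β θ).continuousOn
    refine Integrable.of_bound (AEStronglyMeasurable.fun_smul (Lp.aestronglyMeasurable _)
      (continuous_gradNet hη hσ β θ).aestronglyMeasurable) (2 * (N : ℝ) ^ δ * C) ?_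
    filter_upwards [D.ae_mem, coe_signal hL hη hσ hψ hN f θ] with x hx hx'
    rw [norm_smul, hx']
    exact mul_le_mul (hψ.abs_truncF_le hN _) (hC x (subset_closure hx)) (norm_nonneg _)
      (by positivity)
  have e1 := (EuclideanSpace.proj (𝕜 := ℝ) p : Param n N →L[ℝ] ℝ).integral_comp_comm hint
  rw [e0]
  refine e1.symm.trans ?_
  rw [inner_incl_feature, ← integral_const_mul, ← integral_neg]
  refine integral_congr_ae (ae_of_all _ fun x => ?_)
  change signal hL hη hσ hψ hN f θ x *
    -(1 / (N : ℝ) ^ β * featureFn η σ p.2 (unitParam p.1 θ) x) = _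
  ring

lemma neg_smul_biasedGradient (hL : IsLipschitzOperator D L) (hη : IsAuxiliary D η)
    (hσ : IsActivation σ) (hψ : IsTruncation β δ ψ) (hN : 0 < N) (f : H2 D) (θ : Param n N) :
    -(α * (N : ℝ) ^ (2 * β - 1)) • biasedGradient L σ β η f ψ θ =
      velocity hL hη hσ hψ hN f α θ := by
  ext p
  rw [PiLp.smul_apply, biasedGradient_apply hL hη hσ hψ hN, velocity, smul_eq_mul]
  have hN' : (0 : ℝ) < N := by exact_mod_cast hN
  have : (N : ℝ) ^ (β - 1) = (N : ℝ) ^ (2 * β - 1) * (1 / (N : ℝ) ^ β) := by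
    rw [one_div, ← Real.rpow_neg hN'.le, ← Real.rpow_add hN']; congr 1; ring
  simp only [this]
  ring

lemma IsTrainedPath.hasDerivWithinAt (hL : IsLipschitzOperator D L) (hη : IsAuxiliary D η)
    (hσ : IsActivation σ) (hψ : IsTruncation β δ ψ) (hN : 0 < N) {f : H2 D}
    {z : Fin N → ℝ × E n × ℝ} {θ : ℝ → Param n N} (h : IsTrainedPath L σ β η f ψ α T z θ) {t : ℝ}
    (ht : t ∈ Icc 0 T) :
    HasDerivWithinAt θ (velocity hL hη hσ hψ hN f α (θ t)) (Icc 0 T) t := by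
  rw [← neg_smul_biasedGradient]; exact h.flow t ht

lemma IsTrainedPath.hasDerivWithinAt_unitParam (hL : IsLipschitzOperator D L) (hη : IsAuxiliary D η)
    (hσ : IsActivation σ) (hψ : IsTruncation β δ ψ) (hN : 0 < N) {f : H2 D}
    {z : Fin N → ℝ × E n × ℝ} {θ : ℝ → Param n N} (h : IsTrainedPath L σ β η f ψ α T z θ) {t : ℝ}
    (ht : t ∈ Icc 0 T) (i : Fin N) :
    HasDerivWithinAt (fun t => unitParam i (θ t))
      (unitParam i (velocity hL hη hσ hψ hN f α (θ t))) (Icc 0 T) t :=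
  (unitParam i).hasFDerivAt.comp_hasDerivWithinAt t (h.hasDerivWithinAt hL hη hσ hψ hN ht)

/-- The empirical neural tangent kernel. -/
def netKernel (hη : IsAuxiliary D η) (hσ : IsActivation σ) (θ : Param n N) : KernelSpace D :=
  (N : ℝ)⁻¹ • ∑ i, unitKernel hη hσ (unitParam i θ)

lemma pairing_smul_sum {Y V ι : Type*} {mY : MeasurableSpace Y} {μ : Measure Y}
    [NormedAddCommGroup V] [NormedSpace ℝ V] [CompleteSpace V] (a : ℝ) (s : Finset ι)
    (A : ι → Lp V 2 μ) (v : Lp ℝ 2 μ) :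
    pairing μ V (a • ∑ i ∈ s, A i) v = a • ∑ i ∈ s, pairing μ V (A i) v := by
  rw [map_smul, smul_apply, pairing_sum]

lemma hasDerivWithinAt_smul_sum_add {V ι : Type*} [NormedAddCommGroup V] [NormedSpace ℝ V]
    [Fintype ι] {g : ι → ℝ → V} {g' : ι → V} {s : Set ℝ} {t : ℝ}
    (h : ∀ i, HasDerivWithinAt (g i) (g' i) s t) (a : ℝ) (b : V) :
    HasDerivWithinAt (fun t => a • (∑ i, g i t) + b) (a • ∑ i, g' i) s t :=
  ((HasDerivWithinAt.fun_sum fun i _ => h i).const_smul a).add_const b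

lemma rescale_sum {V κ : Type*} [NormedAddCommGroup V] [NormedSpace ℝ V] [Fintype κ] {N : ℕ}
    (hN : 0 < N) (α β : ℝ) (c : Fin N → κ → ℝ) (v : Fin N → κ → V) :
    (1 / (N : ℝ) ^ β) • ∑ i, ∑ k, (α * (N : ℝ) ^ (β - 1) * c i k) • v i k =
      α • (N : ℝ)⁻¹ • ∑ i, ∑ k, c i k • v i k := by
  have hN' : (0 : ℝ) < N := by exact_mod_cast hN
  have e : (N : ℝ)⁻¹ = (N : ℝ) ^ (β - 1) * (1 / (N : ℝ) ^ β) := by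
    rw [one_div, ← Real.rpow_neg hN'.le, ← Real.rpow_add hN', ← Real.rpow_neg_one]; congr 1; ring
  simp only [Finset.smul_sum, smul_smul, e]
  refine Finset.sum_congr rfl fun i _ => Finset.sum_congr rfl fun k _ => ?_
  congr 1
  ring

/-- Along the biased gradient flow, the approximator solves a differential equation in `H²` driven by
the empirical neural tangent kernel. -/
lemma IsTrainedPath.hasDerivWithinAt_netH2 (hL : IsLipschitzOperator D L) (hη : IsAuxiliary D η)
    (hσ : IsActivation σ) (hψ : IsTruncation β δ ψ) (hN : 0 < N) {f : H2 D}
    {z : Fin N → ℝ × E n × ℝ} {θ : ℝ → Param n N} (h : IsTrainedPath L σ β η f ψ α T z θ) {t : ℝ}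
    (ht : t ∈ Icc 0 T) :
    HasDerivWithinAt (fun t => netH2 hη hσ β f (θ t))
      (α • pairing D.μ (H2 D) (netKernel hη hσ (θ t)) (signal hL hη hσ hψ hN f (θ t)))
      (Icc 0 T) t := by
  refine (hasDerivWithinAt_smul_sum_add (fun i => hasDerivWithinAt_unitH2 (D := D) hη hσ
    (h.hasDerivWithinAt_unitParam hL hη hσ hψ hN ht i)) (1 / (N : ℝ) ^ β)
    (liftH2 hη f)).congr_deriv ?_
  have e : ∀ i, pairing D.μ (H2 D) (unitKernel hη hσ (unitParam i (θ t)))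
      (signal hL hη hσ hψ hN f (θ t)) = ∑ k, (inner ℝ (signal hL hη hσ hψ hN f (θ t))
        (incl D (feature hη hσ k (unitParam i (θ t)))) : ℝ) •
          feature hη hσ k (unitParam i (θ t)) := fun i => pairing_unitKernel hη hσ _ _
  rw [netKernel, pairing_smul_sum]
  simp only [e, coord_unitParam, velocity]
  exact rescale_sum hN α β _ _

/-- The parameters of a hidden unit move by at most `O(N^{β - 1 + δ})`. -/
lemma exists_displacement_le (hL : IsLipschitzOperator D L) (hη : IsAuxiliary D η)
    (hσ : IsActivation σ) (hψ : IsTruncation β δ ψ) (f : H2 D) (hβ : β < 1) (hα : 0 ≤ α)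
    (hT : 0 ≤ T) {K : ℝ} (hK : 1 ≤ K) :
    ∃ K₁ R : ℝ, K ≤ K₁ ∧ 0 ≤ R ∧ ∀ (N : ℕ), 0 < N → ∀ (z : Fin N → ℝ × E n × ℝ)
      (θ : ℝ → Param n N), IsTrainedPath L σ β η f ψ α T z θ → (∀ i, |(z i).1| ≤ K) →
      ∀ t ∈ Icc 0 T, ∀ i, |(unitParam i (θ t)).1| ≤ K₁ ∧
        ‖unitParam i (θ t) - z i‖ ≤ R * (N : ℝ) ^ (β - 1 + δ) := by
  obtain ⟨C, hC⟩ := exists_tangentBounds hη hσ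
  have hC0 := hC.nonneg
  have hm := rootMass_nonneg (D := D)
  set A := α * (rootMass D * 2) * C * T with hA
  have hA0 : 0 ≤ A := by positivity
  refine ⟨K + A, ∑ _k : ParamIdx n, (K + A) * A, by linarith,
    by positivity, fun N hN z θ h hz t ht i => ?_⟩
  have hN' : (0 : ℝ) < N := by exact_mod_cast hN
  have hN1 : (1 : ℝ) ≤ N := by exact_mod_cast hN
  set q := (N : ℝ) ^ (β - 1 + δ) with hq
  have hq0 : 0 ≤ q := by positivity
  have hq1 : q ≤ 1 := Real.rpow_le_one_of_one_le_of_nonpos hN1 (by have := hψ.lt; linarith)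
  have hpq : (N : ℝ) ^ (β - 1) * (N : ℝ) ^ δ = q := by rw [hq, Real.rpow_add hN']
  -- size of the velocity in terms of the size of the features
  have hvel : ∀ s k B, ‖incl D (feature hη hσ k (unitParam i (θ s)))‖ ≤ B →
      |velocity hL hη hσ hψ hN f α (θ s) (i, k)| ≤ α * (rootMass D * 2) * B * q := by
    intro s k B hB
    have h1 := (abs_real_inner_le_norm (signal hL hη hσ hψ hN f (θ s))
      (incl D (feature hη hσ k (unitParam i (θ s))))).trans
      (mul_le_mul (norm_truncL2_le hψ hN _) hB (norm_nonneg _) (by positivity))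
    have h2 : velocity hL hη hσ hψ hN f α (θ s) (i, k) = α * (N : ℝ) ^ (β - 1) *
      (inner ℝ (signal hL hη hσ hψ hN f (θ s))
        (incl D (feature hη hσ k (unitParam i (θ s)))) : ℝ) := rfl
    rw [h2, abs_mul, abs_of_nonneg (by positivity : 0 ≤ α * (N : ℝ) ^ (β - 1)), ← hpq]
    refine (mul_le_mul_of_nonneg_left h1 (by positivity)).trans (le_of_eq ?_)
    ring
  have h0 : unitParam i (θ 0) = z i := h.init i
  have hmem0 : (0 : ℝ) ∈ Icc 0 T := ⟨le_rfl, hT⟩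
  -- the output weights come first: their velocities involve a feature which does not depend on
  -- them, whereas the features of the other parameters are proportional to the output weight
  have hc : ∀ s ∈ Icc 0 T, |(unitParam i (θ s)).1| ≤ K + A := by
    intro s hs
    have hder : ∀ r ∈ Icc 0 T, HasDerivWithinAt (fun r => (unitParam i (θ r)).1)
        (velocity hL hη hσ hψ hN f α (θ r) (i, Sum.inl ())) (Icc 0 T) r := fun r hr =>
      (ContinuousLinearMap.fst ℝ ℝ (E n × ℝ)).hasFDerivAt.comp_hasDerivWithinAt r
        (h.hasDerivWithinAt_unitParam hL hη hσ hψ hN hr i)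
    have hb := Convex.norm_image_sub_le_of_norm_hasDerivWithin_le hder
      (C := α * (rootMass D * 2) * C * q) (fun r _ => hvel r _ C (by
        have : feature hη hσ (Sum.inl ()) (unitParam i (θ r)) =
          tangentRidge (D := D) hη hσ (Sum.inl ()) (unitParam i (θ r)).2 := one_smul _ _
        rw [this]
        exact hC.norm_incl_le _ _)) (convex_Icc _ _) hmem0 hs
    have hs' : ‖s - 0‖ ≤ T := by
      rw [sub_zero, Real.norm_of_nonneg hs.1]; exact hs.2
    have hb' : ‖(unitParam i (θ s)).1 - (unitParam i (θ 0)).1‖ ≤ A := by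
      refine hb.trans ?_
      calc α * (rootMass D * 2) * C * q * ‖s - 0‖ ≤ α * (rootMass D * 2) * C * 1 * T := by gcongr
        _ = A := by rw [hA]; ring
    rw [h0, Real.norm_eq_abs] at hb'
    have := abs_sub_abs_le_abs_sub (unitParam i (θ s)).1 (z i).1
    have := hz i
    linarith
  refine ⟨hc t ht, ?_⟩
  have hb := Convex.norm_image_sub_le_of_norm_hasDerivWithin_le
    (f := fun r => unitParam i (θ r)) (f' := fun r => unitParam i (velocity hL hη hσ hψ hN f α (θ r)))
    (C := ∑ _k : ParamIdx n, α * (rootMass D * 2) * ((K + A) * C) * q) (s := Icc 0 T)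
    (fun r hr => h.hasDerivWithinAt_unitParam hL hη hσ hψ hN hr i) (fun r hr => by
      refine (norm_le_sum_coord _).trans (Finset.sum_le_sum fun k _ => ?_)
      rw [coord_unitParam]
      exact hvel r k _ (hC.norm_incl_feature_le k (by linarith) (hc r hr)))
    (convex_Icc _ _) hmem0 ht
  simp only [h0] at hb
  have ht' : ‖t - 0‖ ≤ T := by
    rw [sub_zero, Real.norm_of_nonneg ht.1]; exact ht.2
  refine hb.trans ((mul_le_mul_of_nonneg_left ht' (by positivity)).trans (le_of_eq ?_))
  rw [Finset.sum_mul, Finset.sum_mul]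
  refine Finset.sum_congr rfl fun k _ => ?_
  rw [hA]; ring

end Network

/-! ### Stability of the differential equations in `H²` -/

section Gronwall

/-- Gronwall's inequality on `[0, T]`, for one-sided derivatives at the end points. -/
lemma norm_le_of_norm_deriv_le {V : Type*} [NormedAddCommGroup V] [NormedSpace ℝ V]
    {d d' : ℝ → V} {K ε T : ℝ} (hK : 1 ≤ K) (hε : 0 ≤ ε)
    (h : ∀ t ∈ Icc 0 T, HasDerivWithinAt d (d' t) (Icc 0 T) t)
    (hb : ∀ t ∈ Icc 0 T, ‖d' t‖ ≤ K * ‖d t‖ + ε) {t : ℝ} (ht : t ∈ Icc 0 T) :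
    ‖d t‖ ≤ (‖d 0‖ + ε) * Real.exp (K * T) := by
  have h1 := norm_le_gronwallBound_of_norm_deriv_right_le (f := d) (f' := d') (δ := ‖d 0‖) (K := K)
    (ε := ε) (a := 0) (b := T) (fun s hs => (h s hs).continuousWithinAt)
    (fun s hs => (h s (Ico_subset_Icc_self hs)).mono_of_mem_nhdsWithin
      (Icc_mem_nhdsGE_of_mem hs)) le_rfl (fun s hs => hb s (Ico_subset_Icc_self hs)) t ht
  rw [gronwallBound_of_K_ne_0 (by linarith)] at h1
  refine h1.trans ?_
  have hexp : Real.exp (K * (t - 0)) ≤ Real.exp (K * T) :=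
    Real.exp_le_exp.2 (mul_le_mul_of_nonneg_left (by linarith [ht.2]) (by linarith))
  have h3 : ε / K ≤ ε := div_le_self hε hK
  have h4 : 0 ≤ ε / K := div_nonneg hε (by linarith)
  rw [add_mul]
  refine add_le_add (mul_le_mul_of_nonneg_left hexp (norm_nonneg _)) ?_
  exact (mul_le_mul_of_nonneg_left (sub_le_self _ zero_le_one) h4).trans
    (mul_le_mul h3 hexp (Real.exp_pos _).le hε)

lemma norm_pairing_sub_le {Y V : Type*} {mY : MeasurableSpace Y} {μ : Measure Y}
    [NormedAddCommGroup V] [NormedSpace ℝ V] [CompleteSpace V] {c : ℝ} (hc0 : 0 ≤ c)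
    (hc : ∀ (A : Lp V 2 μ) (v : Lp ℝ 2 μ), ‖pairing μ V A v‖ ≤ c * ‖A‖ * ‖v‖) {α : ℝ} (hα : 0 ≤ α)
    {A K : Lp V 2 μ} {F v : Lp ℝ 2 μ} {a p q : ℝ} (ha : ‖A - K‖ ≤ a) (hp : ‖F‖ ≤ p)
    (hq : ‖F - v‖ ≤ q) :
    ‖α • pairing μ V A F - α • pairing μ V K v‖ ≤ α * (c * a * p + c * ‖K‖ * q) := by
  have e : α • pairing μ V A F - α • pairing μ V K v =
      α • (pairing μ V (A - K) F + pairing μ V K (F - v)) := by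
    rw [← smul_sub, map_sub, map_sub, sub_apply]; congr 1; abel
  have ha0 : 0 ≤ a := (norm_nonneg _).trans ha
  rw [e, norm_smul, Real.norm_of_nonneg hα]
  refine mul_le_mul_of_nonneg_left ((norm_add_le _ _).trans (add_le_add ?_ ?_)) hα
  · exact (hc _ _).trans (mul_le_mul (mul_le_mul_of_nonneg_left ha hc0) hp (norm_nonneg _)
      (mul_nonneg hc0 ha0))
  · exact (hc _ _).trans (mul_le_mul_of_nonneg_left hq (mul_nonneg hc0 (norm_nonneg _)))

lemma norm_avg_sub_avg_le {V ι : Type*} [NormedAddCommGroup V] [NormedSpace ℝ V] [Fintype ι]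
    {a : ℝ} (ha : 0 ≤ a) (u v : ι → V) {r : ι → ℝ} (h : ∀ i, ‖u i - v i‖ ≤ r i) :
    ‖a • ∑ i, u i - a • ∑ i, v i‖ ≤ a * ∑ i, r i := by
  rw [← smul_sub, ← Finset.sum_sub_distrib, norm_smul, Real.norm_of_nonneg ha]
  exact mul_le_mul_of_nonneg_left (norm_sum_le_of_le _ fun i _ => h i) ha

/-- Stability of the equations `q' = α 𝒜 F` and `Q' = α 𝒦 v` with respect to the kernel and the
signal. -/
lemma norm_sub_le_of_pairing {Y V : Type*} {mY : MeasurableSpace Y} {μ : Measure Y}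
    [NormedAddCommGroup V] [NormedSpace ℝ V] [CompleteSpace V] {c : ℝ} (hc0 : 0 ≤ c)
    (hc : ∀ (A : Lp V 2 μ) (v : Lp ℝ 2 μ), ‖pairing μ V A v‖ ≤ c * ‖A‖ * ‖v‖) {α : ℝ} (hα : 0 ≤ α)
    {T : ℝ} {A : ℝ → Lp V 2 μ} {K : Lp V 2 μ} {F v : ℝ → Lp ℝ 2 μ} {q Q : ℝ → V}
    (hq : ∀ t ∈ Icc 0 T, HasDerivWithinAt q (α • pairing μ V (A t) (F t)) (Icc 0 T) t)
    (hQ : ∀ t ∈ Icc 0 T, HasDerivWithinAt Q (α • pairing μ V K (v t)) (Icc 0 T) t)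
    {a p l r : ℝ} (hl : 0 ≤ l) (hA : ∀ t ∈ Icc 0 T, ‖A t - K‖ ≤ a) (hp : ∀ t ∈ Icc 0 T, ‖F t‖ ≤ p)
    (hr : 0 ≤ r) (hF : ∀ t ∈ Icc 0 T, ‖F t - v t‖ ≤ l * ‖q t - Q t‖ + r) {t : ℝ}
    (ht : t ∈ Icc 0 T) :
    ‖q t - Q t‖ ≤ (‖q 0 - Q 0‖ + α * (c * a * p + c * ‖K‖ * r)) *
      Real.exp ((α * (c * ‖K‖ * l) + 1) * T) := by
  have ha : 0 ≤ a := (norm_nonneg _).trans (hA t ht)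
  have hp0 : 0 ≤ p := (norm_nonneg _).trans (hp t ht)
  refine norm_le_of_norm_deriv_le (d := fun t => q t - Q t)
    (le_add_of_nonneg_left (by positivity)) (by positivity)
    (fun s hs => (hq s hs).sub (hQ s hs)) (fun s hs => ?_) ht
  refine (norm_pairing_sub_le hc0 hc hα (hA s hs) (hp s hs) (hF s hs)).trans ?_
  have := norm_nonneg (q s - Q s)
  linarith

lemma exists_norm_eq {V : Type*} [NormedAddCommGroup V] (u : V) : ∃ x : ℝ, ‖u‖ = x ∧ 0 ≤ x :=
  ⟨_, rfl, norm_nonneg u⟩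

lemma stability_bound_le {x y w r α c m k C p e : ℝ} (hx : 0 ≤ x) (hy : 0 ≤ y) (hw : 0 ≤ w)
    (hr : 0 ≤ r) (hα : 0 ≤ α) (hc : 0 ≤ c) (hm : 0 ≤ m) (hk : 0 ≤ k) (hC : 0 ≤ C) (hp : 0 ≤ p)
    (he : 0 ≤ e) :
    (x + α * (c * (C * w + y) * (m * (2 * p)) + c * k * (4 * r))) * e ≤
      (α * c * (m * 2) * (1 + C) + α * c * k * 4 + 1) * e * (x + p * y + p * w + r) := by
  have h1 : 0 ≤ α * c * (m * 2) * (x + p * w + r) := by positivity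
  have h2 : 0 ≤ α * c * (m * 2) * C * (x + p * y + r) := by positivity
  have h3 : 0 ≤ α * c * k * 4 * (x + p * y + p * w) := by positivity
  have h4 : 0 ≤ p * y := by positivity
  have h5 : 0 ≤ p * w := by positivity
  rw [mul_right_comm _ e]
  refine mul_le_mul_of_nonneg_right ?_ he
  linarith

end Gronwall

section Stability

variable {n : ℕ} {D : Domain n} {η : E n → ℝ} {σ : ℝ → ℝ} {β δ α T : ℝ} {ψ : ℕ → ℝ → ℝ}
  {L : H2 D → (E n →ₘ[D.μ] ℝ)} {ν : Measure (ℝ × E n × ℝ)}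

lemma IsWideLimit.init_eq (hη : IsAuxiliary D η) {f : H2 D} {Q : ℝ → H2 D}
    (hQ : IsWideLimit L σ η f ν α T Q) : Q 0 = liftH2 hη f :=
  H2.ext_fn (hQ.init.trans (fn_liftH2 hη f).symm)

lemma IsWideLimit.hasDerivWithinAt (hL : IsLipschitzOperator D L) (hη : IsAuxiliary D η)
    (hσ : IsActivation σ) (hν : IsInitialLaw β ν) {f : H2 D} {Q : ℝ → H2 D}
    (hQ : IsWideLimit L σ η f ν α T Q) {t : ℝ} (ht : t ∈ Icc 0 T) :
    HasDerivWithinAt Q (α • pairing D.μ (H2 D) (limitKernel hη hσ ν) (opL2 hL (Q t)))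
      (Icc 0 T) t := by
  obtain ⟨V, hV, hd⟩ := hQ.ode t ht
  have e : opB D σ η ν (opL2 hL (Q t)) = opB D σ η ν (L (Q t)) := by
    funext y
    refine integral_congr_ae ?_
    filter_upwards [coe_opL2 hL (Q t)] with x hx
    rw [hx]
  have : V = pairing D.μ (H2 D) (limitKernel hη hσ ν) (opL2 hL (Q t)) :=
    H2.ext_fn (hV.trans (by rw [← e]; exact (fn_pairing_limitKernel hη hσ hν _).symm))
  rw [← this]
  exact hd

lemma IsWideLimit.continuousOn {f : H2 D} {Q : ℝ → H2 D} (hQ : IsWideLimit L σ η f ν α T Q) :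
    ContinuousOn Q (Icc 0 T) := fun t ht => by
  obtain ⟨V, -, hd⟩ := hQ.ode t ht
  exact hd.continuousWithinAt

lemma one_add_add_sq_le {x R : ℝ} : 1 + (x + R) ^ 2 ≤ 2 * (1 + R ^ 2) * (1 + x ^ 2) := by
  nlinarith [sq_nonneg (x - R), sq_nonneg (x * R), sq_nonneg x, sq_nonneg R]

set_option maxHeartbeats 800000 in
/-- The empirical kernel stays close to its initial value. -/
lemma exists_norm_netKernel_sub_le (hL : IsLipschitzOperator D L) (hη : IsAuxiliary D η)
    (hσ : IsActivation σ) (hψ : IsTruncation β δ ψ) (f : H2 D) (hβ : β < 1) (hα : 0 ≤ α)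
    (hT : 0 ≤ T) {K : ℝ} (hK : 1 ≤ K) :
    ∃ C : ℝ, 0 ≤ C ∧ ∀ (N : ℕ), 0 < N → ∀ (z : Fin N → ℝ × E n × ℝ)
      (θ : ℝ → Param n N), IsTrainedPath L σ β η f ψ α T z θ → (∀ i, |(z i).1| ≤ K) →
      ∀ t ∈ Icc 0 T, ‖netKernel (D := D) hη hσ (θ t) - (N : ℝ)⁻¹ • ∑ i, unitKernel hη hσ (z i)‖ ≤
        C * ((N : ℝ) ^ (β - 1 + δ) * ((N : ℝ)⁻¹ * ∑ i, (1 + ‖(z i).2.1‖ ^ 2))) := by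
  obtain ⟨K₁, R, hKK, hR, hdis⟩ := exists_displacement_le hL hη hσ hψ f hβ hα hT hK
  obtain ⟨C, hC0, hC⟩ := exists_norm_unitKernel_sub_le (D := D) hη hσ (hK.trans hKK)
  refine ⟨C * (2 * (1 + R ^ 2)) * R, by positivity, fun N hN z θ h hz t ht => ?_⟩
  have hN1 : (1 : ℝ) ≤ N := by exact_mod_cast hN
  set q := (N : ℝ) ^ (β - 1 + δ) with hq
  have hq0 : 0 ≤ q := by positivity
  have hq1 : q ≤ 1 := Real.rpow_le_one_of_one_le_of_nonpos hN1 (by have := hψ.lt; linarith)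
  refine (norm_avg_sub_avg_le (V := KernelSpace D) (by positivity : 0 ≤ (N : ℝ)⁻¹)
    (fun i => unitKernel hη hσ (unitParam i (θ t))) (fun i => unitKernel hη hσ (z i))
    (r := fun i => C * (2 * (1 + R ^ 2)) * R * q * (1 + ‖(z i).2.1‖ ^ 2)) fun i => ?_).trans
    (le_of_eq ?_)
  · obtain ⟨h1, h2⟩ := hdis N hN z θ h hz t ht i
    have h3 : ‖unitParam i (θ t) - z i‖ ≤ R := h2.trans (mul_le_of_le_one_right hR hq1)
    have h4 : ‖(unitParam i (θ t)).2.1‖ ≤ ‖(z i).2.1‖ + R := by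
      have h5 : ‖(unitParam i (θ t)).2.1 - (z i).2.1‖ ≤ R :=
        ((norm_fst_le _).trans (norm_snd_le (unitParam i (θ t) - z i))).trans h3
      have := norm_le_norm_add_norm_sub' (unitParam i (θ t)).2.1 (z i).2.1
      linarith
    refine (hC (‖(z i).2.1‖ + R) (z i) (unitParam i (θ t)) ((hz i).trans hKK) h1
      (by linarith) h4).trans ?_
    calc C * (1 + (‖(z i).2.1‖ + R) ^ 2) * ‖unitParam i (θ t) - z i‖
        ≤ C * (2 * (1 + R ^ 2) * (1 + ‖(z i).2.1‖ ^ 2)) * (R * q) :=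
          mul_le_mul (mul_le_mul_of_nonneg_left one_add_add_sq_le hC0) h2 (norm_nonneg _)
            (by positivity)
      _ = _ := by ring
  · rw [← Finset.mul_sum]; ring

/-- The size of the initial fluctuations of the approximator and of its kernel, and of the displacement
of the parameters. -/
def fluctuation (hη : IsAuxiliary D η) (hσ : IsActivation σ) (β δ : ℝ) (ν : Measure (ℝ × E n × ℝ))
    {N : ℕ} (z : Fin N → ℝ × E n × ℝ) : ℝ :=
  ‖(1 / (N : ℝ) ^ β) • ∑ i, unitH2 (D := D) hη hσ (z i)‖ +
    (N : ℝ) ^ δ * ‖(N : ℝ)⁻¹ • ∑ i, unitKernel hη hσ (z i) - limitKernel (D := D) hη hσ ν‖ +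
    (N : ℝ) ^ δ * ((N : ℝ) ^ (β - 1 + δ) * ((N : ℝ)⁻¹ * ∑ i, (1 + ‖(z i).2.1‖ ^ 2)))

/-- The deterministic estimate for the distance between the approximator and its limit: it is
controlled by the initial fluctuations of the approximator and of the kernel, the displacement of the
parameters, and the effect of the truncation along the limit. -/
lemma exists_norm_netH2_sub_le (hL : IsLipschitzOperator D L) (hη : IsAuxiliary D η)
    (hσ : IsActivation σ) (hψ : IsTruncation β δ ψ) (hν : IsInitialLaw β ν) {f : H2 D} (hβ : β < 1)
    (hα : 0 ≤ α) (hT : 0 ≤ T) {K : ℝ} (hK : 1 ≤ K) {Q : ℝ → H2 D}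
    (hQ : IsWideLimit L σ η f ν α T Q) :
    ∃ C : ℝ, 0 ≤ C ∧ ∀ (N : ℕ), 0 < N → ∀ (z : Fin N → ℝ × E n × ℝ)
      (θ : ℝ → Param n N), IsTrainedPath L σ β η f ψ α T z θ → (∀ i, |(z i).1| ≤ K) → ∀ r : ℝ,
      (∀ t ∈ Icc 0 T, ‖excessL2 (thr_nonneg δ N) (opL2 hL (Q t))‖ ≤ r) →
      ∀ t ∈ Icc 0 T, ‖netH2 hη hσ β f (θ t) - Q t‖ ≤
        C * (fluctuation (D := D) hη hσ β δ ν z + r) := by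
  obtain ⟨C₁, hC10, hC1⟩ := exists_norm_netKernel_sub_le hL hη hσ hψ f hβ hα hT hK
  obtain ⟨C₂, hC20, hC2⟩ := exists_norm_opL2_sub_le hL
  obtain ⟨c, hc0, hc⟩ := exists_norm_pairing_le D.μ (H2 D)
  have hm := rootMass_nonneg (D := D)
  obtain ⟨k, hk, hk0⟩ := exists_norm_eq (limitKernel (D := D) hη hσ ν)
  refine ⟨(α * c * (rootMass D * 2) * (1 + C₁) + α * c * k * 4 + 1) *
    Real.exp ((α * (c * k * (3 * C₂)) + 1) * T), by positivity, fun N hN z θ h hz r hr t ht => ?_⟩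
  have h0 : netH2 hη hσ β f (θ 0) - Q 0 = (1 / (N : ℝ) ^ β) • ∑ i, unitH2 (D := D) hη hσ (z i) := by
    rw [hQ.init_eq hη, netH2, add_sub_cancel_right]
    have : ∀ i, unitParam i (θ 0) = z i := h.init
    simp only [this]
  obtain ⟨x, hx, hx0⟩ := exists_norm_eq ((1 / (N : ℝ) ^ β) • ∑ i, unitH2 (D := D) hη hσ (z i))
  obtain ⟨y, hy, hy0⟩ := exists_norm_eq
    ((N : ℝ)⁻¹ • ∑ i, unitKernel hη hσ (z i) - limitKernel (D := D) hη hσ ν)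
  obtain ⟨w, hw⟩ : ∃ w : ℝ,
    (N : ℝ) ^ (β - 1 + δ) * ((N : ℝ)⁻¹ * ∑ i, (1 + ‖(z i).2.1‖ ^ 2)) = w := ⟨_, rfl⟩
  have hw0 : 0 ≤ w := by rw [← hw]; positivity
  have hNd : 0 ≤ (N : ℝ) ^ δ := by positivity
  have hr0 : 0 ≤ r := (norm_nonneg _).trans (hr t ht)
  have hA : ∀ s ∈ Icc 0 T,
      ‖netKernel (D := D) hη hσ (θ s) - limitKernel hη hσ ν‖ ≤ C₁ * w + y := fun s hs =>
    (norm_sub_le_norm_sub_add_norm_sub _ ((N : ℝ)⁻¹ • ∑ i, unitKernel hη hσ (z i)) _).trans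
      (add_le_add ((hC1 N hN z θ h hz s hs).trans_eq (by rw [hw])) hy.le)
  have hF : ∀ s ∈ Icc 0 T, ‖signal hL hη hσ hψ hN f (θ s) - opL2 hL (Q s)‖ ≤
      3 * C₂ * ‖netH2 hη hσ β f (θ s) - Q s‖ + 4 * r := fun s hs =>
    (norm_truncL2_sub_le hψ hN _ _).trans (add_le_add
      ((mul_le_mul_of_nonneg_left (hC2 _ _) (by norm_num)).trans_eq (mul_assoc _ _ _).symm)
      (mul_le_mul_of_nonneg_left (hr s hs) (by norm_num)))
  have hmain := norm_sub_le_of_pairing hc0 hc hα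
    (fun s hs => h.hasDerivWithinAt_netH2 hL hη hσ hψ hN hs)
    (fun s hs => hQ.hasDerivWithinAt hL hη hσ hν hs) (l := 3 * C₂) (r := 4 * r) (by positivity) hA
    (fun s _ => norm_truncL2_le hψ hN _) (by positivity) hF ht
  rw [hk, h0, hx] at hmain
  rw [fluctuation, hx, hy, hw]
  exact hmain.trans (stability_bound_le hx0 hy0 hw0 hr0 hα hc0 hm hk0 hC10 hNd (Real.exp_pos _).le)

end Stability

/-! ### Initial fluctuations -/

section Fluctuation

variable {S Z V : Type*} [MeasurableSpace S] {P : Measure S}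
  [MeasurableSpace Z] {ν : Measure Z} {ξ : (N : ℕ) → Fin N → S → Z}

lemma integrable_norm_smul_sum_sub [IsFiniteMeasure P] [NormedAddCommGroup V] [NormedSpace ℝ V]
    (hm : ∀ N i, Measurable (ξ N i)) (hl : ∀ N i, P.map (ξ N i) = ν) {X : Z → V}
    (hX : Integrable X ν) (N : ℕ) (a : ℝ) (b : V) :
    Integrable (fun s => ‖a • ∑ i, X (ξ N i s) - b‖) P :=
  (((integrable_finsetSum _ fun i _ => integrable_comp_law (hm N i) (hl N i) hX).smul a).sub
    (integrable_const b)).norm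

lemma integrable_norm_smul_sum [NormedAddCommGroup V] [NormedSpace ℝ V]
    (hm : ∀ N i, Measurable (ξ N i)) (hl : ∀ N i, P.map (ξ N i) = ν) {X : Z → V}
    (hX : Integrable X ν) (N : ℕ) (a : ℝ) :
    Integrable (fun s => ‖a • ∑ i, X (ξ N i s)‖) P :=
  ((integrable_finsetSum _ fun i _ => integrable_comp_law (hm N i) (hl N i) hX).smul a).norm

/-- At the scaling `N^{-β}`, a sum of independent centred variables with a finite moment of order
`1 / β` tends to zero in mean. -/
lemma tendsto_integral_norm_smul_sum [IsProbabilityMeasure P]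
    [IsProbabilityMeasure ν] [NormedAddCommGroup V] [InnerProductSpace ℝ V]
    [CompleteSpace V] (hm : ∀ N i, Measurable (ξ N i)) (hl : ∀ N i, P.map (ξ N i) = ν)
    (hi : ∀ N, iIndepFun (ξ N) P) {X : Z → V} (hX : StronglyMeasurable X) {β : ℝ}
    (hβ : 1 / 2 < β) (hβ' : β < 1) (hint : Integrable (fun z => ‖X z‖ ^ (1 / β)) ν)
    (h0 : ∫ z, X z ∂ν = 0) :
    Tendsto (fun N : ℕ => ∫ s, ‖(1 / (N : ℝ) ^ β) • ∑ i, X (ξ N i s)‖ ∂P) atTop (𝓝 0) := by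
  have hβ0 : 0 < β := by linarith
  have h := tendsto_rpow_mul_integral_norm_sum hm hl hi hX (p := 1 / β)
    ((lt_div_iff₀ hβ0).2 (by linarith)) ((div_lt_iff₀ hβ0).2 (by linarith)) hint
  refine h.congr fun N => ?_
  simp only [h0, sub_zero, norm_smul]
  rw [integral_const_mul, Real.norm_of_nonneg (by positivity), one_div_one_div,
    Real.rpow_neg (by positivity), one_div]

/-- The error of an empirical mean of variables with a finite moment of order `3 / 2` is
`o(N^{-1/3})` in mean, so that it absorbs a factor `N^δ` with `δ < 1 / 3`. -/
lemma tendsto_integral_norm_avg_sub [IsProbabilityMeasure P]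
    [IsProbabilityMeasure ν] [NormedAddCommGroup V] [InnerProductSpace ℝ V]
    [CompleteSpace V] (hm : ∀ N i, Measurable (ξ N i)) (hl : ∀ N i, P.map (ξ N i) = ν)
    (hi : ∀ N, iIndepFun (ξ N) P) {X : Z → V} (hX : StronglyMeasurable X) {δ : ℝ}
    (hδ : δ < 1 / 3) (hint : Integrable (fun z => ‖X z‖ ^ (3 / 2 : ℝ)) ν) :
    Tendsto (fun N : ℕ => ∫ s, (N : ℝ) ^ δ * ‖(N : ℝ)⁻¹ • ∑ i, X (ξ N i s) - ∫ z, X z ∂ν‖ ∂P)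
      atTop (𝓝 0) := by
  have h := tendsto_rpow_mul_integral_norm_sum hm hl hi hX (p := 3 / 2) (by norm_num)
    (by norm_num) hint
  have h2 : Tendsto (fun N : ℕ => (N : ℝ) ^ (-(1 / 3 - δ))) atTop (𝓝 0) :=
    (tendsto_rpow_neg_atTop (by linarith)).comp tendsto_natCast_atTop_atTop
  have h3 := h2.mul h
  rw [zero_mul] at h3
  refine h3.congr' ?_
  filter_upwards [eventually_gt_atTop 0] with N hN
  have hN' : (0 : ℝ) < N := by exact_mod_cast hN
  rw [integral_const_mul, ← mul_assoc, ← Real.rpow_add hN']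
  have e : ∀ s, ‖(N : ℝ)⁻¹ • ∑ i, X (ξ N i s) - ∫ z, X z ∂ν‖ =
      (N : ℝ)⁻¹ * ‖∑ i, (X (ξ N i s) - ∫ z, X z ∂ν)‖ := fun s => by
    rw [Finset.sum_sub_distrib, Finset.sum_const, Finset.card_univ, Fintype.card_fin,
      ← Nat.cast_smul_eq_nsmul ℝ, ← Real.norm_of_nonneg (inv_nonneg.2 hN'.le), ← norm_smul,
      smul_sub, Real.norm_of_nonneg (inv_nonneg.2 hN'.le), inv_smul_smul₀ hN'.ne']
  simp only [e]
  rw [integral_const_mul, ← mul_assoc, ← Real.rpow_neg_one (N : ℝ), ← Real.rpow_add hN']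
  congr 2
  norm_num
  ring

lemma integral_avg (hm : ∀ N i, Measurable (ξ N i)) (hl : ∀ N i, P.map (ξ N i) = ν) {X : Z → ℝ}
    (hX : Integrable X ν) {N : ℕ} (hN : 0 < N) :
    ∫ s, (N : ℝ)⁻¹ * ∑ i, X (ξ N i s) ∂P = ∫ z, X z ∂ν := by
  have hN' : (N : ℝ) ≠ 0 := by exact_mod_cast hN.ne'
  rw [integral_const_mul, integral_finsetSum _ fun i _ => integrable_comp_law (hm N i) (hl N i) hX]
  simp only [fun i => integral_comp_law (hm N i) (hl N i) hX.1, Finset.sum_const,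
    Finset.card_univ, Fintype.card_fin, nsmul_eq_mul]
  rw [inv_mul_cancel_left₀ hN']

lemma integrable_avg (hm : ∀ N i, Measurable (ξ N i)) (hl : ∀ N i, P.map (ξ N i) = ν) {X : Z → ℝ}
    (hX : Integrable X ν) (N : ℕ) : Integrable (fun s => (N : ℝ)⁻¹ * ∑ i, X (ξ N i s)) P :=
  (integrable_finsetSum _ fun i _ => integrable_comp_law (hm N i) (hl N i) hX).const_mul _

lemma tendsto_integral_weight (hm : ∀ N i, Measurable (ξ N i)) (hl : ∀ N i, P.map (ξ N i) = ν)
    {X : Z → ℝ} (hX : Integrable X ν) {β δ : ℝ} (h : δ < (1 - β) / 2) :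
    Tendsto (fun N : ℕ => ∫ s, (N : ℝ) ^ δ * ((N : ℝ) ^ (β - 1 + δ) *
      ((N : ℝ)⁻¹ * ∑ i, X (ξ N i s))) ∂P) atTop (𝓝 0) := by
  have h2 : Tendsto (fun N : ℕ => (N : ℝ) ^ (-(1 - β - 2 * δ))) atTop (𝓝 0) :=
    (tendsto_rpow_neg_atTop (by linarith)).comp tendsto_natCast_atTop_atTop
  have h3 := h2.mul_const (∫ z, X z ∂ν)
  rw [zero_mul] at h3
  refine h3.congr' ?_
  filter_upwards [eventually_gt_atTop 0] with N hN
  have hN' : (0 : ℝ) < N := by exact_mod_cast hN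
  rw [integral_const_mul, integral_const_mul, integral_avg hm hl hX hN, ← mul_assoc,
    ← Real.rpow_add hN']
  congr 2
  ring

lemma tendsto_integral_add_three {a b c : ℕ → S → ℝ} (ha : ∀ N, Integrable (a N) P)
    (hb : ∀ N, Integrable (b N) P) (hc : ∀ N, Integrable (c N) P)
    (ha' : Tendsto (fun N => ∫ s, a N s ∂P) atTop (𝓝 0))
    (hb' : Tendsto (fun N => ∫ s, b N s ∂P) atTop (𝓝 0))
    (hc' : Tendsto (fun N => ∫ s, c N s ∂P) atTop (𝓝 0)) :
    Tendsto (fun N => ∫ s, a N s + b N s + c N s ∂P) atTop (𝓝 0) := by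
  have h := (ha'.add hb').add hc'
  rw [add_zero, add_zero] at h
  refine h.congr fun N => ?_
  exact ((integral_add ((ha N).add (hb N)) (hc N)).trans
    (congrArg (· + _) (integral_add (ha N) (hb N)))).symm

end Fluctuation

section FluctuationH2

variable {n : ℕ} {D : Domain n} {η : E n → ℝ} {σ : ℝ → ℝ} {β δ : ℝ}
  {ν : Measure (ℝ × E n × ℝ)} {S : Type*} [MeasurableSpace S] {P : Measure S}
  [IsProbabilityMeasure P] {ξ : (N : ℕ) → Fin N → S → ℝ × E n × ℝ}

lemma integrable_unitH2 (hη : IsAuxiliary D η) (hσ : IsActivation σ) (hν : IsInitialLaw β ν)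
    (hβ : 1 / 2 < β) (hβ' : β < 1) : Integrable (fun z => unitH2 (D := D) hη hσ z) ν := by
  have := hν.prob
  exact integrable_of_rpow (stronglyMeasurable_of_continuous (continuous_unitH2 hη hσ))
    ((le_div_iff₀ (by linarith)).2 (by linarith)) (integrable_rpow_unitH2 hη hσ hν (by linarith))

lemma integrable_fluctuation (hη : IsAuxiliary D η) (hσ : IsActivation σ) (hν : IsInitialLaw β ν)
    (hξ : IsInitialization P ν ξ) (hβ : 1 / 2 < β) (hβ' : β < 1) (δ : ℝ) (N : ℕ) :
    Integrable (fun s => fluctuation (D := D) hη hσ β δ ν fun i => ξ N i s) P :=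
  ((integrable_norm_smul_sum hξ.measurable hξ.law (integrable_unitH2 hη hσ hν hβ hβ') N _).add
    ((integrable_norm_smul_sum_sub hξ.measurable hξ.law (integrable_unitKernel hη hσ hν)
      N _ _).const_mul _)).add
    (((integrable_avg hξ.measurable hξ.law hν.integrable_weight N).const_mul _).const_mul _)

lemma tendsto_integral_fluctuation (hη : IsAuxiliary D η) (hσ : IsActivation σ)
    (hν : IsInitialLaw β ν) (hξ : IsInitialization P ν ξ) (hβ : 1 / 2 < β) (hβ' : β < 1)
    (hδ : δ < (1 - β) / 2) :
    Tendsto (fun N : ℕ => ∫ s, fluctuation (D := D) hη hσ β δ ν (fun i => ξ N i s) ∂P) atTop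
      (𝓝 0) := by
  have := hν.prob
  exact tendsto_integral_add_three
    (fun N => integrable_norm_smul_sum hξ.measurable hξ.law
      (integrable_unitH2 (D := D) hη hσ hν hβ hβ') N _)
    (fun N => (integrable_norm_smul_sum_sub hξ.measurable hξ.law
      (integrable_unitKernel (D := D) hη hσ hν) N _ _).const_mul _)
    (fun N => ((integrable_avg hξ.measurable hξ.law hν.integrable_weight N).const_mul _).const_mul _)
    (tendsto_integral_norm_smul_sum hξ.measurable hξ.law hξ.indep
      (stronglyMeasurable_of_continuous (continuous_unitH2 (D := D) hη hσ)) hβ hβ'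
      (integrable_rpow_unitH2 hη hσ hν (by linarith)) (integral_unitH2 hη hσ hν))
    (tendsto_integral_norm_avg_sub hξ.measurable hξ.law hξ.indep
      (stronglyMeasurable_of_continuous (continuous_unitKernel (D := D) hη hσ))
      -- `δ < (1 - β) / 2 < 1 / 4`
      (by linarith) (integrable_rpow_unitKernel hη hσ hν))
    (tendsto_integral_weight hξ.measurable hξ.law hν.integrable_weight hδ)

end FluctuationH2

/-! ### Measurability of the trained parameters -/

section LipOnBalls

variable {X V W : Type*} [NormedAddCommGroup X] [NormedAddCommGroup V] [NormedAddCommGroup W]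

/-- Lipschitz continuity on every ball around the origin. -/
def LipOnBalls (f : X → V) : Prop :=
  ∀ R : ℝ, ∃ C : ℝ, 0 ≤ C ∧ ∀ x y, ‖x‖ ≤ R → ‖y‖ ≤ R → ‖f y - f x‖ ≤ C * ‖y - x‖

lemma LipOnBalls.exists_bound {f : X → V} (hf : LipOnBalls f) {R : ℝ} (hR : 0 ≤ R) :
    ∃ B, 0 ≤ B ∧ ∀ x, ‖x‖ ≤ R → ‖f x‖ ≤ B := by
  obtain ⟨C, hC0, hC⟩ := hf R
  refine ⟨‖f 0‖ + C * R, by positivity, fun x hx => ?_⟩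
  have h := hC 0 x (by simpa using hR) hx
  rw [sub_zero] at h
  have h2 := norm_le_norm_add_norm_sub' (f x) (f 0)
  have h3 : C * ‖x‖ ≤ C * R := mul_le_mul_of_nonneg_left hx hC0
  linarith

lemma LipOnBalls.comp_clm [NormedSpace ℝ X] [NormedSpace ℝ W] {f : X → V} (hf : LipOnBalls f)
    (l : W →L[ℝ] X) : LipOnBalls fun w => f (l w) := fun R => by
  obtain ⟨C, hC0, hC⟩ := hf (‖l‖ * R)
  have h : ∀ w : W, ‖w‖ ≤ R → ‖l w‖ ≤ ‖l‖ * R := fun w hw =>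
    (l.le_opNorm w).trans (mul_le_mul_of_nonneg_left hw (norm_nonneg _))
  refine ⟨C * ‖l‖, by positivity, fun x y hx hy => (hC _ _ (h x hx) (h y hy)).trans ?_⟩
  rw [← map_sub, mul_assoc]
  exact mul_le_mul_of_nonneg_left (l.le_opNorm _) hC0

lemma LipOnBalls.of_comp {f : X → V} (hf : LipOnBalls f) {g : V → W} {C : ℝ} (hC : 0 ≤ C)
    (hg : ∀ u v, ‖g u - g v‖ ≤ C * ‖u - v‖) : LipOnBalls fun x => g (f x) := fun R => by
  obtain ⟨C', hC0, hC'⟩ := hf R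
  refine ⟨C * C', by positivity, fun x y hx hy => (hg _ _).trans ?_⟩
  rw [mul_assoc]
  exact mul_le_mul_of_nonneg_left (hC' x y hx hy) hC

lemma LipOnBalls.smul_sum_add [NormedSpace ℝ V] {ι : Type*} [Fintype ι] {f : ι → X → V}
    (hf : ∀ i, LipOnBalls (f i)) (a : ℝ) (b : V) : LipOnBalls fun x => a • (∑ i, f i x) + b :=
  fun R => by
  choose C hC0 hC using fun i => hf i R
  refine ⟨|a| * ∑ i, C i, mul_nonneg (abs_nonneg a) (Finset.sum_nonneg fun i _ => hC0 i),
    fun x y hx hy => ?_⟩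
  rw [add_sub_add_right_eq_sub, ← smul_sub, ← Finset.sum_sub_distrib, norm_smul, Real.norm_eq_abs,
    mul_assoc, Finset.sum_mul]
  exact mul_le_mul_of_nonneg_left (norm_sum_le_of_le _ fun i _ => hC i x y hx hy) (abs_nonneg a)

lemma LipOnBalls.inner [InnerProductSpace ℝ V] {f g : X → V} (hf : LipOnBalls f)
    (hg : LipOnBalls g) : LipOnBalls fun x => (inner ℝ (f x) (g x) : ℝ) := fun R => by
  obtain ⟨C, hC0, hC⟩ := hf (max R 0)
  obtain ⟨C', hC0', hC'⟩ := hg (max R 0)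
  obtain ⟨B, hB0, hB⟩ := hf.exists_bound (le_max_right R 0)
  obtain ⟨B', hB0', hB'⟩ := hg.exists_bound (le_max_right R 0)
  refine ⟨B * C' + C * B', by positivity, fun x y hx hy => ?_⟩
  replace hx := hx.trans (le_max_left R 0)
  replace hy := hy.trans (le_max_left R 0)
  have e : (Inner.inner ℝ (f y) (g y) : ℝ) - Inner.inner ℝ (f x) (g x) =
      Inner.inner ℝ (f y) (g y - g x) + Inner.inner ℝ (f y - f x) (g x) := by
    rw [inner_sub_right, inner_sub_left]; ring
  rw [e]
  refine (norm_add_le _ _).trans ?_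
  have h1 := (norm_inner_le_norm (𝕜 := ℝ) (f y) (g y - g x)).trans
    (mul_le_mul (hB y hy) (hC' x y hx hy) (norm_nonneg _) hB0)
  have h2 := (norm_inner_le_norm (𝕜 := ℝ) (f y - f x) (g x)).trans
    (mul_le_mul (hC x y hx hy) (hB' x hx) (norm_nonneg _) (by positivity))
  linarith

lemma LipOnBalls.toLp {ι : Type*} [Fintype ι] {f : ι → X → ℝ} (hf : ∀ i, LipOnBalls (f i)) (a : ℝ) :
    LipOnBalls fun x => (WithLp.toLp 2 fun i => a * f i x : EuclideanSpace ℝ ι) := fun R => by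
  choose C hC0 hC using fun i => hf i R
  refine ⟨∑ i, |a| * C i, Finset.sum_nonneg fun i _ => mul_nonneg (abs_nonneg a) (hC0 i),
    fun x y hx hy => ?_⟩
  have h1 : ∀ v : EuclideanSpace ℝ ι, ‖v‖ ≤ ∑ i, |v i| := fun v => by
    rw [EuclideanSpace.norm_eq]
    refine Real.sqrt_le_iff.2 ⟨by positivity, ?_⟩
    simp only [Real.norm_eq_abs]
    exact Finset.sum_sq_le_sq_sum_of_nonneg fun i _ => abs_nonneg _
  refine (h1 _).trans ?_
  rw [Finset.sum_mul]
  refine Finset.sum_le_sum fun i _ => ?_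
  change |a * f i y - a * f i x| ≤ _
  rw [← mul_sub, abs_mul, mul_assoc]
  exact mul_le_mul_of_nonneg_left (hC i x y hx hy) (abs_nonneg a)

/-- A function which factors, on a set of full measure, through a measurable map as a locally
Lipschitz function is almost everywhere measurable, whatever its domain of definition looks like. -/
lemma aemeasurable_of_factor {S : Type*} [MeasurableSpace S] {P : Measure S} [MeasurableSpace X]
    [BorelSpace X] [MeasurableSpace V] [BorelSpace V] {ξ : S → X} (hξ : Measurable ξ) {Θ : S → V}
    {good : S → Prop} (hg : ∀ᵐ s ∂P, good s)
    (h : ∀ R : ℝ, ∃ C : ℝ, 0 ≤ C ∧ ∀ s s', good s → good s' → ‖ξ s‖ ≤ R → ‖ξ s'‖ ≤ R →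
      ‖Θ s' - Θ s‖ ≤ C * ‖ξ s' - ξ s‖) : AEMeasurable Θ P := by
  -- `Θ` itself need not be measurable off `G`, and `ξ '' G` need not be a measurable set
  obtain ⟨G, hG, hGm, hGg⟩ := hg.exists_measurable_mem
  have hmeas : Measurable fun s : G => Θ s := by
    refine measurable_of_isOpen fun U hU => ?_
    -- the largest open set of data whose preimage consists of points mapped into `U`
    let O : Set X := ⋃₀ {B | IsOpen B ∧ ∀ s' ∈ G, ξ s' ∈ B → Θ s' ∈ U}
    have hO : IsOpen O := isOpen_sUnion fun B hB => hB.1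
    have e : (fun s : G => Θ s) ⁻¹' U = (fun s : G => ξ s) ⁻¹' O := by
      ext s
      constructor
      · intro hs
        obtain ⟨ε, hε, hball⟩ := Metric.isOpen_iff.1 hU _ hs
        obtain ⟨C, hC0, hC⟩ := h (‖ξ s‖ + 1)
        refine mem_sUnion.2 ⟨Metric.ball (ξ s) (min 1 (ε / (C + 1))),
          ⟨Metric.isOpen_ball, fun s' hs' hξs' => hball ?_⟩,
          Metric.mem_ball_self (lt_min one_pos (by positivity))⟩
        rw [Metric.mem_ball, dist_eq_norm] at hξs' ⊢
        have h1 := hξs'.trans_le (min_le_left _ _)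
        have h2 := hξs'.trans_le (min_le_right _ _)
        have h3 : ‖ξ s'‖ ≤ ‖ξ s‖ + 1 := by
          have := norm_le_norm_add_norm_sub' (ξ s') (ξ s); linarith
        refine (hC s s' (hGg _ s.2) (hGg _ hs') (by linarith) h3).trans_lt ?_
        rw [lt_div_iff₀ (by linarith)] at h2
        have := norm_nonneg (ξ s' - ξ s)
        linarith
      · intro hs
        obtain ⟨B, hB, hsB⟩ := mem_sUnion.1 hs
        exact hB.2 s s.2 hsB
    rw [e]
    exact (hξ.comp measurable_subtype_coe) hO.measurableSet
  have := aemeasurable_restrict_of_measurable_subtype (μ := P) hGm hmeas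
  rwa [Measure.restrict_eq_self_of_ae_mem hG] at this

end LipOnBalls

section Flow

variable {n : ℕ} {D : Domain n} {η : E n → ℝ} {σ : ℝ → ℝ} {β δ α T : ℝ} {ψ : ℕ → ℝ → ℝ}
  {L : H2 D → (E n →ₘ[D.μ] ℝ)}

lemma lipOnBalls_unitH2 (hη : IsAuxiliary D η) (hσ : IsActivation σ) :
    LipOnBalls (unitH2 (D := D) hη hσ) := fun R => by
  obtain ⟨C, hC⟩ := exists_tangentBounds hη hσ
  have hC0 := hC.nonneg
  refine ⟨2 * max 1 R * C * (1 + R ^ 2), by positivity, fun x y hx hy => ?_⟩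
  exact hC.norm_unitH2_sub (le_max_left 1 R) (((norm_fst_le y).trans hy).trans (le_max_right 1 R))
    ((norm_fst_le _).trans ((norm_snd_le x).trans hx))
    ((norm_fst_le _).trans ((norm_snd_le y).trans hy))

lemma lipOnBalls_incl_feature (hη : IsAuxiliary D η) (hσ : IsActivation σ) (k : ParamIdx n) :
    LipOnBalls fun z => incl D (feature hη hσ k z) := fun R => by
  obtain ⟨C, hC⟩ := exists_tangentBounds hη hσ
  have hC0 := hC.nonneg
  refine ⟨2 * max 1 R * C, by positivity, fun x y hx hy => ?_⟩
  exact hC.norm_incl_feature_sub k (le_max_left 1 R)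
    (((norm_fst_le y).trans hy).trans (le_max_right 1 R))

lemma lipOnBalls_signal (hL : IsLipschitzOperator D L) (hη : IsAuxiliary D η) (hσ : IsActivation σ)
    (hψ : IsTruncation β δ ψ) {N : ℕ} (hN : 0 < N) (f : H2 D) :
    LipOnBalls (signal hL hη hσ hψ hN f) := by
  obtain ⟨C, hC0, hC⟩ := exists_norm_opL2_sub_le hL
  obtain ⟨K, hK⟩ := lipschitzWith_truncL2 D.μ hψ hN
  have h1 : LipOnBalls (netH2 hη hσ β f : Param n N → H2 D) :=
    LipOnBalls.smul_sum_add (fun i => (lipOnBalls_unitH2 hη hσ).comp_clm (unitParam i)) _ _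
  exact (h1.of_comp hC0 hC).of_comp K.2 fun u v => by
    rw [← dist_eq_norm, ← dist_eq_norm]; exact hK.dist_le_mul u v

lemma lipOnBalls_velocity (hL : IsLipschitzOperator D L) (hη : IsAuxiliary D η)
    (hσ : IsActivation σ) (hψ : IsTruncation β δ ψ) {N : ℕ} (hN : 0 < N) (f : H2 D) (α : ℝ) :
    LipOnBalls (velocity hL hη hσ hψ hN f α) := by
  have h : ∀ p : Fin N × ParamIdx n, LipOnBalls fun θ : Param n N =>
      (inner ℝ (signal hL hη hσ hψ hN f θ) (incl D (feature hη hσ p.2 (unitParam p.1 θ))) : ℝ) :=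
    fun p => (lipOnBalls_signal hL hη hσ hψ hN f).inner
      ((lipOnBalls_incl_feature hη hσ p.2).comp_clm (unitParam p.1))
  exact LipOnBalls.toLp h (α * (N : ℝ) ^ (β - 1))

lemma abs_coord_le (z : ℝ × E n × ℝ) (k : ParamIdx n) : |coord z k| ≤ ‖z‖ := by
  rcases k with _ | k | _
  · exact norm_fst_le z
  · exact (PiLp.norm_apply_le z.2.1 k).trans ((norm_fst_le _).trans (norm_snd_le z))
  · exact (norm_snd_le z.2).trans (norm_snd_le z)

lemma norm_le_of_unitParam {N : ℕ} {θ : Param n N} {r : ℝ} (h : ∀ i, ‖unitParam i θ‖ ≤ r) :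
    ‖θ‖ ≤ (∑ _p : Fin N × ParamIdx n, 1) * r := by
  have h1 : ‖θ‖ ≤ ∑ p, |θ p| := by
    rw [EuclideanSpace.norm_eq]
    refine Real.sqrt_le_iff.2 ⟨by positivity, ?_⟩
    simp only [Real.norm_eq_abs]
    exact Finset.sum_sq_le_sq_sum_of_nonneg fun i _ => abs_nonneg _
  refine h1.trans ?_
  rw [Finset.sum_mul]
  refine Finset.sum_le_sum fun p _ => ?_
  rw [one_mul, ← coord_unitParam p.1 θ p.2]
  exact (abs_coord_le _ _).trans (h p.1)

/-- The biased gradient flow depends on the initial parameters in a locally Lipschitz way. -/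
lemma exists_norm_sub_le_of_isTrainedPath (hL : IsLipschitzOperator D L) (hη : IsAuxiliary D η)
    (hσ : IsActivation σ) (hψ : IsTruncation β δ ψ) (f : H2 D) (hβ : β < 1) (hα : 0 ≤ α)
    (hT : 0 ≤ T) {K : ℝ} (hK : 1 ≤ K) {N : ℕ} (hN : 0 < N) (R : ℝ) :
    ∃ C : ℝ, 0 ≤ C ∧ ∀ (z z' : Fin N → ℝ × E n × ℝ) (θ θ' : ℝ → Param n N),
      IsTrainedPath L σ β η f ψ α T z θ → IsTrainedPath L σ β η f ψ α T z' θ' →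
      (∀ i, |(z i).1| ≤ K) → (∀ i, |(z' i).1| ≤ K) → ‖z‖ ≤ R → ‖z'‖ ≤ R →
      ∀ t ∈ Icc 0 T, ‖θ' t - θ t‖ ≤ C * ‖z' - z‖ := by
  obtain ⟨K₁, R₁, -, hR₁, hdis⟩ := exists_displacement_le hL hη hσ hψ f hβ hα hT hK
  set M : ℝ := ∑ _p : Fin N × ParamIdx n, 1 with hM
  have hM0 : 0 ≤ M := by positivity
  obtain ⟨C, hC0, hC⟩ := lipOnBalls_velocity hL hη hσ hψ hN f α
    (M * (R + R₁ * (N : ℝ) ^ (β - 1 + δ)))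
  have hball : ∀ (z : Fin N → ℝ × E n × ℝ) (θ : ℝ → Param n N),
      IsTrainedPath L σ β η f ψ α T z θ → (∀ i, |(z i).1| ≤ K) → ‖z‖ ≤ R → ∀ t ∈ Icc 0 T,
      ‖θ t‖ ≤ M * (R + R₁ * (N : ℝ) ^ (β - 1 + δ)) := fun z θ h hz hR t ht =>
    norm_le_of_unitParam fun i => by
      have h1 := (hdis N hN z θ h hz t ht i).2
      have h2 := norm_le_norm_add_norm_sub' (unitParam i (θ t)) (z i)
      have h3 := (norm_le_pi_norm z i).trans hR
      linarith
  refine ⟨M * Real.exp ((C + 1) * T), by positivity, fun z z' θ θ' h h' hz hz' hR hR' t ht => ?_⟩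
  have hg := norm_le_of_norm_deriv_le (d := fun t => θ' t - θ t) (K := C + 1) (ε := 0)
    (by linarith) le_rfl (fun s hs => (h'.hasDerivWithinAt hL hη hσ hψ hN hs).sub
      (h.hasDerivWithinAt hL hη hσ hψ hN hs)) (fun s hs => by
      have := hC _ _ (hball z θ h hz hR s hs) (hball z' θ' h' hz' hR' s hs)
      have := norm_nonneg (θ' s - θ s)
      linarith) ht
  have h0 : ‖θ' 0 - θ 0‖ ≤ M * ‖z' - z‖ := norm_le_of_unitParam fun i => by
    have e1 : unitParam i (θ 0) = z i := h.init i
    have e2 : unitParam i (θ' 0) = z' i := h'.init i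
    rw [map_sub, e1, e2]
    exact norm_le_pi_norm (z' - z) i
  rw [add_zero] at hg
  refine hg.trans ((mul_le_mul_of_nonneg_right h0 (Real.exp_pos _).le).trans (le_of_eq ?_))
  ring

lemma aemeasurable_trained {ν : Measure (ℝ × E n × ℝ)} {S : Type*} [MeasurableSpace S]
    {P : Measure S} {ξ : (N : ℕ) → Fin N → S → ℝ × E n × ℝ} (hL : IsLipschitzOperator D L)
    (hη : IsAuxiliary D η) (hσ : IsActivation σ) (hψ : IsTruncation β δ ψ) {f : H2 D} (hβ : β < 1)
    (hα : 0 ≤ α) (hξ : IsInitialization P ν ξ) {K : ℝ} (hK : 1 ≤ K)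
    {N : ℕ} (hN : 0 < N) {θ : S → ℝ → Param n N}
    (hθ : ∀ᵐ s ∂P, IsTrainedPath L σ β η f ψ α T (fun i => ξ N i s) (θ s))
    (hb : ∀ᵐ s ∂P, ∀ i, |(ξ N i s).1| ≤ K) {t : ℝ} (ht : t ∈ Icc 0 T) :
    AEMeasurable (fun s => θ s t) P := by
  refine aemeasurable_of_factor (ξ := fun s i => ξ N i s)
    (measurable_pi_lambda _ fun i => hξ.measurable N i) (hθ.and hb) fun R => ?_
  obtain ⟨C, hC0, hC⟩ := exists_norm_sub_le_of_isTrainedPath hL hη hσ hψ f hβ hα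
    (ht.1.trans ht.2) hK hN R
  exact ⟨C, hC0, fun s s' hs hs' hR hR' => hC _ _ _ _ hs.1 hs'.1 hs.2 hs'.2 hR hR' t ht⟩

end Flow

/-! ### The boundary trace of the limit -/

section ClosedSubspace

lemma pairing_integral_mem {Y Z V : Type*} {mY : MeasurableSpace Y} {μ : Measure Y}
    [NormedAddCommGroup V] [NormedSpace ℝ V] [CompleteSpace V] [MeasurableSpace Z] {ν : Measure Z}
    [IsProbabilityMeasure ν] {A : Z → Lp V 2 μ} (hA : Integrable A ν) (v : Lp ℝ 2 μ)
    {W : Submodule ℝ V} (hW : IsClosed (W : Set V)) (h : ∀ z, pairing μ V (A z) v ∈ W) :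
    pairing μ V (∫ z, A z ∂ν) v ∈ W := by
  obtain ⟨h1, h2⟩ := pairing_integral hA v
  rw [h2]
  exact Convex.integral_mem W.convex hW (ae_of_all _ h) h1

/-- A path whose velocity lies in a closed subspace does not leave its coset. -/
lemma sub_mem_topologicalClosure {V : Type*} [NormedAddCommGroup V] [InnerProductSpace ℝ V]
    [CompleteSpace V] (W : Submodule ℝ V) {q q' : ℝ → V} {T : ℝ}
    (hq : ∀ t ∈ Icc 0 T, HasDerivWithinAt q (q' t) (Icc 0 T) t)
    (h : ∀ t ∈ Icc 0 T, q' t ∈ W.topologicalClosure) {t : ℝ} (ht : t ∈ Icc 0 T) :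
    q t - q 0 ∈ W.topologicalClosure := by
  rw [← Submodule.orthogonal_orthogonal_eq_closure, Submodule.mem_orthogonal]
  intro w hw
  have hd : ∀ s ∈ Icc 0 T, HasDerivWithinAt (fun s => (inner ℝ w (q s) : ℝ)) 0 (Icc 0 T) s := by
    intro s hs
    have h1 := (innerSL ℝ w).hasFDerivAt.comp_hasDerivWithinAt s (hq s hs)
    have h2 := h s hs
    rw [← Submodule.orthogonal_orthogonal_eq_closure, Submodule.mem_orthogonal] at h2
    exact h1.congr_deriv (h2 w hw)
  have := Convex.norm_image_sub_le_of_norm_hasDerivWithin_le hd (C := 0) (fun s _ => by simp)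
    (convex_Icc _ _) ⟨le_rfl, ht.1.trans ht.2⟩ ht
  rw [zero_mul, norm_le_zero_iff] at this
  rw [inner_sub_right]
  exact this

end ClosedSubspace

section Trace

variable {n : ℕ} {D : Domain n} {η : E n → ℝ} {σ : ℝ → ℝ} {β α T : ℝ}
  {L : H2 D → (E n →ₘ[D.μ] ℝ)} {ν : Measure (ℝ × E n × ℝ)}

/-- The elements of `H²` given by `C²` functions which vanish on the boundary. -/
def smoothVanishing (D : Domain n) : Submodule ℝ (H2 D) where
  carrier := {u | ∃ (v : E n → ℝ) (hv : ContDiff ℝ 2 v), (∀ x ∈ frontier D.Ω, v x = 0) ∧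
    u = ofC2 D hv}
  add_mem' := by
    rintro _ _ ⟨v, hv, h0, rfl⟩ ⟨w, hw, h0', rfl⟩
    refine ⟨fun x => v x + w x, hv.add hw, fun x hx => by simp [h0 x hx, h0' x hx], ?_⟩
    refine H2.ext_fn ?_
    filter_upwards [fn_ofC2 (D := D) hv, fn_ofC2 (D := D) hw, fn_ofC2 (D := D) (hv.add hw),
      Lp.coeFn_add (incl D (ofC2 D hv)) (incl D (ofC2 D hw))] with x e1 e2 e3 e4
    exact e4.trans ((congrArg₂ (· + ·) e1 e2).trans e3.symm)
  zero_mem' := by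
    refine ⟨fun _ => 0, contDiff_const, fun _ _ => rfl, H2.ext_fn ?_⟩
    exact (Lp.coeFn_zero ℝ 2 D.μ).trans (fn_ofC2 contDiff_const).symm
  smul_mem' := by
    rintro c _ ⟨v, hv, h0, rfl⟩
    refine ⟨fun x => c * v x, contDiff_const.mul hv, fun x hx => by simp [h0 x hx], ?_⟩
    refine H2.ext_fn ?_
    filter_upwards [fn_ofC2 (D := D) hv, fn_ofC2 (D := D) (contDiff_const.mul hv),
      Lp.coeFn_smul c (incl D (ofC2 D hv))] with x e1 e3 e4
    exact e4.trans ((congrArg (c * ·) e1).trans e3.symm)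

lemma mult_eq_zero (hη : IsAuxiliary D η) {x : E n} (hx : x ∈ frontier D.Ω) :
    ∀ k, mult η k x = 0
  | Sum.inl _ => hη.boundary x hx
  | Sum.inr (Sum.inl i) => by simp [mult, hη.boundary x hx]
  | Sum.inr (Sum.inr _) => hη.boundary x hx

lemma feature_mem_smoothVanishing (hη : IsAuxiliary D η) (hσ : IsActivation σ) (k : ParamIdx n)
    (z : ℝ × E n × ℝ) : feature hη hσ k z ∈ smoothVanishing D :=
  (smoothVanishing D).smul_mem _ ⟨ridgeFn (mult η k) (act n σ k) z.2,
    contDiff_ridgeFn (contDiff_mult hη k) (contDiff_act' hσ k) z.2,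
    fun x hx => by rw [ridgeFn, mult_eq_zero hη hx, zero_mul], rfl⟩

lemma pairing_limitKernel_mem (hη : IsAuxiliary D η) (hσ : IsActivation σ)
    (hν : IsInitialLaw β ν) (v : Lp ℝ 2 D.μ) :
    pairing D.μ (H2 D) (limitKernel hη hσ ν) v ∈ (smoothVanishing D).topologicalClosure := by
  have := hν.prob
  refine pairing_integral_mem (integrable_unitKernel hη hσ hν) v
    (Submodule.isClosed_topologicalClosure _) fun z => ?_
  rw [pairing_unitKernel]
  exact Submodule.sum_mem _ fun k _ => Submodule.smul_mem _ _
    (Submodule.le_topologicalClosure _ (feature_mem_smoothVanishing hη hσ k z))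

lemma IsWideLimit.sub_mem (hL : IsLipschitzOperator D L) (hη : IsAuxiliary D η)
    (hσ : IsActivation σ) (hν : IsInitialLaw β ν) {f : H2 D} {Q : ℝ → H2 D}
    (hQ : IsWideLimit L σ η f ν α T Q) {t : ℝ} (ht : t ∈ Icc 0 T) :
    Q t - liftH2 hη f ∈ (smoothVanishing D).topologicalClosure := by
  rw [← hQ.init_eq hη]
  exact sub_mem_topologicalClosure _ (fun s hs => hQ.hasDerivWithinAt hL hη hσ hν hs)
    (fun s _ => Submodule.smul_mem _ _ (pairing_limitKernel_mem hη hσ hν _)) ht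

variable {Y : Type*} {mY : MeasurableSpace Y} {μ : Measure Y}

lemma tendsto_eLpNorm_mul {a : ℕ → Y → ℝ} {m : Y → ℝ} {c : ℝ} (hm : ∀ᵐ x ∂μ, |m x| ≤ c)
    (ha : Tendsto (fun k => eLpNorm (a k) 2 μ) atTop (𝓝 0)) :
    Tendsto (fun k => eLpNorm (fun x => m x * a k x) 2 μ) atTop (𝓝 0) := by
  have h := ENNReal.Tendsto.const_mul (a := ENNReal.ofReal c) ha (Or.inr ENNReal.ofReal_ne_top)
  rw [mul_zero] at h
  refine tendsto_of_tendsto_of_tendsto_of_le_of_le tendsto_const_nhds h (fun _ => zero_le)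
    fun k => eLpNorm_le_mul_eLpNorm_of_ae_le_mul (hm.mono fun x hx => ?_) 2
  rw [norm_mul]
  exact mul_le_mul_of_nonneg_right hx (norm_nonneg _)

lemma tendsto_eLpNorm_add {a b : ℕ → Y → ℝ} (ham : ∀ k, AEStronglyMeasurable (a k) μ)
    (hbm : ∀ k, AEStronglyMeasurable (b k) μ)
    (ha : Tendsto (fun k => eLpNorm (a k) 2 μ) atTop (𝓝 0))
    (hb : Tendsto (fun k => eLpNorm (b k) 2 μ) atTop (𝓝 0)) :
    Tendsto (fun k => eLpNorm (fun x => a k x + b k x) 2 μ) atTop (𝓝 0) := by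
  have h := ha.add hb
  rw [add_zero] at h
  exact tendsto_of_tendsto_of_tendsto_of_le_of_le tendsto_const_nhds h (fun _ => zero_le)
    fun k => eLpNorm_add_le (ham k) (hbm k) (by norm_num)

lemma tendsto_eLpNorm_jet {u : ℕ → H2 D} {v : H2 D} (h : Tendsto u atTop (𝓝 v)) (k : JetIdx n) :
    Tendsto (fun j => eLpNorm (fun x => (u j).1 k x - v.1 k x) 2 D.μ) atTop (𝓝 0) :=
  (Lp.tendsto_Lp_iff_tendsto_eLpNorm' _ _).1
    (((PiLp.proj (𝕜 := ℝ) 2 (fun _ : JetIdx n => Lp ℝ 2 D.μ) k).continuous.tendsto _).comp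
      ((continuous_subtype_val.tendsto v).comp h))

lemma exists_bound_ae (D : Domain n) {m : E n → ℝ} (hm : Continuous m) :
    ∃ c : ℝ, ∀ᵐ x ∂D.μ, |m x| ≤ c := by
  obtain ⟨C, -, hC⟩ := exists_bound_on D hm
  exact ⟨C, D.ae_mem.mono hC⟩

lemma aestronglyMeasurable_jet (u : H2 D) (k : JetIdx n) :
    AEStronglyMeasurable (fun x => u.1 k x) D.μ := Lp.aestronglyMeasurable _

/-- Adding an element of the closure of the smooth functions vanishing on the boundary to `(1 - η) f`
does not change the boundary trace of `f`. -/
lemma HasTrace.of_sub_mem (hη : IsAuxiliary D η) {f q : H2 D} {g : Lp ℝ 2 D.surface}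
    (hfg : HasTrace D f g) (hq : q - liftH2 hη f ∈ (smoothVanishing D).topologicalClosure) :
    HasTrace D q g := by
  obtain ⟨v, hv, h0, h1, hg⟩ := hfg
  obtain ⟨u, hu, hlim⟩ := mem_closure_iff_seq_limit.1 hq
  choose w hw hw0 hwu using hu
  have hm : ContDiff ℝ 2 fun x => 1 - η x := hη.contDiff_one_sub
  have hm1 : ContDiff ℝ 1 fun x => 1 - η x := hm.of_le (by norm_num)
  have hw1 : ∀ k, ContDiff ℝ 1 (w k) := fun k => (hw k).of_le (by norm_num)
  obtain ⟨c, hc⟩ := exists_bound_ae D hm.continuous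
  have hq0 : ∀ k : JetIdx n, ∀ᵐ x ∂D.μ, (q - liftH2 hη f).1 k x = q.1 k x - (liftH2 hη f).1 k x :=
    fun k => Lp.coeFn_sub (q.1 k) ((liftH2 hη f).1 k)
  refine ⟨fun k x => (1 - η x) * v k x + w k x, fun k => (hm1.mul (hv k)).add (hw1 k), ?_,
    fun i => ?_, ?_⟩
  · have a1 := tendsto_eLpNorm_add
      (fun k => hm.continuous.aestronglyMeasurable.mul
        ((hv k).continuous.aestronglyMeasurable.sub (aestronglyMeasurable_jet f (Sum.inl ()))))
      (fun k => (aestronglyMeasurable_jet (u k) (Sum.inl ())).sub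
        (aestronglyMeasurable_jet (q - liftH2 hη f) (Sum.inl ())))
      (tendsto_eLpNorm_mul hc h0) (tendsto_eLpNorm_jet hlim (Sum.inl ()))
    refine a1.congr fun k => eLpNorm_congr_ae ?_
    filter_upwards [hq0 (Sum.inl ()), fn_liftH2 hη f, fn_ofC2 (D := D) (hw k)] with x e1 e2 e3
    have e3' : (u k).1 (Sum.inl ()) x = w k x := by rw [hwu k]; exact e3
    have e2' : (liftH2 hη f).1 (Sum.inl ()) x = (1 - η x) * H2.fn f x := e2
    have e4 : H2.fn q x = q.1 (Sum.inl ()) x := rfl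
    have e5 : H2.fn f x = f.1 (Sum.inl ()) x := rfl
    simp only [Pi.mul_apply, Pi.sub_apply]
    rw [e1, e3', e2', e4, e5]
    ring
  · obtain ⟨c', hc'⟩ := exists_bound_ae D (continuous_partialDeriv hm1 i)
    have a1 := tendsto_eLpNorm_add
      (fun k => hm.continuous.aestronglyMeasurable.mul
        ((continuous_partialDeriv (hv k) i).aestronglyMeasurable.sub
          (aestronglyMeasurable_jet f (Sum.inr (Sum.inl i)))))
      (fun k => (aestronglyMeasurable_jet (u k) (Sum.inr (Sum.inl i))).sub
        (aestronglyMeasurable_jet (q - liftH2 hη f) (Sum.inr (Sum.inl i))))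
      (tendsto_eLpNorm_mul hc (h1 i)) (tendsto_eLpNorm_jet hlim (Sum.inr (Sum.inl i)))
    have a2 := tendsto_eLpNorm_add
      (fun k => (continuous_partialDeriv hm1 i).aestronglyMeasurable.mul
        ((hv k).continuous.aestronglyMeasurable.sub (aestronglyMeasurable_jet f (Sum.inl ()))))
      (fun k => (hm.continuous.aestronglyMeasurable.mul
        ((continuous_partialDeriv (hv k) i).aestronglyMeasurable.sub
          (aestronglyMeasurable_jet f (Sum.inr (Sum.inl i))))).add
        ((aestronglyMeasurable_jet (u k) (Sum.inr (Sum.inl i))).sub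
        (aestronglyMeasurable_jet (q - liftH2 hη f) (Sum.inr (Sum.inl i)))))
      (tendsto_eLpNorm_mul hc' h0) a1
    refine a2.congr fun k => eLpNorm_congr_ae ?_
    filter_upwards [hq0 (Sum.inr (Sum.inl i)), d1_liftH2 hη f i, d1_ofC2 (D := D) (hw k) i]
      with x e1 e2 e3
    have e3' : (u k).1 (Sum.inr (Sum.inl i)) x = partialDeriv i (w k) x := by rw [hwu k]; exact e3
    have e2' : (liftH2 hη f).1 (Sum.inr (Sum.inl i)) x =
      partialDeriv i (fun x => 1 - η x) x * H2.fn f x + (1 - η x) * H2.d1 f i x := e2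
    have e4 : H2.d1 q i x = q.1 (Sum.inr (Sum.inl i)) x := rfl
    have e5 : H2.fn f x = f.1 (Sum.inl ()) x := rfl
    have e6 : H2.d1 f i x = f.1 (Sum.inr (Sum.inl i)) x := rfl
    have e7 : partialDeriv i (fun x => (1 - η x) * v k x + w k x) x =
        partialDeriv i (fun x => 1 - η x) x * v k x + (1 - η x) * partialDeriv i (v k) x +
          partialDeriv i (w k) x := by
      rw [partialDeriv_add (((hm1.mul (hv k)).differentiable one_ne_zero) x)
        ((hw1 k).differentiable one_ne_zero x) i,
        partialDeriv_mul (hm1.differentiable one_ne_zero x) ((hv k).differentiable one_ne_zero x) i]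
    simp only [Pi.add_apply, Pi.mul_apply, Pi.sub_apply]
    rw [e1, e3', e2', e4, e5, e6, e7]
    ring
  · refine hg.congr fun k => eLpNorm_congr_ae ?_
    filter_upwards [ae_restrict_mem isClosed_frontier.measurableSet] with x hx
    rw [hη.boundary x hx, hw0 k x hx]
    ring

end Trace

/-! ### Convergence of the trained approximator -/

section Convergence

/-- Convergence of expectations under a bound by a vanishing random error plus a deterministic error
which is eventually smaller than every positive number. -/
lemma tendsto_integral_of_ae_le {S : Type*} [MeasurableSpace S] {P : Measure S}
    [IsProbabilityMeasure P] {X e : ℕ → S → ℝ} {C : ℝ} (hC : 0 ≤ C)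
    (hX : ∀ N, 0 < N → Integrable (X N) P) (hX0 : ∀ N s, 0 ≤ X N s)
    (he : ∀ N, Integrable (e N) P)
    (hlim : Tendsto (fun N => ∫ s, e N s ∂P) atTop (𝓝 0))
    (h : ∀ ε : ℝ, 0 < ε → ∀ᶠ N in atTop, ∀ᵐ s ∂P, X N s ≤ C * (e N s + ε)) :
    Tendsto (fun N => ∫ s, X N s ∂P) atTop (𝓝 0) := by
  refine tendsto_order.2 ⟨fun a ha => Eventually.of_forall fun N =>
    ha.trans_le (integral_nonneg (hX0 N)), fun a ha => ?_⟩
  have hε : 0 < a / (2 * (C + 1)) := by positivity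
  filter_upwards [h _ hε, hlim.eventually_lt_const hε, eventually_gt_atTop 0] with N h1 h2 h3
  have h4 : ∫ s, X N s ∂P ≤ ∫ s, C * (e N s + a / (2 * (C + 1))) ∂P :=
    integral_mono_ae (hX N h3) (((he N).add (integrable_const _)).const_mul C) h1
  rw [integral_const_mul, integral_add (he N) (integrable_const _), integral_const, probReal_univ,
    one_smul] at h4
  refine h4.trans_lt ?_
  have h5 : C * ((∫ s, e N s ∂P) + a / (2 * (C + 1))) ≤ C * (2 * (a / (2 * (C + 1)))) :=
    mul_le_mul_of_nonneg_left (by linarith) hC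
  refine h5.trans_lt ?_
  have h6 : C * (2 * (a / (2 * (C + 1)))) = a * (C / (C + 1)) := by field_simp
  rw [h6]
  exact mul_lt_of_lt_one_right ha ((div_lt_one (by linarith)).2 (by linarith))

variable {n : ℕ} {D : Domain n} {η : E n → ℝ} {σ : ℝ → ℝ} {β δ α T : ℝ} {ψ : ℕ → ℝ → ℝ}
  {L : H2 D → (E n →ₘ[D.μ] ℝ)} {ν : Measure (ℝ × E n × ℝ)} {S : Type*} [MeasurableSpace S]
  {P : Measure S} {ξ : (N : ℕ) → Fin N → S → ℝ × E n × ℝ}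

lemma IsInitialization.ae_abs_le (hξ : IsInitialization P ν ξ) {K : ℝ}
    (hK : ∀ᵐ z ∂ν, |z.1| ≤ K) (N : ℕ) : ∀ᵐ s ∂P, ∀ i, |(ξ N i s).1| ≤ K := by
  refine ae_all_iff.2 fun i => ?_
  rw [← hξ.law N i] at hK
  exact ae_of_ae_map (hξ.measurable N i).aemeasurable hK

variable [IsProbabilityMeasure P]

/-- Trained approximators are integrable and converge in mean to the solution of the limiting
differential equation. -/
theorem integrable_and_tendsto_netH2 (hL : IsLipschitzOperator D L) {f : H2 D}
    (hη : IsAuxiliary D η) (hσ : IsActivation σ) (hβ : 1 / 2 < β) (hβ' : β < 1) (hα : 0 ≤ α)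
    (hψ : IsTruncation β δ ψ) (hν : IsInitialLaw β ν) (hξ : IsInitialization P ν ξ)
    {θ : (N : ℕ) → S → ℝ → Param n N}
    (hθ : ∀ N, 0 < N → ∀ᵐ s ∂P, IsTrainedPath L σ β η f ψ α T (fun i => ξ N i s) (θ N s))
    {Q : ℝ → H2 D} (hQ : IsWideLimit L σ η f ν α T Q) {t : ℝ} (ht : t ∈ Icc 0 T) :
    (∀ N, 0 < N → Integrable (fun s => ‖netH2 hη hσ β f (θ N s t) - Q t‖) P) ∧
      Tendsto (fun N : ℕ => ∫ s, ‖netH2 hη hσ β f (θ N s t) - Q t‖ ∂P) atTop (𝓝 0) := by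
  have hT : 0 ≤ T := ht.1.trans ht.2
  obtain ⟨K, hK1, hK⟩ := hν.exists_bound
  obtain ⟨C, hC0, hC⟩ := exists_norm_netH2_sub_le hL hη hσ hψ hν hβ' hα hT hK1 hQ
  have hv : ContinuousOn (fun t => opL2 hL (Q t)) (Icc 0 T) :=
    (continuous_opL2 hL).comp_continuousOn hQ.continuousOn
  have hfl := fun N => integrable_fluctuation (D := D) hη hσ hν hξ hβ hβ' δ N
  have hae : ∀ N, 0 < N → ∀ r : ℝ,
      (∀ t ∈ Icc 0 T, ‖excessL2 (thr_nonneg δ N) (opL2 hL (Q t))‖ ≤ r) →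
      ∀ᵐ s ∂P, ‖netH2 hη hσ β f (θ N s t) - Q t‖ ≤
        C * (fluctuation (D := D) hη hσ β δ ν (fun i => ξ N i s) + r) := fun N hN r hr => by
    filter_upwards [hθ N hN, hξ.ae_abs_le hK N] with s h1 h2
    exact hC N hN _ _ h1 h2 r hr t ht
  have hint : ∀ N, 0 < N → Integrable (fun s => ‖netH2 hη hσ β f (θ N s t) - Q t‖) P := by
    intro N hN
    obtain ⟨r, hr⟩ := (isCompact_Icc (a := (0 : ℝ)) (b := T)).exists_bound_of_continuousOn
      (((lipschitzWith_excess _).continuous_compLp (excess_zero (thr_nonneg δ N))).comp_continuousOn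
        hv)
    refine (((hfl N).add (integrable_const r)).const_mul C).mono' ?_ ?_
    · have hm := aemeasurable_trained hL hη hσ hψ hβ' hα hξ hK1 hN (hθ N hN) (hξ.ae_abs_le hK N) ht
      have hc : Continuous fun θ : Param n N => ‖netH2 hη hσ β f θ - Q t‖ :=
        ((continuous_netH2 hη hσ β f).sub continuous_const).norm
      exact hc.comp_aestronglyMeasurable hm.aestronglyMeasurable
    · filter_upwards [hae N hN r hr] with s hs
      rw [norm_norm]
      exact hs
  refine ⟨hint, tendsto_integral_of_ae_le hC0 hint (fun _ _ => norm_nonneg _) hfl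
    (tendsto_integral_fluctuation hη hσ hν hξ hβ hβ' hψ.lt) fun ε hε => ?_⟩
  filter_upwards [eventually_norm_excessL2_le hψ.pos hv hε, eventually_gt_atTop 0] with N h1 hN
  exact hae N hN ε h1

end Convergence

end QPDE

end

theorem theorem4 {n : ℕ} (D : QPDE.Domain n)
    (L : QPDE.H2 D → (QPDE.E n →ₘ[D.μ] ℝ)) (hL : QPDE.IsLipschitzOperator D L)
    (f : QPDE.H2 D) (g : Lp ℝ 2 D.surface) (hfg : QPDE.HasTrace D f g)
    (η : QPDE.E n → ℝ) (hη : QPDE.IsAuxiliary D η)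
    (σ : ℝ → ℝ) (hσ : QPDE.IsActivation σ)
    (β δ α T : ℝ) (hβ : 1 / 2 < β) (hβ' : β < 1) (hα : 0 < α)
    (ψ : ℕ → ℝ → ℝ) (hψ : QPDE.IsTruncation β δ ψ)
    (ν : Measure (ℝ × QPDE.E n × ℝ)) (hν : QPDE.IsInitialLaw β ν)
    {S : Type*} [MeasurableSpace S] (P : Measure S) [IsProbabilityMeasure P]
    (ξ : (N : ℕ) → Fin N → S → ℝ × QPDE.E n × ℝ) (hξ : QPDE.IsInitialization P ν ξ)
    (θ : (N : ℕ) → S → ℝ → QPDE.Param n N)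
    (hθ : ∀ N, 0 < N → ∀ᵐ s ∂P,
      QPDE.IsTrainedPath L σ β η f ψ α T (fun i => ξ N i s) (θ N s))
    (Q : ℝ → QPDE.H2 D) (hQ : QPDE.IsWideLimit L σ η f ν α T Q)
    (t : ℝ) (ht : t ∈ Icc 0 T) :
    (∀ N, 0 < N → (∀ s, QPDE.MemH2 D (QPDE.netQ σ β η f (θ N s t))) ∧
      Integrable (fun s => ‖QPDE.toH2 D (QPDE.netQ σ β η f (θ N s t)) - Q t‖) P) ∧
    Tendsto (fun N : ℕ =>
      ∫ s, ‖QPDE.toH2 D (QPDE.netQ σ β η f (θ N s t)) - Q t‖ ∂P) atTop (𝓝 0) ∧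
    QPDE.HasTrace D (Q t) g := by
  obtain ⟨h1, h2⟩ := QPDE.integrable_and_tendsto_netH2 hL hη hσ hβ hβ' hα.le hψ hν hξ hθ hQ ht
  simp only [QPDE.toH2_netQ hη hσ]
  exact ⟨fun N hN => ⟨fun s => QPDE.memH2_netQ hη hσ β f _, h1 N hN⟩, h2,
    hfg.of_sub_mem hη (hQ.sub_mem hL hη hσ hν ht)⟩
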